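/- Setting. Let $n,t\ge 1$, let $\mathcal H=(\mathbb C^d)^{\otimes n}$, let $R$ be a unitary representation of a group $G$ on $\mathcal H$, and let $\mathcal U_{n,G,R}$ be the group of unitaries on $\mathcal H$ commuting with all $R(g)$. Fix a decomposition into irreducible representations, $R(g)=\sum_{\lambda\in\Lambda}F_\lambda(R_\lambda(g)\otimes I)F_\lambda^\dagger$, where the $R_\lambda$ are pairwise inequivalent irreducible unitary representations on $\mathbb C^{r_\lambda}$, the multiplicities $m_\lambda$ are positive, and the $F_\lambda:\mathbb C^{r_\lambda}\otimes\mathbb C^{m_\lambda}\to\mathcal H$ are isometries with mutually orthogonal ranges that together span $\mathcal H$. Every operator $A$ commuting with $R$ is uniquely of the form $A=\sum_\lambda F_\lambda(I\otimes A_\lambda)F_\lambda^\dagger$; put $\bm f(A)=(\mathrm{tr}\,A_\lambda)_{\lambda\in\Lambda}$. A subset $\mathcal X\subset\mathcal U_{n,G,R}$ is *semi-universal* if $\langle\mathcal X\rangle\cdot Z(\mathcal U_{n,G,R})=\mathcal U_{n,G,R}$, where $\langle\mathcal X\rangle$ is the generated subgroup and $Z$ denotes the centre. For a probability measure $\nu$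 on $\mathcal U_{n,G,R}$ put $M_{t,\nu}=\int U^{\otimes t}\otimes (U^{*})^{\otimes t}\,d\nu(U)$, with $U^*$ the complex conjugate of $U$; $\nu$ is an *asymptotic $(G,R)$-symmetric unitary $t$-design* if $\lim_{D\to\infty}(M_{t,\nu})^D=M_{t,\mu}$, where $\mu$ is the normalized Haar measure of $\mathcal U_{n,G,R}$. Theorem. Let $\{\mathcal S^\gamma\}_{\gamma\in\Gamma}$ be a finite family of connected compact subgroups of $\mathcal U_{n,G,R}$ such that $\bigcup_\gamma\mathcal S^\gamma$ is semi-universal, let $p^\gamma>0$ with $\sum_\gamma p^\gamma=1$, and let $\zeta=\sum_\gamma p^\gamma\mu_{\mathcal S^\gamma}$ be the mixture of the normalized Haar measures. Let $\mathfrak s^\gamma$ be the Lie algebra of $\mathcal S^\gamma$ (the tangent space at the identity divided by $i$) and $\mathcal V=\mathrm{span}_{\mathbb R}\{\bm f(A): A\in\mathfrak s^\gamma \text{ for some }\gamma\in\Gamma\}$. Then $\zeta$ is an asymptotic $(G,R)$-symmetric unitary $t$-design if and only if there is no nonzero $x\in\mathbb Z^\Lambda$ satisfying (1) $\sum_\lambda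 m_\lambda|x_\lambda|\le 2t$, (2) $\sum_\lambda m_\lambda x_\lambda=0$, (3) $\sum_\lambda v_\lambda x_\lambda=0$ for all $v\in\mathcal V$. Suppose in particular that $R=T^{\otimes n}$ for a unitary representation $T$ of $G$ on $\mathbb C^d$, and that, for a nonempty finite family of sets $\gamma\subset\{1,\dots,n\}$, $\mathcal S^\gamma$ is the group $\mathcal U^\gamma_{n,G,R}$ of all elements of $\mathcal U_{n,G,R}$ that act as the identity outside the qudits in $\gamma$. Let $k=\max_\gamma\#\gamma$. Then for every $x\in\mathbb Z^\Lambda$ the conditions (2) and (3) together are equivalent to (4) $\sum_\lambda c_\lambda x_\lambda=0$ for all $c\in\mathcal C$, where $\mathcal C=\{\bm f(A\otimes I^{\otimes n-k}) : A \text{ an operator on } (\mathbb C^d)^{\otimes k} \text{ commuting with } T(g)^{\otimes k} \text{ for all } g\in G\}$; hence, if $\bigcup_\gamma\mathcal U^\gamma_{n,G,R}$ is semi-universal, $\zeta$ is an asymptotic $(G,R)$-symmetric unitary $t$-design if and only if no nonzero $x\in\mathbb Z^\Lambda$ satisfies (1) and (4). -/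

import Mathlib

open Matrix Filter Topology MeasureTheory
open scoped BigOperators Kronecker Pointwise ENNReal

noncomputable section

namespace SymDesign

/-! ### Tensor powers and local operators -/

/-- The tensor power `M^{⊗ ι}`, acting on `⨂_{s ∈ ι} ℂ^I = ℂ^(ι → I)`. -/
def tensorPow (ι : Type*) [Fintype ι] {I : Type*} (M : Matrix I I ℂ) :
    Matrix (ι → I) (ι → I) ℂ :=
  Matrix.of fun a b => ∏ s, M (a s) (b s)

theorem tensorPow_one (ι : Type*) [Fintype ι] [DecidableEq ι] {I : Type*} [DecidableEq I] :
    tensorPow ι (1 : Matrix I I ℂ) = 1 := by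
  ext a b
  simp only [tensorPow, Matrix.of_apply, Matrix.one_apply]
  rw [Finset.prod_ite_zero]
  simp [funext_iff]

theorem tensorPow_mul (ι : Type*) [Fintype ι] [DecidableEq ι] {I : Type*} [Fintype I]
    (M N : Matrix I I ℂ) :
    tensorPow ι (M * N) = tensorPow ι M * tensorPow ι N := by
  ext a b
  simp only [tensorPow, Matrix.of_apply, Matrix.mul_apply]
  rw [Finset.prod_univ_sum]
  simp [Finset.prod_mul_distrib]

theorem tensorPow_star (ι : Type*) [Fintype ι] {I : Type*} (M : Matrix I I ℂ) :
    tensorPow ι (star M) = star (tensorPow ι M) := by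
  ext a b
  simp [tensorPow, Matrix.star_apply]

/-- The tensor power `T^{⊗ ι}` of a unitary representation `T`. -/
def tensorPowRep (ι : Type*) [Fintype ι] [DecidableEq ι] {I : Type*} [Fintype I] [DecidableEq I]
    {G : Type*} [Group G] (T : G →* Matrix.unitaryGroup I ℂ) :
    G →* Matrix.unitaryGroup (ι → I) ℂ where
  toFun g := ⟨tensorPow ι (T g : Matrix I I ℂ), by
    rw [Matrix.mem_unitaryGroup_iff, ← tensorPow_star, ← tensorPow_mul,
      Matrix.mem_unitaryGroup_iff.mp (T g).2, tensorPow_one]⟩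
  map_one' := by
    ext1
    simp [tensorPow_one]
  map_mul' g h := by
    ext1
    simp [tensorPow_mul]

/-- For an injection `e : ι ↪ κ` of sites, the operator on the `κ`-qudit space that acts as `A`
on the sites in the range of `e` and as the identity on all other sites. -/
def embedOp {ι κ : Type*} {I : Type*} (e : ι ↪ κ) (A : Matrix (ι → I) (ι → I) ℂ) :
    Matrix (κ → I) (κ → I) ℂ :=
  open Classical in
  Matrix.of fun a b =>
    if ∀ s, s ∉ Set.range e → a s = b s then A (a ∘ e) (b ∘ e) else 0

theorem embedOp_one {ι κ I : Type*} [Fintype ι] [Fintype κ] [DecidableEq ι] [DecidableEq κ]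
    [DecidableEq I] (e : ι ↪ κ) :
    embedOp e (1 : Matrix (ι → I) (ι → I) ℂ) = 1 := by
  ext a b
  simp only [embedOp, Matrix.of_apply, Matrix.one_apply]
  by_cases hab : a = b
  · simp [hab]
  · rw [if_neg hab]
    split_ifs with h1 h2
    · exact absurd (funext fun s => by
        by_cases hs : s ∈ Set.range e
        · obtain ⟨i, rfl⟩ := hs
          exact congrFun h2 i
        · exact h1 s hs) hab
    · rfl
    · rfl

theorem embedOp_star {ι κ I : Type*} (e : ι ↪ κ) (A : Matrix (ι → I) (ι → I) ℂ) :
    embedOp e (star A) = star (embedOp e A) := by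
  ext a b
  simp only [embedOp, Matrix.of_apply, Matrix.star_apply, apply_ite star, star_zero]
  congr 1
  simp only [eq_comm]

theorem embedOp_mul {ι κ I : Type*} [Fintype ι] [Fintype κ] [Fintype I]
    [DecidableEq ι] [DecidableEq κ] [DecidableEq I]
    (e : ι ↪ κ) (A B : Matrix (ι → I) (ι → I) ℂ) :
    embedOp e (A * B) = embedOp e A * embedOp e B := by
  classical
  ext a b
  simp only [embedOp, Matrix.of_apply, Matrix.mul_apply]
  split_ifs with h
  · have hg : ∀ c : ι → I, ∃ c' : κ → I, c' ∘ e = c ∧ ∀ s, s ∉ Set.range e → a s = c' s :=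
      fun c => ⟨fun s => if hs : s ∈ Set.range e then c hs.choose else a s, by
        funext i
        have hi : e i ∈ Set.range e := ⟨i, rfl⟩
        simp only [Function.comp_apply, dif_pos hi]
        exact congrArg c (e.injective hi.choose_spec), fun s hs => by simp only [dif_neg hs]⟩
    choose g hg1 hg2 using hg
    refine Finset.sum_bij_ne_zero (fun c _ _ => g c) (fun _ _ _ => Finset.mem_univ _) ?_ ?_ ?_
    · intro c _ _ c' _ _ hcc
      rw [← hg1 c, ← hg1 c', hcc]
    · intro c' _ hne
      have h1 : ∀ s, s ∉ Set.range e → a s = c' s := by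
        by_contra hcon
        exact hne (by rw [if_neg hcon, zero_mul])
      have hgc : g (c' ∘ e) = c' := by
        funext s
        by_cases hs : s ∈ Set.range e
        · obtain ⟨i, rfl⟩ := hs
          exact congrFun (hg1 (c' ∘ e)) i
        · rw [← hg2 _ s hs, h1 s hs]
      refine ⟨c' ∘ e, Finset.mem_univ _, ?_, hgc⟩
      have h2 : ∀ s, s ∉ Set.range e → c' s = b s := fun s hs => by rw [← h1 s hs, h s hs]
      rwa [if_pos h1, if_pos h2] at hne
    · intro c _ _
      have h2 : ∀ s, s ∉ Set.range e → g c s = b s := fun s hs => by rw [← hg2 c s hs, h s hs]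
      rw [if_pos (hg2 c), if_pos h2, hg1]
  · symm
    refine Finset.sum_eq_zero fun c _ => ?_
    by_cases h1 : ∀ s, s ∉ Set.range e → a s = c s
    · rw [if_neg (c := ∀ s, s ∉ Set.range e → c s = b s), mul_zero]
      exact fun h2 => h fun s hs => (h1 s hs).trans (h2 s hs)
    · rw [if_neg h1, zero_mul]

/-- `embedOp` as a linear map. -/
def embedLin {ι κ : Type*} {I : Type*} (e : ι ↪ κ) :
    Matrix (ι → I) (ι → I) ℂ →ₗ[ℂ] Matrix (κ → I) (κ → I) ℂ where
  toFun := embedOp e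
  map_add' A B := by
    ext a b
    simp only [embedOp, Matrix.of_apply, Matrix.add_apply]
    split_ifs <;> simp
  map_smul' c A := by
    ext a b
    simp [embedOp]

/-! ### Symmetric operators and unitaries -/

section Symmetric

variable {I : Type*} [Fintype I] [DecidableEq I] {G : Type*} [Group G]

/-- The operators commuting with `R g` for all `g`. -/
def symOps (R : G →* Matrix.unitaryGroup I ℂ) : Set (Matrix I I ℂ) :=
  {A | ∀ g, A * (R g : Matrix I I ℂ) = (R g : Matrix I I ℂ) * A}

/-- The group of `(G, R)`-symmetric unitaries. -/
def symUnitary (R : G →* Matrix.unitaryGroup I ℂ) : Subgroup (Matrix.unitaryGroup I ℂ) where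
  carrier := {U | ∀ g, U * R g = R g * U}
  one_mem' g := by simp
  mul_mem' {U V} hU hV g := by rw [mul_assoc, hV g, ← mul_assoc, hU g, mul_assoc]
  inv_mem' {U} hU g := by
    rw [inv_mul_eq_iff_eq_mul, ← mul_assoc, hU g, mul_assoc, mul_inv_cancel, mul_one]

/-- The centre of the group of symmetric unitaries, as a subset of the unitary group. -/
def symCenter (R : G →* Matrix.unitaryGroup I ℂ) : Set (Matrix.unitaryGroup I ℂ) :=
  {U | U ∈ symUnitary R ∧ ∀ V ∈ symUnitary R, U * V = V * U}

/-- `X` is semi-universal: `⟨X⟩ · Z(𝒰) = 𝒰` for the group `𝒰` of symmetric unitaries. -/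
def SemiUniversal (R : G →* Matrix.unitaryGroup I ℂ) (X : Set (Matrix.unitaryGroup I ℂ)) : Prop :=
  (Subgroup.closure X : Set (Matrix.unitaryGroup I ℂ)) * symCenter R =
    (symUnitary R : Set (Matrix.unitaryGroup I ℂ))

/-- The Lie algebra of a closed subgroup of the unitary group, i.e. its tangent space at the
identity divided by `i`, as usual for matrix groups given by the `A` whose one-parameter group
`θ ↦ e^{iθA}` stays in the subgroup. -/
def lieAlg (S : Subgroup (Matrix.unitaryGroup I ℂ)) : Set (Matrix I I ℂ) :=
  {A | ∀ θ : ℝ, ∃ U ∈ S, (U : Matrix I I ℂ) = NormedSpace.exp (((θ : ℂ) * Complex.I) • A)}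

theorem isCompact_unitaryGroup :
    IsCompact {M : Matrix I I ℂ | M ∈ Matrix.unitaryGroup I ℂ} := by
  have hK : IsCompact (Set.univ.pi fun _ : I => Set.univ.pi fun _ : I =>
      Metric.closedBall (0 : ℂ) 1) :=
    isCompact_univ_pi fun _ => isCompact_univ_pi fun _ => isCompact_closedBall _ _
  refine IsCompact.of_isClosed_subset (X := Matrix I I ℂ) hK ?_ ?_
  · simp only [Matrix.mem_unitaryGroup_iff]
    exact isClosed_eq (by fun_prop) continuous_const
  · intro M hM i _ j _
    simpa using entry_norm_bound_of_unitary hM i j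

instance : CompactSpace (Matrix.unitaryGroup I ℂ) :=
  isCompact_iff_compactSpace.mp (isCompact_unitaryGroup (I := I))

theorem isCompact_symUnitary (R : G →* Matrix.unitaryGroup I ℂ) :
    IsCompact (symUnitary R : Set (Matrix.unitaryGroup I ℂ)) := by
  refine IsClosed.isCompact ?_
  have : (symUnitary R : Set (Matrix.unitaryGroup I ℂ)) = ⋂ g, {U | U * R g = R g * U} := by
    ext U
    simp [symUnitary]
  rw [this]
  exact isClosed_iInter fun g => isClosed_eq (by fun_prop) (by fun_prop)

end Symmetric

/-! ### Haar measures, moment operators, designs -/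

section Design

variable {I : Type*} [Fintype I] [DecidableEq I] {G : Type*} [Group G]

instance : MeasurableSpace (Matrix.unitaryGroup I ℂ) := borel _

instance : BorelSpace (Matrix.unitaryGroup I ℂ) := ⟨rfl⟩

/-- The normalized Haar measure of a compact subgroup `S`, as a measure on the unitary group. -/
def haarOn (S : Subgroup (Matrix.unitaryGroup I ℂ))
    (hS : IsCompact (S : Set (Matrix.unitaryGroup I ℂ))) : Measure (Matrix.unitaryGroup I ℂ) :=
  haveI : CompactSpace S := isCompact_iff_compactSpace.mp hS
  (Measure.haarMeasure (⊤ : TopologicalSpace.PositiveCompacts S)).map Subtype.val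

/-- The mixture `∑ γ, p γ • μ_{S γ}` of the normalized Haar measures. -/
def haarMixture {Γ : Type*} [Fintype Γ] (p : Γ → ℝ)
    (S : Γ → Subgroup (Matrix.unitaryGroup I ℂ))
    (hS : ∀ γ, IsCompact (S γ : Set (Matrix.unitaryGroup I ℂ))) :
    Measure (Matrix.unitaryGroup I ℂ) :=
  ∑ γ, ENNReal.ofReal (p γ) • haarOn (S γ) (hS γ)

/-- The moment operator `∫ U^{⊗t} ⊗ (U^*)^{⊗t} dν(U)` (integrated entrywise), where `U^*` is the
entrywise complex conjugate of `U`. -/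
def momentOp (t : ℕ) (ν : Measure (Matrix.unitaryGroup I ℂ)) :
    Matrix ((Fin t → I) × (Fin t → I)) ((Fin t → I) × (Fin t → I)) ℂ :=
  Matrix.of fun a b => ∫ U : Matrix.unitaryGroup I ℂ,
    (tensorPow (Fin t) (U : Matrix I I ℂ) ⊗ₖ
      tensorPow (Fin t) ((U : Matrix I I ℂ).map star)) a b ∂ν

/-- `ν` is an asymptotic `(G, R)`-symmetric unitary `t`-design. -/
def IsAsymptoticDesign (R : G →* Matrix.unitaryGroup I ℂ) (t : ℕ)
    (ν : Measure (Matrix.unitaryGroup I ℂ)) : Prop :=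
  Tendsto (fun D : ℕ => momentOp t ν ^ D) atTop
    (𝓝 (momentOp t (haarOn (symUnitary R) (isCompact_symUnitary R))))

end Design

/-! ### Decomposition into irreducible representations -/

section Decomposition

variable {I : Type*} [Fintype I] [DecidableEq I] {G : Type*} [Group G]

/-- A unitary representation by matrices as a representation on `ℂ^I`. -/
def toRep (ρ : G →* Matrix.unitaryGroup I ℂ) : Representation ℂ G (I → ℂ) :=
  ((Matrix.toLinAlgEquiv' : Matrix I I ℂ ≃ₐ[ℂ] _) : Matrix I I ℂ →* _).comp
    ((Matrix.unitaryGroup I ℂ).subtype.comp ρ)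

/-- A decomposition `ℂ^I ≅ ⨁_λ ℂ^{r λ} ⊗ ℂ^{m λ}` of the unitary representation `R` into
irreducible representations: `R g = ∑_λ F_λ (R_λ g ⊗ 1) F_λ†`, with pairwise inequivalent
irreducible `R_λ`, multiplicities `m λ > 0`, and isometries `F_λ` with orthogonal ranges that
together span the space. -/
structure IrrepDecomposition (R : G →* Matrix.unitaryGroup I ℂ) (Λ : Type*) [Fintype Λ] where
  /-- dimension of the irreducible representation -/
  r : Λ → ℕ
  /-- multiplicity -/
  m : Λ → ℕ
  m_pos : ∀ l, 0 < m l
  /-- the irreducible representations -/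
  irr : ∀ l, G →* Matrix.unitaryGroup (Fin (r l)) ℂ
  irreducible : ∀ l, (toRep (irr l)).IsIrreducible
  inequivalent : ∀ l l', l ≠ l' → IsEmpty ((toRep (irr l)).Equiv (toRep (irr l')))
  /-- the isometric embeddings -/
  F : ∀ l, Matrix I (Fin (r l) × Fin (m l)) ℂ
  isometry : ∀ l, (F l)ᴴ * F l = 1
  orthogonal : ∀ l l', l ≠ l' → (F l)ᴴ * F l' = 0
  complete : ∑ l, F l * (F l)ᴴ = 1
  decomp : ∀ g, (R g : Matrix I I ℂ) =
    ∑ l, F l * ((irr l g : Matrix (Fin (r l)) (Fin (r l)) ℂ) ⊗ₖ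
      (1 : Matrix (Fin (m l)) (Fin (m l)) ℂ)) * (F l)ᴴ

namespace IrrepDecomposition

variable {R : G →* Matrix.unitaryGroup I ℂ} {Λ : Type*} [Fintype Λ]

/-- The block `A_λ` of a symmetric operator `A = ∑_λ F_λ (1 ⊗ A_λ) F_λ†`, read off by averaging
`F_λ† A F_λ` over the first tensor factor; see `block_eq`. -/
def block (D : IrrepDecomposition R Λ) (A : Matrix I I ℂ) (l : Λ) :
    Matrix (Fin (D.m l)) (Fin (D.m l)) ℂ :=
  Matrix.of fun α β => (D.r l : ℂ)⁻¹ * ∑ a, ((D.F l)ᴴ * A * D.F l) (a, α) (a, β)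

theorem r_ne_zero (D : IrrepDecomposition R Λ) (l : Λ) : D.r l ≠ 0 := by
  intro h
  have := D.irreducible l
  have : IsEmpty (Fin (D.r l)) := by rw [h]; infer_instance
  obtain ⟨x, y, hxy⟩ := exists_pair_ne (Subrepresentation (toRep (D.irr l)))
  refine hxy (SetLike.ext fun v => ?_)
  rw [Subsingleton.elim v 0]
  exact ⟨fun _ => y.toSubmodule.zero_mem, fun _ => x.toSubmodule.zero_mem⟩

/-- The blocks are determined by `A = ∑_λ F_λ (1 ⊗ A_λ) F_λ†`. -/
theorem block_eq (D : IrrepDecomposition R Λ) (A : Matrix I I ℂ)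
    (B : ∀ l, Matrix (Fin (D.m l)) (Fin (D.m l)) ℂ)
    (h : A = ∑ l, D.F l * ((1 : Matrix (Fin (D.r l)) (Fin (D.r l)) ℂ) ⊗ₖ B l) * (D.F l)ᴴ)
    (l : Λ) : D.block A l = B l := by
  classical
  have key : (D.F l)ᴴ * A * D.F l = (1 : Matrix (Fin (D.r l)) (Fin (D.r l)) ℂ) ⊗ₖ B l := by
    rw [h, Matrix.mul_sum, Matrix.sum_mul, Finset.sum_eq_single l]
    · calc _ = ((D.F l)ᴴ * D.F l) * ((1 : Matrix (Fin (D.r l)) (Fin (D.r l)) ℂ) ⊗ₖ B l) *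
            ((D.F l)ᴴ * D.F l) := by simp only [Matrix.mul_assoc]
        _ = _ := by rw [D.isometry]; simp
    · intro l' _ hne
      calc _ = ((D.F l)ᴴ * D.F l') * (((1 : Matrix (Fin (D.r l')) (Fin (D.r l')) ℂ) ⊗ₖ B l') *
            (D.F l')ᴴ * D.F l) := by simp only [Matrix.mul_assoc]
        _ = _ := by rw [D.orthogonal l l' hne.symm]; simp
    · simp
  have hr : (D.r l : ℂ) ≠ 0 := by exact_mod_cast D.r_ne_zero l
  ext α β
  simp [block, key, Matrix.kroneckerMap_apply, hr]

/-- The vector `f(A) = (tr A_λ)_λ` of sector traces. -/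
def traceVec (D : IrrepDecomposition R Λ) (A : Matrix I I ℂ) : Λ → ℂ :=
  fun l => (D.block A l).trace

/-- The real span of the trace vectors of the Lie algebras of the subgroups `S γ`. -/
def relPhaseSpace (D : IrrepDecomposition R Λ) {Γ : Type*}
    (S : Γ → Subgroup (Matrix.unitaryGroup I ℂ)) : Submodule ℝ (Λ → ℂ) :=
  Submodule.span ℝ {v | ∃ γ, ∃ A ∈ lieAlg (S γ), v = D.traceVec A}

end IrrepDecomposition

end Decomposition


/-! ### Existence of decompositions -/

section Existence

variable {I : Type*} [Fintype I] [DecidableEq I] {G : Type*} [Group G]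

theorem toRep_apply (ρ : G →* Matrix.unitaryGroup I ℂ) (g : G) (v : I → ℂ) :
    toRep ρ g v = (ρ g : Matrix I I ℂ) *ᵥ v := rfl

theorem conjTranspose_map (ρ : G →* Matrix.unitaryGroup I ℂ) (g : G) :
    (ρ g : Matrix I I ℂ)ᴴ = (ρ g⁻¹ : Matrix I I ℂ) := by
  rw [map_inv]; rfl

theorem map_mul_conjTranspose (ρ : G →* Matrix.unitaryGroup I ℂ) (g : G) :
    (ρ g : Matrix I I ℂ) * (ρ g : Matrix I I ℂ)ᴴ = 1 :=
  Matrix.mem_unitaryGroup_iff.mp (ρ g).2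

/-- Restriction of a unitary representation to an invariant subspace. -/
theorem exists_restrict (ρ : G →* Matrix.unitaryGroup I ℂ) {k k' : ℕ} (E : Matrix I (Fin k) ℂ)
    (E' : Matrix I (Fin k') ℂ) (h1 : Eᴴ * E = 1) (hc : E * Eᴴ + E' * E'ᴴ = 1)
    (hinv : ∀ g, E'ᴴ * (ρ g : Matrix I I ℂ) * E = 0) :
    ∃ σ : G →* Matrix.unitaryGroup (Fin k) ℂ,
      ∀ g, (ρ g : Matrix I I ℂ) * E = E * (σ g : Matrix (Fin k) (Fin k) ℂ) := by
  have key : ∀ g, (ρ g : Matrix I I ℂ) * E = E * (Eᴴ * (ρ g : Matrix I I ℂ) * E) := fun g =>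
    calc (ρ g : Matrix I I ℂ) * E = (E * Eᴴ + E' * E'ᴴ) * ((ρ g : Matrix I I ℂ) * E) := by
          rw [hc, Matrix.one_mul]
      _ = E * (Eᴴ * (ρ g : Matrix I I ℂ) * E) + E' * (E'ᴴ * (ρ g : Matrix I I ℂ) * E) := by
          simp only [Matrix.add_mul, Matrix.mul_assoc]
      _ = _ := by rw [hinv, Matrix.mul_zero, add_zero]
  have hmul : ∀ g h, Eᴴ * (ρ (g * h) : Matrix I I ℂ) * E =
      (Eᴴ * (ρ g : Matrix I I ℂ) * E) * (Eᴴ * (ρ h : Matrix I I ℂ) * E) := fun g h =>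
    calc Eᴴ * (ρ (g * h) : Matrix I I ℂ) * E
        = Eᴴ * (ρ g : Matrix I I ℂ) * ((ρ h : Matrix I I ℂ) * E) := by
          rw [map_mul]; simp [Matrix.mul_assoc]
      _ = _ := by rw [key h]; simp only [Matrix.mul_assoc]
  have hone : Eᴴ * (ρ 1 : Matrix I I ℂ) * E = 1 := by simp [h1]
  refine ⟨{ toFun := fun g => ⟨Eᴴ * (ρ g : Matrix I I ℂ) * E, ?_⟩, map_one' := ?_,
            map_mul' := ?_ }, key⟩
  · rw [Matrix.mem_unitaryGroup_iff, Matrix.star_eq_conjTranspose]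
    simp only [Matrix.conjTranspose_mul, Matrix.conjTranspose_conjTranspose, conjTranspose_map]
    rw [← Matrix.mul_assoc Eᴴ (ρ g⁻¹ : Matrix I I ℂ) E, ← hmul, mul_inv_cancel, hone]
  · exact Subtype.ext hone
  · exact fun g h => Subtype.ext (hmul g h)

/-- A reducible unitary representation is an orthogonal sum of two smaller ones. -/
theorem exists_split {N : ℕ} (ρ : G →* Matrix.unitaryGroup (Fin N) ℂ)
    (P : Subrepresentation (toRep ρ)) (h0 : P.toSubmodule ≠ ⊥) (h1 : P.toSubmodule ≠ ⊤) :
    ∃ (k k' : ℕ) (_ : k < N) (_ : k' < N) (E : Matrix (Fin N) (Fin k) ℂ)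
      (E' : Matrix (Fin N) (Fin k') ℂ) (σ : G →* Matrix.unitaryGroup (Fin k) ℂ)
      (σ' : G →* Matrix.unitaryGroup (Fin k') ℂ),
      Eᴴ * E = 1 ∧ E'ᴴ * E' = 1 ∧ Eᴴ * E' = 0 ∧ E * Eᴴ + E' * E'ᴴ = 1 ∧
      (∀ g, (ρ g : Matrix (Fin N) (Fin N) ℂ) * E = E * (σ g : Matrix (Fin k) (Fin k) ℂ)) ∧
      (∀ g, (ρ g : Matrix (Fin N) (Fin N) ℂ) * E' = E' * (σ' g : Matrix (Fin k') (Fin k') ℂ)) := by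
  let e := WithLp.linearEquiv 2 ℂ (Fin N → ℂ)
  let W : Submodule ℂ (EuclideanSpace ℂ (Fin N)) := P.toSubmodule.comap e.toLinearMap
  have hW0 : W ≠ ⊥ := fun h => h0 <| by
    rw [eq_bot_iff]
    intro v hv
    have : e.symm v ∈ W := by simpa [W] using hv
    rw [h, Submodule.mem_bot] at this
    simpa using this
  have hW1 : W ≠ ⊤ := fun h => h1 <| by
    rw [eq_top_iff]
    intro v _
    have : e.symm v ∈ W := by rw [h]; trivial
    simpa [W] using this
  have hdim : Module.finrank ℂ W + Module.finrank ℂ Wᗮ = N := by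
    rw [Submodule.finrank_add_finrank_orthogonal]; simp
  have hk : 0 < Module.finrank ℂ W := by
    rw [Nat.pos_iff_ne_zero]; exact fun h => hW0 (Submodule.finrank_eq_zero.mp h)
  have hk' : 0 < Module.finrank ℂ Wᗮ := by
    rw [Nat.pos_iff_ne_zero]
    exact fun h => hW1 ((Submodule.orthogonal_eq_bot_iff).mp (Submodule.finrank_eq_zero.mp h))
  let b := stdOrthonormalBasis ℂ W
  let b' := stdOrthonormalBasis ℂ Wᗮ
  let E : Matrix (Fin N) (Fin (Module.finrank ℂ W)) ℂ :=
    Matrix.of fun i a => (b a : EuclideanSpace ℂ (Fin N)) i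
  let E' : Matrix (Fin N) (Fin (Module.finrank ℂ Wᗮ)) ℂ :=
    Matrix.of fun i a => (b' a : EuclideanSpace ℂ (Fin N)) i
  have hEE : Eᴴ * E = 1 := by
    ext a c
    have := orthonormal_iff_ite.mp b.orthonormal a c
    simp only [Submodule.coe_inner, PiLp.inner_apply, RCLike.inner_apply] at this
    simp only [Matrix.mul_apply, Matrix.conjTranspose_apply, Matrix.one_apply, E, Matrix.of_apply]
    rw [← this]
    exact Finset.sum_congr rfl fun i _ => mul_comm _ _
  have hEE' : E'ᴴ * E' = 1 := by
    ext a c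
    have := orthonormal_iff_ite.mp b'.orthonormal a c
    simp only [Submodule.coe_inner, PiLp.inner_apply, RCLike.inner_apply] at this
    simp only [Matrix.mul_apply, Matrix.conjTranspose_apply, Matrix.one_apply, E', Matrix.of_apply]
    rw [← this]
    exact Finset.sum_congr rfl fun i _ => mul_comm _ _
  have hperp : Eᴴ * E' = 0 := by
    ext a c
    have := Submodule.inner_right_of_mem_orthogonal (b a).2 (b' c).2
    simp only [PiLp.inner_apply, RCLike.inner_apply] at this
    simp only [Matrix.mul_apply, Matrix.conjTranspose_apply, Matrix.zero_apply, E, E',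
      Matrix.of_apply]
    rw [← this]
    exact Finset.sum_congr rfl fun i _ => mul_comm _ _
  have hperp' : E'ᴴ * E = 0 := by
    have := congrArg Matrix.conjTranspose hperp
    simpa using this
  have hc : E * Eᴴ + E' * E'ᴴ = 1 := by
    let eq : Fin N ≃ Fin (Module.finrank ℂ W) ⊕ Fin (Module.finrank ℂ Wᗮ) :=
      (finCongr hdim.symm).trans finSumFinEquiv.symm
    rw [← Matrix.fromCols_mul_fromRows, Matrix.mul_eq_one_comm_of_equiv eq,
      Matrix.fromRows_mul_fromCols, hEE, hEE', hperp, hperp', Matrix.fromBlocks_one]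
  have hinv : ∀ g, E'ᴴ * (ρ g : Matrix (Fin N) (Fin N) ℂ) * E = 0 := by
    intro g
    ext c a
    have hm : e.symm ((ρ g : Matrix (Fin N) (Fin N) ℂ) *ᵥ e (b a)) ∈ W := by
      have : toRep ρ g (e (b a)) ∈ P.toSubmodule := P.apply_mem_toSubmodule g (b a).2
      rw [toRep_apply] at this
      simpa [W] using this
    have := Submodule.inner_left_of_mem_orthogonal hm (b' c).2
    simp only [PiLp.inner_apply, RCLike.inner_apply] at this
    rw [Matrix.mul_assoc]
    simp only [Matrix.mul_apply, Matrix.conjTranspose_apply, Matrix.zero_apply, E, E',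
      Matrix.of_apply]
    rw [← this]
    refine Finset.sum_congr rfl fun i _ => ?_
    rw [mul_comm]; rfl
  have hinv' : ∀ g, Eᴴ * (ρ g : Matrix (Fin N) (Fin N) ℂ) * E' = 0 := by
    intro g
    have := congrArg Matrix.conjTranspose (hinv g⁻¹)
    rw [Matrix.conjTranspose_mul, Matrix.conjTranspose_mul, conjTranspose_map, inv_inv,
      Matrix.conjTranspose_conjTranspose, Matrix.conjTranspose_zero, ← Matrix.mul_assoc] at this
    exact this
  obtain ⟨σ, hσ⟩ := exists_restrict ρ E E' hEE hc hinv
  obtain ⟨σ', hσ'⟩ := exists_restrict ρ E' E hEE' (by rw [add_comm]; exact hc) hinv'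
  exact ⟨_, _, by omega, by omega, E, E', σ, σ', hEE, hEE', hperp, hc, hσ, hσ'⟩

/-- Orthogonal decomposition of a unitary representation into irreducible ones. -/
def HasIrredSum (ρ : G →* Matrix.unitaryGroup I ℂ) : Prop :=
  ∃ (J : Type) (_ : Fintype J) (k : J → ℕ) (σ : ∀ j, G →* Matrix.unitaryGroup (Fin (k j)) ℂ)
    (E : ∀ j, Matrix I (Fin (k j)) ℂ), (∀ j, (toRep (σ j)).IsIrreducible) ∧
    (∀ j, (E j)ᴴ * E j = 1) ∧ (∀ j j', j ≠ j' → (E j)ᴴ * E j' = 0) ∧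
    ∑ j, E j * (E j)ᴴ = 1 ∧
    ∀ j g, (ρ g : Matrix I I ℂ) * E j = E j * (σ j g : Matrix (Fin (k j)) (Fin (k j)) ℂ)

theorem hasIrredSum_fin (N : ℕ) :
    ∀ ρ : G →* Matrix.unitaryGroup (Fin N) ℂ, HasIrredSum ρ := by
  induction N using Nat.strong_induction_on with
  | _ N ih =>
    intro ρ
    by_cases hirr : (toRep ρ).IsIrreducible
    · refine ⟨Unit, inferInstance, fun _ => N, fun _ => ρ, fun _ => 1, fun _ => hirr, ?_, ?_, ?_, ?_⟩
      · simp
      · exact fun j j' h => absurd (Subsingleton.elim j j') h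
      · simp
      · exact fun _ g => (Matrix.mul_one _).trans (Matrix.one_mul _).symm
    by_cases hN : N = 0
    · subst hN
      refine ⟨Empty, inferInstance, fun _ => 0, fun j => j.elim, fun j => j.elim, fun j => j.elim,
        fun j => j.elim, fun j => j.elim, ?_, fun j => j.elim⟩
      ext i; exact i.elim0
    have hP : ∃ P : Subrepresentation (toRep ρ), P.toSubmodule ≠ ⊥ ∧ P.toSubmodule ≠ ⊤ := by
      by_contra hcon
      push Not at hcon
      apply hirr
      have : Nontrivial (Subrepresentation (toRep ρ)) := by
        refine ⟨⊥, ⊤, fun h => ?_⟩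
        have h1 : (Pi.single ⟨0, Nat.pos_of_ne_zero hN⟩ 1 : Fin N → ℂ) ∈
            (⊤ : Subrepresentation (toRep ρ)).toSubmodule := Submodule.mem_top
        rw [← h] at h1
        have h2 := congrFun ((Submodule.mem_bot ℂ).mp h1) ⟨0, Nat.pos_of_ne_zero hN⟩
        simp at h2
      refine ⟨fun P => ?_⟩
      by_cases hb : P.toSubmodule = ⊥
      · exact Or.inl (Subrepresentation.toSubmodule_injective hb)
      · exact Or.inr (Subrepresentation.toSubmodule_injective (hcon P hb))
    obtain ⟨P, hP0, hP1⟩ := hP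
    obtain ⟨k, k', hk, hk', E, E', σ, σ', hE, hE', ho, hc, hσ, hσ'⟩ := exists_split ρ P hP0 hP1
    have ho' : E'ᴴ * E = 0 := by simpa using congrArg Matrix.conjTranspose ho
    obtain ⟨J, _, q, τ, B, hi, hB, hBo, hBc, hBτ⟩ := ih k hk σ
    obtain ⟨J', _, q', τ', B', hi', hB', hBo', hBc', hBτ'⟩ := ih k' hk' σ'
    have hl : ∀ {a b a' b' : ℕ} (X : Matrix (Fin N) (Fin a) ℂ) (X' : Matrix (Fin N) (Fin a') ℂ)
        (Y : Matrix (Fin a) (Fin b) ℂ) (Y' : Matrix (Fin a') (Fin b') ℂ),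
        (X * Y)ᴴ * (X' * Y') = Yᴴ * ((Xᴴ * X') * Y') := by
      intros; simp only [Matrix.conjTranspose_mul, Matrix.mul_assoc]
    refine ⟨J ⊕ J', inferInstance, Sum.elim q q', fun j => Sum.rec τ τ' j,
      fun j => Sum.rec (fun j => E * B j) (fun j => E' * B' j) j, ?_, ?_, ?_, ?_, ?_⟩
    · rintro (j | j)
      · exact hi j
      · exact hi' j
    · rintro (j | j)
      · change (E * B j)ᴴ * (E * B j) = 1
        rw [hl, hE, Matrix.one_mul, hB]
      · change (E' * B' j)ᴴ * (E' * B' j) = 1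
        rw [hl, hE', Matrix.one_mul, hB']
    · rintro (j | j) (j' | j') hne
      · change (E * B j)ᴴ * (E * B j') = 0
        rw [hl, hE, Matrix.one_mul, hBo _ _ (fun h => hne (by rw [h]))]
      · change (E * B j)ᴴ * (E' * B' j') = 0
        rw [hl, ho, Matrix.zero_mul, Matrix.mul_zero]
      · change (E' * B' j)ᴴ * (E * B j') = 0
        rw [hl, ho', Matrix.zero_mul, Matrix.mul_zero]
      · change (E' * B' j)ᴴ * (E' * B' j') = 0
        rw [hl, hE', Matrix.one_mul, hBo' _ _ (fun h => hne (by rw [h]))]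
    · rw [Fintype.sum_sum_type]
      change ∑ j, (E * B j) * (E * B j)ᴴ + ∑ j, (E' * B' j) * (E' * B' j)ᴴ = 1
      have h1 : ∑ j, (E * B j) * (E * B j)ᴴ = E * Eᴴ := by
        calc _ = E * (∑ j, B j * (B j)ᴴ) * Eᴴ := by
              simp only [Matrix.mul_sum, Matrix.sum_mul, Matrix.conjTranspose_mul,
                Matrix.mul_assoc]
          _ = _ := by rw [hBc, Matrix.mul_one]
      have h2 : ∑ j, (E' * B' j) * (E' * B' j)ᴴ = E' * E'ᴴ := by
        calc _ = E' * (∑ j, B' j * (B' j)ᴴ) * E'ᴴ := by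
              simp only [Matrix.mul_sum, Matrix.sum_mul, Matrix.conjTranspose_mul,
                Matrix.mul_assoc]
          _ = _ := by rw [hBc', Matrix.mul_one]
      rw [h1, h2, hc]
    · rintro (j | j) g
      · change (ρ g : Matrix (Fin N) (Fin N) ℂ) * (E * B j) =
          E * B j * (τ j g : Matrix (Fin (q j)) (Fin (q j)) ℂ)
        rw [← Matrix.mul_assoc, hσ, Matrix.mul_assoc, hBτ, Matrix.mul_assoc]
      · change (ρ g : Matrix (Fin N) (Fin N) ℂ) * (E' * B' j) =
          E' * B' j * (τ' j g : Matrix (Fin (q' j)) (Fin (q' j)) ℂ)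
        rw [← Matrix.mul_assoc, hσ', Matrix.mul_assoc, hBτ', Matrix.mul_assoc]

theorem hasIrredSum (ρ : G →* Matrix.unitaryGroup I ℂ) : HasIrredSum ρ := by
  let e := Fintype.equivFin I
  let X : Matrix I (Fin (Fintype.card I)) ℂ := (1 : Matrix I I ℂ).submatrix id e.symm
  have h1 : Xᴴ * X = 1 := by
    ext a b
    simp [X, Matrix.mul_apply, Matrix.one_apply, apply_ite]
  have h2 : X * Xᴴ = 1 := (Matrix.mul_eq_one_comm_of_equiv e).mpr h1
  obtain ⟨σ, hσ⟩ := exists_restrict ρ X (0 : Matrix I (Fin 0) ℂ) h1 (by simp [h2]) (by simp)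
  obtain ⟨J, _, q, τ, B, hi, hB, hBo, hBc, hBτ⟩ := hasIrredSum_fin _ σ
  have hl : ∀ {b b' : ℕ} (Y : Matrix (Fin (Fintype.card I)) (Fin b) ℂ)
      (Y' : Matrix (Fin (Fintype.card I)) (Fin b') ℂ),
      (X * Y)ᴴ * (X * Y') = Yᴴ * ((Xᴴ * X) * Y') := by
    intros; simp only [Matrix.conjTranspose_mul, Matrix.mul_assoc]
  refine ⟨J, inferInstance, q, τ, fun j => X * B j, hi, ?_, ?_, ?_, ?_⟩
  · intro j; rw [hl, h1, Matrix.one_mul, hB]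
  · intro j j' h; rw [hl, h1, Matrix.one_mul, hBo _ _ h]
  · calc _ = X * (∑ j, B j * (B j)ᴴ) * Xᴴ := by
          simp only [Matrix.mul_sum, Matrix.sum_mul, Matrix.conjTranspose_mul, Matrix.mul_assoc]
      _ = _ := by rw [hBc, Matrix.mul_one, h2]
  · intro j g
    rw [← Matrix.mul_assoc, hσ, Matrix.mul_assoc, hBτ, Matrix.mul_assoc]

/-- Equivalent irreducible unitary representations are unitarily equivalent. -/
theorem exists_unitary_intertwiner {k k' : ℕ} (σ : G →* Matrix.unitaryGroup (Fin k) ℂ)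
    (σ' : G →* Matrix.unitaryGroup (Fin k') ℂ) (hσ : (toRep σ).IsIrreducible)
    (φ : (toRep σ).Equiv (toRep σ')) :
    ∃ V : Matrix (Fin k') (Fin k) ℂ, Vᴴ * V = 1 ∧ V * Vᴴ = 1 ∧
      ∀ g, (σ' g : Matrix (Fin k') (Fin k') ℂ) * V = V * (σ g : Matrix (Fin k) (Fin k) ℂ) := by
  let M : Matrix (Fin k') (Fin k) ℂ := LinearMap.toMatrix' φ.toLinearEquiv.toLinearMap
  have hMv : ∀ v, M *ᵥ v = φ v := fun v => by
    simp only [M, LinearMap.toMatrix'_mulVec]; rfl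
  have hM : ∀ g, (σ' g : Matrix (Fin k') (Fin k') ℂ) * M = M * (σ g : Matrix (Fin k) (Fin k) ℂ) := by
    intro g
    refine Matrix.toLin'.injective (LinearMap.ext fun v => ?_)
    simp only [Matrix.toLin'_apply, ← Matrix.mulVec_mulVec]
    rw [hMv, hMv, ← toRep_apply, ← toRep_apply]
    exact (LinearMap.congr_fun (φ.isIntertwining' g) v).symm
  have hM' : ∀ g, Mᴴ * (σ' g : Matrix (Fin k') (Fin k') ℂ) = (σ g : Matrix (Fin k) (Fin k) ℂ) * Mᴴ := by
    intro g
    have := congrArg Matrix.conjTranspose (hM g⁻¹)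
    rwa [Matrix.conjTranspose_mul, Matrix.conjTranspose_mul, conjTranspose_map, conjTranspose_map,
      inv_inv] at this
  have hkk : k = k' := by
    have := φ.toLinearEquiv.finrank_eq
    simpa using this
  subst hkk
  let f : (toRep σ).IntertwiningMap (toRep σ) :=
    ⟨Matrix.toLin' (Mᴴ * M), fun g => LinearMap.ext fun v => by
      simp only [LinearMap.comp_apply, Matrix.toLin'_apply, toRep_apply, Matrix.mulVec_mulVec]
      rw [Matrix.mul_assoc, ← hM, ← Matrix.mul_assoc, hM', Matrix.mul_assoc]⟩
  obtain ⟨c, hc⟩ :=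
    (Representation.IsIrreducible.algebraMap_intertwiningMap_bijective_of_isAlgClosed
      (ρ := toRep σ)).2 f
  have hMM : Mᴴ * M = c • (1 : Matrix (Fin k) (Fin k) ℂ) := by
    refine Matrix.toLin'.injective (LinearMap.ext fun v => ?_)
    have : f v = c • v := by rw [← hc]; rfl
    simpa [f, Matrix.toLin'_apply, Matrix.smul_mulVec] using this
  have hk : 0 < k := by
    rw [Nat.pos_iff_ne_zero]
    rintro rfl
    obtain ⟨x, y, hxy⟩ := exists_pair_ne (Subrepresentation (toRep σ))
    refine hxy (SetLike.ext fun v => ?_)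
    rw [Subsingleton.elim v 0]
    exact ⟨fun _ => y.toSubmodule.zero_mem, fun _ => x.toSubmodule.zero_mem⟩
  obtain ⟨s, hs0, hsc⟩ : ∃ s : ℝ, 0 < s ∧ c = (s : ℂ) := by
    have h1 := congrFun (congrFun hMM ⟨0, hk⟩) ⟨0, hk⟩
    simp only [Matrix.mul_apply, Matrix.conjTranspose_apply, Matrix.smul_apply, Matrix.one_apply_eq,
      smul_eq_mul, mul_one] at h1
    have h2 : ∀ i, star (M i ⟨0, hk⟩) * M i ⟨0, hk⟩ = ((‖M i ⟨0, hk⟩‖ ^ 2 : ℝ) : ℂ) := fun i => by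
      have := Complex.conj_mul' (M i ⟨0, hk⟩)
      simpa using this
    simp only [h2] at h1
    rw [← Complex.ofReal_sum] at h1
    refine ⟨_, lt_of_le_of_ne (Finset.sum_nonneg fun i _ => by positivity) ?_, h1.symm⟩
    intro h0
    have h3 : ∀ i, M i ⟨0, hk⟩ = 0 := fun i => by
      have := (Finset.sum_eq_zero_iff_of_nonneg (fun i _ => by positivity)).mp h0.symm i
        (Finset.mem_univ i)
      simpa using this
    have h4 : φ (Pi.single ⟨0, hk⟩ 1) = 0 := by
      rw [← hMv]
      ext i
      simp [h3]
    have h5 : (Pi.single ⟨0, hk⟩ 1 : Fin k → ℂ) = 0 := by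
      apply φ.toLinearEquiv.injective
      rw [map_zero]; exact h4
    have := congrFun h5 ⟨0, hk⟩
    simp at this
  have hV : ((((Real.sqrt s)⁻¹ : ℝ) : ℂ) • M)ᴴ * ((((Real.sqrt s)⁻¹ : ℝ) : ℂ) • M) = 1 := by
    rw [Matrix.conjTranspose_smul, Matrix.smul_mul, Matrix.mul_smul, hMM, smul_smul, smul_smul, hsc]
    have : star (((Real.sqrt s)⁻¹ : ℝ) : ℂ) * ((((Real.sqrt s)⁻¹ : ℝ) : ℂ) * (s : ℂ)) = 1 := by
      rw [Complex.star_def, Complex.conj_ofReal, ← Complex.ofReal_mul, ← Complex.ofReal_mul]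
      norm_cast
      have hss := Real.mul_self_sqrt hs0.le
      have hsp := Real.sqrt_pos.mpr hs0
      field_simp
      nlinarith
    rw [mul_assoc, this, one_smul]
  exact ⟨_, hV, mul_eq_one_comm.mp hV, fun g => by
    rw [Matrix.mul_smul, Matrix.smul_mul, hM]⟩

/-- Every unitary representation has a decomposition into irreducible ones. -/
theorem exists_irrepDecomposition (R : G →* Matrix.unitaryGroup I ℂ) :
    ∃ N : ℕ, Nonempty (IrrepDecomposition R (Fin N)) := by
  classical
  obtain ⟨J, _, k, σ, E, hi, hE, hEo, hEc, hEσ⟩ := hasIrredSum R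
  let st : Setoid J :=
    { r := fun j j' => Nonempty ((toRep (σ j)).Equiv (toRep (σ j')))
      iseqv := ⟨fun j => ⟨Representation.Equiv.refl _⟩, fun ⟨f⟩ => ⟨f.symm⟩,
        fun ⟨f⟩ ⟨g⟩ => ⟨f.trans g⟩⟩ }
  let eQ : Quotient st ≃ Fin (Fintype.card (Quotient st)) := Fintype.equivFin _
  let rep : Fin (Fintype.card (Quotient st)) → J := fun l => (eQ.symm l).out
  let cls : J → Fin (Fintype.card (Quotient st)) := fun j => eQ (Quotient.mk st j)
  have hrep : ∀ l, cls (rep l) = l := fun l => by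
    simp [cls, rep]
  have hV : ∀ j l, cls j = l → ∃ V : Matrix (Fin (k j)) (Fin (k (rep l))) ℂ,
      Vᴴ * V = 1 ∧ V * Vᴴ = 1 ∧
      ∀ g, (σ j g : Matrix (Fin (k j)) (Fin (k j)) ℂ) * V = V * (σ (rep l) g : Matrix (Fin (k (rep l))) (Fin (k (rep l))) ℂ) := by
    intro j l hjl
    have h1 : (Quotient.mk st (rep l)) = Quotient.mk st j := by
      apply eQ.injective
      rw [← hjl]
      exact hrep _
    obtain ⟨φ⟩ := Quotient.exact h1
    exact exists_unitary_intertwiner _ _ (hi _) φ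
  choose V hV1 hV2 hV3 using hV
  let eF : ∀ l, {j // cls j = l} ≃ Fin (Fintype.card {j // cls j = l}) :=
    fun l => Fintype.equivFin _
  let s : ∀ l, Fin (Fintype.card {j // cls j = l}) → J := fun l α => ((eF l).symm α : J)
  have hs : ∀ l α, cls (s l α) = l := fun l α => ((eF l).symm α).2
  let Y : ∀ l α, Matrix I (Fin (k (rep l))) ℂ := fun l α => E (s l α) * V (s l α) l (hs l α)
  let F : ∀ l, Matrix I (Fin (k (rep l)) × Fin (Fintype.card {j // cls j = l})) ℂ :=
    fun l => Matrix.of fun i x => Y l x.2 i x.1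
  have hYY : ∀ l α l' α', (Y l α)ᴴ * Y l' α' =
      (V (s l α) l (hs l α))ᴴ * (((E (s l α))ᴴ * E (s l' α')) * V (s l' α') l' (hs l' α')) := by
    intros; simp only [Y, Matrix.conjTranspose_mul, Matrix.mul_assoc]
  have hY1 : ∀ l α, (Y l α)ᴴ * Y l α = 1 := fun l α => by
    rw [hYY, hE, Matrix.one_mul, hV1]
  have hY0 : ∀ l α l' α', s l α ≠ s l' α' → (Y l α)ᴴ * Y l' α' = 0 := fun l α l' α' h => by
    rw [hYY, hEo _ _ h, Matrix.zero_mul, Matrix.mul_zero]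
  have hFF : ∀ l l' x x', ((F l)ᴴ * F l') x x' = ((Y l x.2)ᴴ * Y l' x'.2) x.1 x'.1 := by
    intros; rfl
  have hYR : ∀ l α g, (R g : Matrix I I ℂ) * Y l α = Y l α * (σ (rep l) g : Matrix (Fin (k (rep l))) (Fin (k (rep l))) ℂ) := by
    intro l α g
    simp only [Y]
    rw [← Matrix.mul_assoc, hEσ, Matrix.mul_assoc, hV3, Matrix.mul_assoc]
  have hFsum : ∀ l, F l * (F l)ᴴ = ∑ j : {j // cls j = l}, E j * (E j)ᴴ := by
    intro l
    have h1 : F l * (F l)ᴴ = ∑ α, Y l α * (Y l α)ᴴ := by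
      ext i i'
      rw [Matrix.sum_apply, Matrix.mul_apply, Fintype.sum_prod_type_right]
      rfl
    rw [h1, ← (eF l).sum_comp]
    refine Finset.sum_congr rfl fun j _ => ?_
    have h2 : ∀ α, Y l α * (Y l α)ᴴ = E (s l α) * (E (s l α))ᴴ := fun α => by
      calc _ = E (s l α) * (V (s l α) l (hs l α) * (V (s l α) l (hs l α))ᴴ) * (E (s l α))ᴴ := by
            simp only [Y, Matrix.conjTranspose_mul, Matrix.mul_assoc]
        _ = _ := by rw [hV2, Matrix.mul_one]
    rw [h2]
    change E ((eF l).symm (eF l j) : J) * (E ((eF l).symm (eF l j) : J))ᴴ = _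
    rw [Equiv.symm_apply_apply]
  have hcomplete : ∑ l, F l * (F l)ᴴ = 1 := by
    simp only [hFsum]
    rw [← hEc, ← Finset.univ.sum_fiberwise cls]
    refine Finset.sum_congr rfl fun l _ => ?_
    rw [← Finset.sum_subtype_eq_sum_filter]
    simp
  have hFR : ∀ l g, (R g : Matrix I I ℂ) * F l =
      F l * ((σ (rep l) g : Matrix (Fin (k (rep l))) (Fin (k (rep l))) ℂ) ⊗ₖ (1 : Matrix (Fin (Fintype.card {j // cls j = l}))
        (Fin (Fintype.card {j // cls j = l})) ℂ)) := by
    intro l g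
    ext i ⟨a, α⟩
    have h1 := congrFun (congrFun (hYR l α g) i) a
    rw [Matrix.mul_apply] at h1 ⊢
    rw [Matrix.mul_apply, Fintype.sum_prod_type]
    simp only [Matrix.kroneckerMap_apply, Matrix.one_apply, F, Matrix.of_apply]
    rw [h1, Matrix.mul_apply]
    simp
  refine ⟨_, ⟨{
    r := fun l => k (rep l), m := fun l => (Fintype.card {j // cls j = l}),
    m_pos := ?_, irr := fun l => σ (rep l), irreducible := fun l => hi _, inequivalent := ?_,
    F := F, isometry := ?_, orthogonal := ?_, complete := hcomplete, decomp := ?_}⟩⟩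
  · exact fun l => Fintype.card_pos_iff.mpr ⟨⟨rep l, hrep l⟩⟩
  · intro l l' hne
    refine ⟨fun φ => hne ?_⟩
    rw [← hrep l, ← hrep l']
    exact congrArg eQ (Quotient.sound (s := st) ⟨φ⟩)
  · intro l
    ext ⟨a, α⟩ ⟨b, β⟩
    rw [hFF]
    by_cases h : α = β
    · subst h
      rw [hY1]
      simp [Matrix.one_apply]
    · rw [hY0 _ _ _ _ (fun h' => h ((eF l).symm.injective (Subtype.ext h')))]
      simp [h]
  · intro l l' hne
    ext ⟨a, α⟩ ⟨b, β⟩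
    rw [hFF, hY0 _ _ _ _ (fun h' => hne (by rw [← hs l α, ← hs l' β, h']))]
    rfl
  · intro g
    calc (R g : Matrix I I ℂ) = (R g : Matrix I I ℂ) * ∑ l, F l * (F l)ᴴ := by
          rw [hcomplete, Matrix.mul_one]
      _ = _ := by
          rw [Matrix.mul_sum]
          exact Finset.sum_congr rfl fun l _ => by rw [← Matrix.mul_assoc, hFR]

end Existence

/-! ### Local symmetric gates on qudits -/

section Local

variable {n d : ℕ} {G : Type*} [Group G]

/-- The group of `(G, R)`-symmetric unitaries on `n` qudits that act only on the sites in `s`,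
i.e. are of the form `A ⊗ 1` with `A` acting on the sites in `s`. -/
def localSymUnitary (R : G →* Matrix.unitaryGroup (Fin n → Fin d) ℂ) (s : Finset (Fin n)) :
    Subgroup (Matrix.unitaryGroup (Fin n → Fin d) ℂ) where
  carrier := {U | U ∈ symUnitary R ∧ ∃ A : Matrix (s → Fin d) (s → Fin d) ℂ,
    (U : Matrix (Fin n → Fin d) (Fin n → Fin d) ℂ) =
      embedOp (Function.Embedding.subtype fun i => i ∈ s) A}
  one_mem' := ⟨one_mem _, 1, by rw [embedOp_one]; rfl⟩
  mul_mem' := by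
    rintro U V ⟨hU, A, hA⟩ ⟨hV, B, hB⟩
    exact ⟨mul_mem hU hV, A * B, by rw [embedOp_mul, ← hA, ← hB]; rfl⟩
  inv_mem' := by
    rintro U ⟨hU, A, hA⟩
    exact ⟨inv_mem hU, star A, by rw [embedOp_star, ← hA]; rfl⟩

theorem isCompact_localSymUnitary (R : G →* Matrix.unitaryGroup (Fin n → Fin d) ℂ)
    (s : Finset (Fin n)) :
    IsCompact (localSymUnitary R s : Set (Matrix.unitaryGroup (Fin n → Fin d) ℂ)) := by
  refine IsClosed.isCompact ?_
  have : (localSymUnitary R s : Set (Matrix.unitaryGroup (Fin n → Fin d) ℂ)) =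
      (symUnitary R : Set (Matrix.unitaryGroup (Fin n → Fin d) ℂ)) ∩ Subtype.val ⁻¹'
        (LinearMap.range (embedLin (I := Fin d)
          (Function.Embedding.subtype fun i => i ∈ s)) : Set _) := by
    ext U
    simp only [localSymUnitary, Subgroup.coe_set_mk, Set.mem_inter_iff, Set.mem_preimage,
      SetLike.mem_coe, LinearMap.mem_range]
    exact and_congr Iff.rfl (exists_congr fun A => eq_comm)
  rw [this]
  exact (isCompact_symUnitary R).isClosed.inter
    ((Submodule.closed_of_finiteDimensional _).preimage continuous_subtype_val)

/-- The locality `k = max_γ #γ` of a finite family of sets of sites. -/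
def locality {Γ : Type*} [Fintype Γ] (loc : Γ → Finset (Fin n)) : ℕ :=
  Finset.univ.sup fun γ => (loc γ).card

theorem locality_le {Γ : Type*} [Fintype Γ] (loc : Γ → Finset (Fin n)) : locality loc ≤ n :=
  Finset.sup_le fun γ _ => by simpa using Finset.card_le_univ (loc γ)

/-- The operator `A ⊗ 1^{⊗ (n - k)}` on `n` qudits. -/
def padOp {k : ℕ} (hk : k ≤ n) (A : Matrix (Fin k → Fin d) (Fin k → Fin d) ℂ) :
    Matrix (Fin n → Fin d) (Fin n → Fin d) ℂ :=
  embedOp (Fin.castLEEmb hk) A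

/-- The set `𝒞 = {f(A ⊗ 1^{⊗ (n - k)}) | A commutes with T^{⊗ k}}`. -/
def localTraceVecs (T : G →* Matrix.unitaryGroup (Fin d) ℂ) {Λ : Type*} [Fintype Λ]
    (D : IrrepDecomposition (tensorPowRep (Fin n) T) Λ) {k : ℕ} (hk : k ≤ n) : Set (Λ → ℂ) :=
  {c | ∃ A ∈ symOps (tensorPowRep (Fin k) T), c = D.traceVec (padOp hk A)}

end Local

end SymDesign

end

/-! For a compact group S of unitaries, the Haar moment operator is the orthogonal projection onto
the vectors of the mixed tensor space fixed by S. The moment operator M of the mixture is therefore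
a convex combination of projections with positive weights, and it fixes exactly the vectors fixed by
every S^γ. If Q is the projection belonging to the full symmetric group 𝒰, then MQ = QM = Q, so the
powers of M converge to Q as soon as every vector fixed by all S^γ is fixed by 𝒰
(`tendsto_momentOp_pow`). The integer vectors x label the characters of 𝒰 that obstruct this.

Suppose a vector is fixed by the group H generated by the S^γ but not by 𝒰. By semi-universality 𝒰
is the product of H and the sector phases, which are central. A component of the vector with
nontrivial phase weight is still fixed by H, and every element of 𝒰 multiplies it by a scalar; this
gives a character of 𝒰. A character is constant on conjugacy classes, so its weight on the maximal
torus does not change under permutations of the eigenvalues within a sector, and it amounts to one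
integer x_λ per sector. Weights of U^{⊗t} ⊗ (U^*)^{⊗t} have sum 0 and absolute sum at most 2t, which
is (2) and (1); triviality on H gives (3) (`exists_weight_of_not_invariant`).

Conversely, x defines the character ∏ det(V_λ)^{x_λ}. By (1) and (2) it is a polynomial of degree s
≤ t in the entries of U and of the same degree in their conjugates, hence a linear functional of the
mixed tensor power (`exists_linearMap_detChar`). By (3) it is infinitesimally trivial on S^γ, and
then trivial because S^γ is connected (`detChar_eq_one`, which rests on `le_of_lieAlg_subset`). The
functional equals 1 on every power of M, whereas invariance under 𝒰 forces it to vanish on Q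
(`not_tendsto_momentOp_pow`).

For local gates, 𝒰^γ is the unitary group of a star-algebra, so it is connected and its Lie algebra
is the Hermitian part. Permutations of the sites are symmetric unitaries and conjugation preserves
sector traces, so only the number of sites matters (`traceVec_embedOp_congr`). Every γ fits into k
sites, some γ has exactly k, and the identity operator accounts for (2). -/

noncomputable section

namespace SymDesign

/-! ### Moment operators -/

section Moments

/-- The mixed tensor power `M^{⊗ t} ⊗ (M^*)^{⊗ t}` of a rectangular matrix. -/
def mixedTensor (t : ℕ) {I J : Type*} (M : Matrix I J ℂ) :
    Matrix ((Fin t → I) × (Fin t → I)) ((Fin t → J) × (Fin t → J)) ℂ :=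
  Matrix.of fun a b => (∏ s, M (a.1 s) (b.1 s)) * ∏ s, star (M (a.2 s) (b.2 s))

theorem mixedTensor_mul (t : ℕ) {I J K : Type*} [Fintype J] (M : Matrix I J ℂ)
    (N : Matrix J K ℂ) : mixedTensor t (M * N) = mixedTensor t M * mixedTensor t N := by
  classical
  ext a b
  simp only [mixedTensor, Matrix.of_apply, Matrix.mul_apply, star_sum, Finset.prod_univ_sum,
    Fintype.sum_prod_type, Fintype.piFinset_univ]
  rw [Finset.sum_mul_sum]
  refine Finset.sum_congr rfl fun c _ => Finset.sum_congr rfl fun c' _ => ?_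
  simp only [Finset.prod_mul_distrib, star_mul']
  ring

theorem mixedTensor_diagonal (t : ℕ) {I : Type*} [DecidableEq I] (f : I → ℂ) :
    mixedTensor t (Matrix.diagonal f) =
      Matrix.diagonal fun b => (∏ s, f (b.1 s)) * ∏ s, star (f (b.2 s)) := by
  ext a b
  simp only [mixedTensor, Matrix.of_apply, Matrix.diagonal_apply, apply_ite star, star_zero]
  rw [Finset.prod_ite_zero, Finset.prod_ite_zero]
  simp only [Finset.mem_univ, forall_const, ← funext_iff, Prod.ext_iff]
  by_cases h1 : a.1 = b.1 <;> by_cases h2 : a.2 = b.2 <;> simp [h1, h2]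

theorem mixedTensor_one (t : ℕ) {I : Type*} [DecidableEq I] :
    mixedTensor t (1 : Matrix I I ℂ) = 1 := by
  rw [← Matrix.diagonal_one, mixedTensor_diagonal]
  simp

theorem mixedTensor_conjTranspose (t : ℕ) {I J : Type*} (M : Matrix I J ℂ) :
    mixedTensor t Mᴴ = (mixedTensor t M)ᴴ := by
  ext a b
  simp [mixedTensor, Matrix.conjTranspose_apply]

variable {I : Type*} [Fintype I] [DecidableEq I]

theorem continuous_mixedTensor_apply (t : ℕ) (a b : (Fin t → I) × (Fin t → I)) :
    Continuous fun U : Matrix.unitaryGroup I ℂ => mixedTensor t (U : Matrix I I ℂ) a b := by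
  have h : ∀ i j, Continuous fun U : Matrix.unitaryGroup I ℂ => (U : Matrix I I ℂ) i j :=
    fun i j => continuous_subtype_val.matrix_elem i j
  simp only [mixedTensor, Matrix.of_apply]
  exact (continuous_finsetProd _ fun s _ => h _ _).mul
    (continuous_finsetProd _ fun s _ => (h _ _).star)

theorem momentOp_apply (t : ℕ) (ν : Measure (Matrix.unitaryGroup I ℂ))
    (a b : (Fin t → I) × (Fin t → I)) :
    momentOp t ν a b = ∫ U : Matrix.unitaryGroup I ℂ, mixedTensor t (U : Matrix I I ℂ) a b ∂ν := by
  simp [momentOp, mixedTensor, tensorPow, Matrix.kroneckerMap_apply]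

theorem integrable_of_continuous (ν : Measure (Matrix.unitaryGroup I ℂ)) [IsFiniteMeasure ν]
    {f : Matrix.unitaryGroup I ℂ → ℂ} (hf : Continuous f) : Integrable f ν := by
  rw [← integrableOn_univ]
  exact hf.continuousOn.integrableOn_compact isCompact_univ

theorem linearMap_eq_sum {m n : Type*} [Fintype m] [Fintype n] [DecidableEq m] [DecidableEq n]
    (L : Matrix m n ℂ →ₗ[ℂ] ℂ) (M : Matrix m n ℂ) :
    L M = ∑ a, ∑ b, M a b * L (Matrix.single a b 1) := by
  conv_lhs => rw [Matrix.matrix_eq_sum_single M]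
  simp only [map_sum]
  refine Finset.sum_congr rfl fun a _ => Finset.sum_congr rfl fun b _ => ?_
  rw [← mul_one (M a b), ← smul_eq_mul, ← Matrix.smul_single, map_smul, smul_eq_mul, smul_eq_mul,
    mul_one]

/-- A functional on matrices is a finite combination of entries, so it passes through the entrywise
integral. Identities between moment operators thereby reduce to pointwise identities for mixed
tensor powers. -/
theorem map_momentOp (t : ℕ) (ν : Measure (Matrix.unitaryGroup I ℂ)) [IsFiniteMeasure ν]
    (L : Matrix ((Fin t → I) × (Fin t → I)) ((Fin t → I) × (Fin t → I)) ℂ →ₗ[ℂ] ℂ) :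
    L (momentOp t ν) = ∫ U : Matrix.unitaryGroup I ℂ, L (mixedTensor t (U : Matrix I I ℂ)) ∂ν := by
  have hc : ∀ a b, Continuous fun U : Matrix.unitaryGroup I ℂ =>
      mixedTensor t (U : Matrix I I ℂ) a b * L (Matrix.single a b 1) := fun a b =>
    (continuous_mixedTensor_apply t a b).mul continuous_const
  rw [linearMap_eq_sum L]
  simp only [linearMap_eq_sum L (mixedTensor t _)]
  rw [integral_finsetSum _ fun a _ => integrable_of_continuous ν
    (continuous_finsetSum _ fun b _ => hc a b)]
  refine Finset.sum_congr rfl fun a _ => ?_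
  rw [integral_finsetSum _ fun b _ => integrable_of_continuous ν (hc a b)]
  refine Finset.sum_congr rfl fun b _ => ?_
  rw [momentOp_apply, integral_mul_const]

/-! ### Haar averages as orthogonal projections onto invariants -/

section Haar

variable (S : Subgroup (Matrix.unitaryGroup I ℂ))
  (hS : IsCompact (S : Set (Matrix.unitaryGroup I ℂ)))

theorem measurableEmbedding_subgroup {S : Subgroup (Matrix.unitaryGroup I ℂ)}
    (hS : IsCompact (S : Set (Matrix.unitaryGroup I ℂ))) : MeasurableEmbedding (Subtype.val : S → _) :=
  MeasurableEmbedding.subtype_coe hS.isClosed.measurableSet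

instance isProbabilityMeasure_haarOn : IsProbabilityMeasure (haarOn S hS) := by
  have : CompactSpace S := isCompact_iff_compactSpace.mp hS
  constructor
  rw [haarOn, Measure.map_apply continuous_subtype_val.measurable MeasurableSet.univ,
    Set.preimage_univ]
  exact Measure.haarMeasure_self (K₀ := (⊤ : TopologicalSpace.PositiveCompacts S))

theorem haarOn_ae_mem : ∀ᵐ U ∂(haarOn S hS), U ∈ S := by
  have : CompactSpace S := isCompact_iff_compactSpace.mp hS
  rw [haarOn, (measurableEmbedding_subgroup hS).ae_map_iff]
  exact Eventually.of_forall fun U => U.2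

theorem integral_haarOn_mul_left (f : Matrix.unitaryGroup I ℂ → ℂ) {u : Matrix.unitaryGroup I ℂ}
    (hu : u ∈ S) : ∫ U, f (u * U) ∂(haarOn S hS) = ∫ U, f U ∂(haarOn S hS) := by
  have : CompactSpace S := isCompact_iff_compactSpace.mp hS
  rw [haarOn, (measurableEmbedding_subgroup hS).integral_map,
    (measurableEmbedding_subgroup hS).integral_map]
  exact integral_mul_left_eq_self (fun U : S => f (U : Matrix.unitaryGroup I ℂ)) (⟨u, hu⟩ : S)

variable (t : ℕ)

theorem map_momentOp_haarOn_of_forall_mem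
    (L : Matrix ((Fin t → I) × (Fin t → I)) ((Fin t → I) × (Fin t → I)) ℂ →ₗ[ℂ] ℂ) (c : ℂ)
    (h : ∀ u ∈ S, L (mixedTensor t (u : Matrix I I ℂ)) = c) :
    L (momentOp t (haarOn S hS)) = c := by
  rw [map_momentOp]
  have : ∀ᵐ U : Matrix.unitaryGroup I ℂ ∂(haarOn S hS), L (mixedTensor t (U : Matrix I I ℂ)) = c := by
    filter_upwards [haarOn_ae_mem S hS] with U hU using h U hU
  rw [integral_congr_ae this]
  simp

theorem mixedTensor_mul_momentOp {u : Matrix.unitaryGroup I ℂ} (hu : u ∈ S) :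
    mixedTensor t (u : Matrix I I ℂ) * momentOp t (haarOn S hS) = momentOp t (haarOn S hS) := by
  ext a b
  have h1 := map_momentOp t (haarOn S hS)
    ((Matrix.entryLinearMap ℂ ℂ a b).comp
      (LinearMap.mulLeft ℂ (mixedTensor t (u : Matrix I I ℂ))))
  have h2 := map_momentOp t (haarOn S hS) (Matrix.entryLinearMap ℂ ℂ a b)
  simp only [LinearMap.comp_apply, LinearMap.mulLeft_apply, Matrix.entryLinearMap_apply,
    ← mixedTensor_mul] at h1 h2
  rw [h1, h2]
  exact integral_haarOn_mul_left S hS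
    (fun U => mixedTensor t (U : Matrix I I ℂ) a b) hu

theorem mul_momentOp_of_forall_mem
    (A : Matrix ((Fin t → I) × (Fin t → I)) ((Fin t → I) × (Fin t → I)) ℂ)
    (h : ∀ u ∈ S, A * mixedTensor t (u : Matrix I I ℂ) = A) :
    A * momentOp t (haarOn S hS) = A := by
  ext a b
  exact map_momentOp_haarOn_of_forall_mem S hS t
    ((Matrix.entryLinearMap ℂ ℂ a b).comp (LinearMap.mulLeft ℂ A)) _
    fun u hu => by simp [h u hu]

/-- Left invariance for u⁻¹, conjugate-transposed, says P†u = P† for u in S. Averaging over u gives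
P†P = P†, and the left-hand side is Hermitian. Only left invariance of the Haar measure enters. -/
theorem momentOp_haarOn_conjTranspose :
    (momentOp t (haarOn S hS))ᴴ = momentOp t (haarOn S hS) := by
  have h1 : (momentOp t (haarOn S hS))ᴴ * momentOp t (haarOn S hS) =
      (momentOp t (haarOn S hS))ᴴ := by
    refine mul_momentOp_of_forall_mem S hS t _ fun u hu => ?_
    have := congrArg Matrix.conjTranspose (mixedTensor_mul_momentOp S hS t (inv_mem hu))
    rw [Matrix.conjTranspose_mul, ← mixedTensor_conjTranspose] at this
    have h2 : ((u⁻¹ : Matrix.unitaryGroup I ℂ) : Matrix I I ℂ)ᴴ = u := by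
      rw [← Matrix.star_eq_conjTranspose]
      exact star_star (u : Matrix I I ℂ)
    rwa [h2] at this
  have h2 := congrArg Matrix.conjTranspose h1
  rw [Matrix.conjTranspose_mul, Matrix.conjTranspose_conjTranspose, h1] at h2
  exact h2

theorem momentOp_mul_mixedTensor {u : Matrix.unitaryGroup I ℂ} (hu : u ∈ S) :
    momentOp t (haarOn S hS) * mixedTensor t (u : Matrix I I ℂ) = momentOp t (haarOn S hS) := by
  have := congrArg Matrix.conjTranspose (mixedTensor_mul_momentOp S hS t (inv_mem hu))
  rw [Matrix.conjTranspose_mul, ← mixedTensor_conjTranspose, momentOp_haarOn_conjTranspose] at this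
  have h2 : ((u⁻¹ : Matrix.unitaryGroup I ℂ) : Matrix I I ℂ)ᴴ = u := by
    rw [← Matrix.star_eq_conjTranspose]
    exact star_star (u : Matrix I I ℂ)
  rwa [h2] at this

theorem momentOp_mul_momentOp {S} {T : Subgroup (Matrix.unitaryGroup I ℂ)} (hS)
    (hT : IsCompact (T : Set (Matrix.unitaryGroup I ℂ))) (h : S ≤ T) :
    momentOp t (haarOn T hT) * momentOp t (haarOn S hS) = momentOp t (haarOn T hT) :=
  mul_momentOp_of_forall_mem S hS t _ fun _ hu => momentOp_mul_mixedTensor T hT t (h hu)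

theorem momentOp_mul_momentOp' {S} {T : Subgroup (Matrix.unitaryGroup I ℂ)} (hS)
    (hT : IsCompact (T : Set (Matrix.unitaryGroup I ℂ))) (h : S ≤ T) :
    momentOp t (haarOn S hS) * momentOp t (haarOn T hT) = momentOp t (haarOn T hT) := by
  have := congrArg Matrix.conjTranspose (momentOp_mul_momentOp t hS hT h)
  rwa [Matrix.conjTranspose_mul, momentOp_haarOn_conjTranspose,
    momentOp_haarOn_conjTranspose] at this

/-- Left translation by u ∈ S does not change the average, so its range is invariant; conversely,
averaging a constant orbit gives the vector back. -/
theorem momentOp_mulVec_eq_iff (v : (Fin t → I) × (Fin t → I) → ℂ) :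
    momentOp t (haarOn S hS) *ᵥ v = v ↔
      ∀ u ∈ S, mixedTensor t (u : Matrix I I ℂ) *ᵥ v = v := by
  constructor
  · intro h u hu
    rw [← h, Matrix.mulVec_mulVec, mixedTensor_mul_momentOp S hS t hu]
  · intro h
    ext a
    exact map_momentOp_haarOn_of_forall_mem S hS t
      ((LinearMap.proj a).comp ((Matrix.mulVecBilin ℂ ℂ).flip v)) (v a)
      fun u hu => by simp [h u hu]

end Haar

theorem momentOp_haarMixture {Γ : Type*} [Fintype Γ] (p : Γ → ℝ) (hp : ∀ γ, 0 < p γ)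
    (S : Γ → Subgroup (Matrix.unitaryGroup I ℂ))
    (hS : ∀ γ, IsCompact (S γ : Set (Matrix.unitaryGroup I ℂ))) (t : ℕ) :
    momentOp t (haarMixture p S hS) = ∑ γ, (p γ : ℂ) • momentOp t (haarOn (S γ) (hS γ)) := by
  ext a b
  rw [momentOp_apply, haarMixture, integral_finsetSum_measure, Matrix.sum_apply]
  · refine Finset.sum_congr rfl fun γ _ => ?_
    rw [integral_smul_measure, Matrix.smul_apply, momentOp_apply,
      ENNReal.toReal_ofReal (hp γ).le, Complex.real_smul, smul_eq_mul]
  · intro γ _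
    exact (integrable_of_continuous _ (continuous_mixedTensor_apply t a b)).smul_measure
      ENNReal.ofReal_ne_top

end Moments

/-! ### Powers of Hermitian contractions and the design property -/

section Convergence

theorem tendsto_pow_zero_of_isHermitian {n : Type*} [Fintype n] [DecidableEq n]
    {N : Matrix n n ℂ} (hN : N.IsHermitian)
    (h : ∀ (κ : ℝ) (v : n → ℂ), v ≠ 0 → N *ᵥ v = (κ : ℂ) • v → |κ| < 1) :
    Tendsto (fun D : ℕ => N ^ D) atTop (𝓝 0) := by
  have hκ : ∀ i, |hN.eigenvalues i| < 1 := fun i => by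
    refine h _ (WithLp.ofLp (hN.eigenvectorBasis i)) ?_ ?_
    · intro h0
      exact hN.eigenvectorBasis.orthonormal.ne_zero i ((WithLp.ofLp_eq_zero 2).mp h0)
    · rw [hN.mulVec_eigenvectorBasis i]
      rfl
  have hpow : ∀ D : ℕ, N ^ D = (hN.eigenvectorUnitary : Matrix n n ℂ) *
      (Matrix.diagonal fun i => (hN.eigenvalues i : ℂ) ^ D) *
        star (hN.eigenvectorUnitary : Matrix n n ℂ) := fun D => by
    conv_lhs => rw [hN.spectral_theorem]
    rw [← map_pow, Unitary.conjStarAlgAut_apply, Matrix.diagonal_pow]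
    rfl
  simp only [hpow]
  have hd : Tendsto (fun D : ℕ => Matrix.diagonal fun i => (hN.eigenvalues i : ℂ) ^ D) atTop
      (𝓝 (Matrix.diagonal fun _ : n => (0 : ℂ))) := by
    refine ((continuous_id.matrix_diagonal (n := n) (R := ℂ)).tendsto _).comp
      (tendsto_pi_nhds.mpr fun i => tendsto_pow_atTop_nhds_zero_of_norm_lt_one ?_)
    rw [Complex.norm_real]
    exact hκ i
  have := (hd.const_mul (hN.eigenvectorUnitary : Matrix n n ℂ)).mul_const
    (star (hN.eigenvectorUnitary : Matrix n n ℂ))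
  simpa using this

/-- Pairing the eigenvalue equation with v gives κ‖v‖² = ∑ p_γ ‖P_γ v‖² ≥ 0. By Pythagoras, (1 -
κ)‖v‖² = ∑ p_γ ‖v - P_γ v‖², so κ ≥ 1 forces every summand on the right to vanish. -/
theorem eigenvalue_mem_of_sum_projections {n Γ : Type*} [Fintype n] [Fintype Γ]
    (P : Γ → Matrix n n ℂ) (hP : ∀ γ, (P γ)ᴴ = P γ) (hPP : ∀ γ, P γ * P γ = P γ)
    (p : Γ → ℝ) (hp : ∀ γ, 0 < p γ) (hp1 : ∑ γ, p γ = 1) (κ : ℝ) (v : n → ℂ) (hv : v ≠ 0)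
    (h : (∑ γ, (p γ : ℂ) • P γ) *ᵥ v = (κ : ℂ) • v) :
    0 ≤ κ ∧ (κ < 1 ∨ ∀ γ, P γ *ᵥ v = v) := by
  let q : (n → ℂ) → ℝ := fun w => ∑ i, ‖w i‖ ^ 2
  have hq : ∀ w, star w ⬝ᵥ w = (q w : ℂ) := fun w => by
    simp only [dotProduct, q, Complex.ofReal_sum]
    refine Finset.sum_congr rfl fun i _ => ?_
    have := Complex.conj_mul' (w i)
    simpa using this
  have hq0 : ∀ w, 0 ≤ q w := fun w => Finset.sum_nonneg fun i _ => by positivity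
  have hqz : ∀ w, q w = 0 → w = 0 := fun w hw => by
    ext i
    have := (Finset.sum_eq_zero_iff_of_nonneg (fun i _ => by positivity)).mp hw i
      (Finset.mem_univ i)
    simpa using this
  have hPq : ∀ γ, star v ⬝ᵥ (P γ *ᵥ v) = (q (P γ *ᵥ v) : ℂ) := fun γ => by
    rw [← hq, Matrix.star_mulVec, ← Matrix.dotProduct_mulVec, hP, Matrix.mulVec_mulVec, hPP]
  have hsplit : ∀ γ, q v = q (P γ *ᵥ v) + q (v - P γ *ᵥ v) := fun γ => by
    have h1 : star (P γ *ᵥ v) ⬝ᵥ v = (q (P γ *ᵥ v) : ℂ) := by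
      rw [Matrix.star_mulVec, ← Matrix.dotProduct_mulVec, hP, hPq]
    have h2 := hq (v - P γ *ᵥ v)
    rw [star_sub, sub_dotProduct, dotProduct_sub, dotProduct_sub, hq, hPq, h1, hq] at h2
    have h3 : ((q v : ℝ) : ℂ) = ((q (P γ *ᵥ v) + q (v - P γ *ᵥ v) : ℝ) : ℂ) := by
      push_cast
      rw [← h2]
      ring
    exact_mod_cast h3
  have hsum : ∑ γ, p γ * q (P γ *ᵥ v) = κ * q v := by
    have h1 := congrArg (fun w => star v ⬝ᵥ w) h
    simp only [Matrix.sum_mulVec, Matrix.smul_mulVec, dotProduct_sum, dotProduct_smul, hPq, hq,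
      smul_eq_mul] at h1
    exact_mod_cast h1
  have hv0 : 0 < q v := lt_of_le_of_ne (hq0 v) fun h0 => hv (hqz v h0.symm)
  constructor
  · by_contra hneg
    have : 0 ≤ κ * q v := hsum ▸ Finset.sum_nonneg fun γ _ => mul_nonneg (hp γ).le (hq0 _)
    nlinarith
  · by_cases hk : κ < 1
    · exact Or.inl hk
    · right
      have h1 : ∑ γ, p γ * q (v - P γ *ᵥ v) = (1 - κ) * q v := by
        have : ∀ γ, p γ * q (v - P γ *ᵥ v) = p γ * q v - p γ * q (P γ *ᵥ v) := fun γ => by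
          rw [hsplit γ]; ring
        simp only [this]
        rw [Finset.sum_sub_distrib, hsum, ← Finset.sum_mul, hp1]
        ring
      have h2 : ∑ γ, p γ * q (v - P γ *ᵥ v) = 0 :=
        le_antisymm (h1 ▸ mul_nonpos_of_nonpos_of_nonneg (by linarith) hv0.le)
          (Finset.sum_nonneg fun γ _ => mul_nonneg (hp γ).le (hq0 _))
      intro γ
      have h3 := (Finset.sum_eq_zero_iff_of_nonneg
        (fun γ _ => mul_nonneg (hp γ).le (hq0 _))).mp h2 γ (Finset.mem_univ γ)
      rcases mul_eq_zero.mp h3 with h4 | h4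
      · exact absurd h4 (hp γ).ne'
      · exact (sub_eq_zero.mp (hqz _ h4)).symm

variable {I : Type*} [Fintype I] [DecidableEq I] {Γ : Type*} [Fintype Γ] (p : Γ → ℝ)
  (S : Γ → Subgroup (Matrix.unitaryGroup I ℂ))
  (hS : ∀ γ, IsCompact (S γ : Set (Matrix.unitaryGroup I ℂ)))
  (T : Subgroup (Matrix.unitaryGroup I ℂ)) (hT : IsCompact (T : Set (Matrix.unitaryGroup I ℂ)))
  (t : ℕ)

/-- The moment operators of a mixture converge to that of `T` if every vector fixed by all the
subgroups is fixed by `T`. -/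
theorem tendsto_momentOp_pow (hp : ∀ γ, 0 < p γ) (hp1 : ∑ γ, p γ = 1) (hST : ∀ γ, S γ ≤ T)
    (hfix : ∀ v : (Fin t → I) × (Fin t → I) → ℂ,
      (∀ γ, ∀ u ∈ S γ, mixedTensor t (u : Matrix I I ℂ) *ᵥ v = v) →
        ∀ u ∈ T, mixedTensor t (u : Matrix I I ℂ) *ᵥ v = v) :
    Tendsto (fun D : ℕ => momentOp t (haarMixture p S hS) ^ D) atTop
      (𝓝 (momentOp t (haarOn T hT))) := by
  set M := momentOp t (haarMixture p S hS) with hMdef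
  set Q := momentOp t (haarOn T hT) with hQdef
  have hM : M = ∑ γ, (p γ : ℂ) • momentOp t (haarOn (S γ) (hS γ)) :=
    momentOp_haarMixture p hp S hS t
  have hpc : ∑ γ, (p γ : ℂ) = 1 := by exact_mod_cast hp1
  have hQM : Q * M = Q := by
    rw [hM, Matrix.mul_sum]
    simp only [Matrix.mul_smul, hQdef, momentOp_mul_momentOp t (hS _) hT (hST _)]
    rw [← Finset.sum_smul, hpc, one_smul]
  have hMQ : M * Q = Q := by
    rw [hM, Matrix.sum_mul]
    simp only [Matrix.smul_mul, hQdef, momentOp_mul_momentOp' t (hS _) hT (hST _)]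
    rw [← Finset.sum_smul, hpc, one_smul]
  have hQQ : Q * Q = Q := momentOp_mul_momentOp t hT hT le_rfl
  have hQh : Qᴴ = Q := momentOp_haarOn_conjTranspose T hT t
  have hMh : Mᴴ = M := by
    rw [hM, Matrix.conjTranspose_sum]
    refine Finset.sum_congr rfl fun γ _ => ?_
    rw [Matrix.conjTranspose_smul, momentOp_haarOn_conjTranspose]
    simp
  -- Since MQ = QM = QQ = Q, the parts M - Q and Q annihilate each other. The exponent is shifted
  -- because the zeroth powers do not split in this way.
  have hpow : ∀ D : ℕ, M ^ (D + 1) = (M - Q) ^ (D + 1) + Q := by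
    intro D
    induction D with
    | zero => simp
    | succ D ih =>
      have hz : ∀ D : ℕ, (M - Q) ^ (D + 1) * Q = 0 := fun D => by
        rw [pow_succ, Matrix.mul_assoc, Matrix.sub_mul, hMQ, hQQ, sub_self, Matrix.mul_zero]
      rw [pow_succ, ih, pow_succ _ (D + 1), Matrix.add_mul, Matrix.mul_sub, hz, hQM, sub_zero]
  have hlim : Tendsto (fun D : ℕ => (M - Q) ^ D) atTop (𝓝 0) := by
    refine tendsto_pow_zero_of_isHermitian (by
      rw [Matrix.IsHermitian, Matrix.conjTranspose_sub, hMh, hQh]) fun κ v hv h => ?_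
    by_cases hκ : κ = 0
    · simp [hκ]
    -- As Q(M - Q) = 0, an eigenvector of M - Q with nonzero eigenvalue is killed by Q, hence is an
    -- eigenvector of M for the same eigenvalue.
    have hQv : Q *ᵥ v = 0 := by
      have h1 := congrArg (fun w => Q *ᵥ w) h
      simp only [Matrix.mulVec_mulVec, Matrix.mul_sub, hQM, hQQ, sub_self, Matrix.zero_mulVec,
        Matrix.mulVec_smul] at h1
      exact (smul_eq_zero.mp h1.symm).resolve_left (by exact_mod_cast hκ)
    rw [Matrix.sub_mulVec, hQv, sub_zero, hM] at h
    obtain ⟨h0, h1⟩ := eigenvalue_mem_of_sum_projections _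
      (fun γ => momentOp_haarOn_conjTranspose (S γ) (hS γ) t)
      (fun γ => momentOp_mul_momentOp t (hS γ) (hS γ) le_rfl) p hp hp1 κ v hv h
    rw [abs_of_nonneg h0]
    -- A vector fixed by all the projections would satisfy Qv = v by `hfix`, contradicting Qv = 0
    -- and v ≠ 0.
    refine h1.resolve_right fun h2 => hv ?_
    rw [← hQv, eq_comm]
    exact (momentOp_mulVec_eq_iff T hT t v).mpr
      (hfix v fun γ => (momentOp_mulVec_eq_iff (S γ) (hS γ) t v).mp (h2 γ))
  rw [← tendsto_add_atTop_iff_nat 1]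
  simp only [hpow]
  simpa using ((tendsto_add_atTop_iff_nat 1).mpr hlim).add_const Q

/-- A character of `T` that occurs in the mixed tensor power and is trivial on all the subgroups,
but not on `T`, prevents convergence. -/
theorem not_tendsto_momentOp_pow (hp : ∀ γ, 0 < p γ) (hp1 : ∑ γ, p γ = 1) (hST : ∀ γ, S γ ≤ T)
    (L : Matrix ((Fin t → I) × (Fin t → I)) ((Fin t → I) × (Fin t → I)) ℂ →ₗ[ℂ] ℂ)
    (χ : Matrix.unitaryGroup I ℂ → ℂ) (hχ1 : χ 1 = 1)
    (hχ : ∀ u ∈ T, ∀ w ∈ T, χ (u * w) = χ u * χ w)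
    (hL : ∀ u ∈ T, L (mixedTensor t (u : Matrix I I ℂ)) = χ u)
    (hχS : ∀ γ, ∀ u ∈ S γ, χ u = 1) (hχT : ∃ u ∈ T, χ u ≠ 1) :
    ¬ Tendsto (fun D : ℕ => momentOp t (haarMixture p S hS) ^ D) atTop
      (𝓝 (momentOp t (haarOn T hT))) := by
  intro hlim
  have hpc : ∑ γ, (p γ : ℂ) = 1 := by exact_mod_cast hp1
  have hLc : Continuous L := L.continuous_of_finiteDimensional
  -- The prefactor u is kept general in the induction: each new averaging factor s ∈ S γ is absorbed
  -- into it, and χ (u * s) = χ u.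
  have h1 : ∀ D : ℕ, ∀ u ∈ T, L (mixedTensor t (u : Matrix I I ℂ) *
      momentOp t (haarMixture p S hS) ^ D) = χ u := by
    intro D
    induction D with
    | zero =>
      intro u hu
      rw [pow_zero, Matrix.mul_one, hL u hu]
    | succ D ih =>
      intro u hu
      have h2 : ∀ γ, L (mixedTensor t (u : Matrix I I ℂ) * (momentOp t (haarOn (S γ) (hS γ)) *
          momentOp t (haarMixture p S hS) ^ D)) = χ u := fun γ => by
        refine map_momentOp_haarOn_of_forall_mem (S γ) (hS γ) t
          (L.comp ((LinearMap.mulLeft ℂ (mixedTensor t (u : Matrix I I ℂ))).comp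
            (LinearMap.mulRight ℂ (momentOp t (haarMixture p S hS) ^ D)))) (χ u) fun s hs => ?_
        simp only [LinearMap.comp_apply, LinearMap.mulLeft_apply, LinearMap.mulRight_apply]
        rw [← Matrix.mul_assoc, ← mixedTensor_mul]
        have h3 := ih (u * s) (mul_mem hu (hST γ hs))
        rwa [hχ u hu s (hST γ hs), hχS γ s hs, mul_one] at h3
      rw [pow_succ']
      nth_rewrite 1 [momentOp_haarMixture p hp S hS t]
      rw [Matrix.sum_mul, Matrix.mul_sum, map_sum]
      simp only [Matrix.smul_mul, Matrix.mul_smul, map_smul, h2]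
      rw [← Finset.sum_smul, hpc, one_smul]
  have hL1 : L (momentOp t (haarOn T hT)) = 1 := by
    refine tendsto_nhds_unique ((hLc.tendsto _).comp hlim) ?_
    have h2 : (L ∘ fun D : ℕ => momentOp t (haarMixture p S hS) ^ D) = fun _ => 1 := by
      funext D
      have := h1 D 1 (one_mem T)
      rw [hχ1] at this
      rw [Function.comp_apply, ← this]
      congr 1
      rw [show ((1 : Matrix.unitaryGroup I ℂ) : Matrix I I ℂ) = 1 from rfl, mixedTensor_one,
        Matrix.one_mul]
    rw [h2]
    exact tendsto_const_nhds
  obtain ⟨u, hu, hu1⟩ := hχT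
  apply hu1
  -- Translating the Haar integral by u multiplies it by χ u; as the integral equals 1, this would
  -- give χ u = 1.
  have h3 := integral_haarOn_mul_left T hT (fun U => L (mixedTensor t (U : Matrix I I ℂ))) hu
  rw [← map_momentOp, hL1] at h3
  rw [← h3]
  have h4 : ∀ᵐ U : Matrix.unitaryGroup I ℂ ∂(haarOn T hT),
      L (mixedTensor t ((u * U : Matrix.unitaryGroup I ℂ) : Matrix I I ℂ)) =
        χ u * L (mixedTensor t (U : Matrix I I ℂ)) := by
    filter_upwards [haarOn_ae_mem T hT] with U hU
    rw [hL _ (mul_mem hu hU), hL U hU, hχ u hu U hU]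
  rw [integral_congr_ae h4, integral_const_mul, ← map_momentOp, hL1, mul_one]

end Convergence

/-! ### Closed subgroups and their Lie algebras -/

section ClosedSubgroup

open scoped Matrix.Norms.L2Operator

variable {I : Type*} [Fintype I] [DecidableEq I]

/-- Telescoping: multiplication by the unitary g preserves the norm, so only the powers of h need a
bound. -/
theorem norm_pow_sub_pow_le (g : Matrix.unitaryGroup I ℂ) (h : Matrix I I ℂ) (C : ℝ) (k : ℕ)
    (hC : ∀ j < k, ‖h ^ j‖ ≤ C) : ‖(g : Matrix I I ℂ) ^ k - h ^ k‖ ≤ k * (‖(g : Matrix I I ℂ) - h‖ * C) := by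
  induction k with
  | zero => simp
  | succ k ih =>
    have h1 : (g : Matrix I I ℂ) ^ (k + 1) - h ^ (k + 1) =
        (g : Matrix I I ℂ) * ((g : Matrix I I ℂ) ^ k - h ^ k) + ((g : Matrix I I ℂ) - h) * h ^ k := by
      rw [pow_succ', pow_succ', mul_sub, sub_mul]
      abel
    rw [h1]
    calc _ ≤ ‖(g : Matrix I I ℂ) * ((g : Matrix I I ℂ) ^ k - h ^ k)‖ + ‖((g : Matrix I I ℂ) - h) * h ^ k‖ :=
          norm_add_le _ _
      _ ≤ k * (‖(g : Matrix I I ℂ) - h‖ * C) + ‖(g : Matrix I I ℂ) - h‖ * C := by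
          refine add_le_add ?_ ((norm_mul_le _ _).trans
            (mul_le_mul_of_nonneg_left (hC k (Nat.lt_succ_self k)) (norm_nonneg _)))
          rw [CStarRing.norm_coe_unitary_mul]
          exact ih fun j hj => hC j (hj.trans (Nat.lt_succ_self k))
      _ = _ := by push_cast; ring

theorem continuous_exp_smul (B : Matrix I I ℂ) :
    Continuous fun s : ℝ => NormedSpace.exp (s • B) :=
  continuous_iff_continuousAt.mpr fun s =>
    (hasDerivAt_exp_smul_const (𝕂 := ℝ) B s).continuousAt

theorem tendsto_slope_exp (B : Matrix I I ℂ) {ε : ℕ → ℝ} (hε0 : ∀ n, 0 < ε n)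
    (hε : Tendsto ε atTop (𝓝 0)) :
    Tendsto (fun n => (ε n)⁻¹ • (NormedSpace.exp (ε n • B) - 1)) atTop (𝓝 B) := by
  have h1 := hasDerivAt_exp_smul_const (𝕂 := ℝ) B (0 : ℝ)
  rw [zero_smul, NormedSpace.exp_zero, one_mul, hasDerivAt_iff_tendsto_slope_zero] at h1
  have h2 : Tendsto ε atTop (𝓝[≠] 0) :=
    tendsto_nhdsWithin_iff.mpr ⟨hε, Eventually.of_forall fun n => (hε0 n).ne'⟩
  have h3 := h1.comp h2
  simpa [Function.comp_def] using h3

/-- Rescaled powers of group elements tending to the identity approach one-parameter groups. -/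
theorem tendsto_pow_exp (g : ℕ → Matrix.unitaryGroup I ℂ) {ε : ℕ → ℝ} (hε0 : ∀ n, 0 < ε n)
    (hε : Tendsto ε atTop (𝓝 0)) (B : Matrix I I ℂ)
    (hB : Tendsto (fun n => (ε n)⁻¹ • ((g n : Matrix I I ℂ) - NormedSpace.exp (ε n • B)))
      atTop (𝓝 0)) {θ : ℝ} (hθ : 0 ≤ θ) :
    Tendsto (fun n => (g n : Matrix I I ℂ) ^ ⌊θ * (ε n)⁻¹⌋₊) atTop
      (𝓝 (NormedSpace.exp (θ • B))) := by
  -- With step size ε, about θ/ε steps reach time θ. Rounding down keeps all intermediate times in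
  -- [0, θ], where the exponentials are uniformly bounded by `C`.
  set k : ℕ → ℕ := fun n => ⌊θ * (ε n)⁻¹⌋₊ with hk
  have hinv : Tendsto (fun n => (ε n)⁻¹) atTop atTop :=
    tendsto_inv_nhdsGT_zero.comp (tendsto_nhdsWithin_iff.mpr ⟨hε, Eventually.of_forall hε0⟩)
  have hkε : Tendsto (fun n => (k n : ℝ) * ε n) atTop (𝓝 θ) := by
    have := (tendsto_nat_floor_mul_div_atTop hθ).comp hinv
    refine this.congr fun n => ?_
    simp [hk]
  have hkle : ∀ n, (k n : ℝ) * ε n ≤ θ := fun n => by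
    have h1 : (k n : ℝ) ≤ θ * (ε n)⁻¹ :=
      Nat.floor_le (mul_nonneg hθ (inv_nonneg.mpr (hε0 n).le))
    calc (k n : ℝ) * ε n ≤ θ * (ε n)⁻¹ * ε n := mul_le_mul_of_nonneg_right h1 (hε0 n).le
      _ = θ := by rw [mul_assoc, inv_mul_cancel₀ (hε0 n).ne', mul_one]
  have hpow : ∀ n (j : ℕ), NormedSpace.exp (ε n • B) ^ j =
      NormedSpace.exp (((j : ℝ) * ε n) • B) := fun n j => by
    rw [← Matrix.exp_nsmul, ← smul_smul, Nat.cast_smul_eq_nsmul]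
  obtain ⟨C, hC⟩ : ∃ C : ℝ, ∀ s ∈ Set.Icc 0 θ, ‖NormedSpace.exp (s • B)‖ ≤ C := by
    exact isCompact_Icc.exists_bound_of_continuousOn (continuous_exp_smul B).continuousOn
  have h1 : Tendsto (fun n => NormedSpace.exp (ε n • B) ^ k n) atTop
      (𝓝 (NormedSpace.exp (θ • B))) := by
    simp only [hpow]
    exact ((continuous_exp_smul B).tendsto θ).comp hkε
  have h2 : Tendsto (fun n => (g n : Matrix I I ℂ) ^ k n - NormedSpace.exp (ε n • B) ^ k n) atTop
      (𝓝 0) := by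
    -- The accumulated error k‖g - exp(εB)‖C is the total time kε, which stays bounded, times the
    -- error per unit time, which tends to 0.
    have h3 : Tendsto (fun n => ((k n : ℝ) * ε n) *
        (‖(ε n)⁻¹ • ((g n : Matrix I I ℂ) - NormedSpace.exp (ε n • B))‖ * C)) atTop (𝓝 0) := by
      have := hkε.mul (hB.norm.mul_const C)
      simpa using this
    refine squeeze_zero_norm (fun n => ?_) h3
    refine (norm_pow_sub_pow_le (g n) _ C (k n) fun j hj => ?_).trans (le_of_eq ?_)
    · rw [hpow]
      refine hC _ ⟨mul_nonneg (Nat.cast_nonneg j) (hε0 n).le, le_trans ?_ (hkle n)⟩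
      exact mul_le_mul_of_nonneg_right (by exact_mod_cast hj.le) (hε0 n).le
    · rw [norm_smul, norm_inv, Real.norm_of_nonneg (hε0 n).le]
      have := (hε0 n).ne'
      field_simp
  simpa using h2.add h1

/-- Otherwise the elements of S within ε of the identity lie in K, and their translates make K open
in S. It is also closed, so connectedness would give S = K. -/
theorem exists_mem_near_one {S K : Subgroup (Matrix.unitaryGroup I ℂ)}
    (hconn : IsConnected (S : Set (Matrix.unitaryGroup I ℂ)))
    (hK : IsCompact (K : Set (Matrix.unitaryGroup I ℂ))) (hKS : K ≤ S)
    (hSK : ¬ S ≤ K) {ε : ℝ} (hε : 0 < ε) :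
    ∃ g ∈ S, g ∉ K ∧ ‖(g : Matrix I I ℂ) - 1‖ < ε := by
  by_contra hcon
  push Not at hcon
  apply hSK
  intro s hs
  by_contra hsK
  let V : Set (Matrix.unitaryGroup I ℂ) :=
    {u | ∃ k ∈ K, ‖((k⁻¹ * u : Matrix.unitaryGroup I ℂ) : Matrix I I ℂ) - 1‖ < ε}
  have hV : IsOpen V := by
    have : V = ⋃ k ∈ K, {u | ‖((k⁻¹ * u : Matrix.unitaryGroup I ℂ) : Matrix I I ℂ) - 1‖ < ε} := by
      ext u
      simp [V]
    rw [this]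
    refine isOpen_biUnion fun k _ => isOpen_lt ?_ continuous_const
    exact ((continuous_subtype_val.comp (continuous_const.mul continuous_id)).sub
      continuous_const).norm
  obtain ⟨u, huS, ⟨k, hk, hku⟩, huK⟩ := hconn.isPreconnected V (K : Set _)ᶜ hV
    hK.isClosed.isOpen_compl (fun u _ => by
      by_cases hu : u ∈ K
      · exact Or.inl ⟨u, hu, by simpa using hε⟩
      · exact Or.inr hu) ⟨1, one_mem S, 1, one_mem K, by simpa using hε⟩ ⟨s, hs, hsK⟩
  by_cases hkK : k⁻¹ * u ∈ K
  · exact huK (by simpa using mul_mem hk hkK)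
  · exact absurd hku (not_lt.mpr (hcon _ (mul_mem (inv_mem (hKS hk)) huS) hkK))

/-- Compactness of K provides the element of the coset gK closest to the identity. This minimality
takes the place of choosing g transversal to K. -/
theorem exists_minimal_near_one {S K : Subgroup (Matrix.unitaryGroup I ℂ)}
    (hconn : IsConnected (S : Set (Matrix.unitaryGroup I ℂ)))
    (hK : IsCompact (K : Set (Matrix.unitaryGroup I ℂ))) (hKS : K ≤ S) (hSK : ¬ S ≤ K) {ε : ℝ}
    (hε : 0 < ε) :
    ∃ g ∈ S, g ∉ K ∧ ‖(g : Matrix I I ℂ) - 1‖ < ε ∧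
      ∀ k ∈ K, ‖(g : Matrix I I ℂ) - 1‖ ≤ ‖(g : Matrix I I ℂ) * (k : Matrix I I ℂ) - 1‖ := by
  obtain ⟨g, hgS, hgK, hg⟩ := exists_mem_near_one hconn hK hKS hSK hε
  obtain ⟨k, hk, hmin⟩ := hK.exists_isMinOn ⟨1, one_mem K⟩
    (f := fun k : Matrix.unitaryGroup I ℂ => ‖(g : Matrix I I ℂ) * (k : Matrix I I ℂ) - 1‖)
    ((continuous_const.mul continuous_subtype_val).sub continuous_const).norm.continuousOn
  refine ⟨g * k, mul_mem hgS (hKS hk), fun h => hgK ?_, ?_, fun k' hk' => ?_⟩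
  · simpa using mul_mem h (inv_mem hk)
  · refine lt_of_le_of_lt ?_ hg
    simpa using hmin (one_mem K)
  · have := hmin (mul_mem hk hk')
    simpa [mul_assoc] using this

/-- A closed subgroup of a connected closed subgroup of the unitary group is the whole of it if it
has the same Lie algebra. -/
theorem le_of_lieAlg_subset {S K : Subgroup (Matrix.unitaryGroup I ℂ)}
    (hS : IsCompact (S : Set (Matrix.unitaryGroup I ℂ)))
    (hconn : IsConnected (S : Set (Matrix.unitaryGroup I ℂ)))
    (hK : IsCompact (K : Set (Matrix.unitaryGroup I ℂ))) (hKS : K ≤ S)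
    (hlie : lieAlg S ⊆ lieAlg K) : S ≤ K := by
  by_contra hSK
  choose g hgS hgK hg hmin using fun n : ℕ =>
    exists_minimal_near_one hconn hK hKS hSK (ε := 1 / ((n : ℝ) + 1)) (by positivity)
  have hpos : ∀ n, 0 < ‖(g n : Matrix I I ℂ) - 1‖ := fun n => by
    rw [norm_pos_iff, sub_ne_zero]
    exact fun h => hgK n (by
      rw [show g n = 1 from Subtype.ext h]
      exact one_mem K)
  have hlim : Tendsto (fun n => ‖(g n : Matrix I I ℂ) - 1‖) atTop (𝓝 0) :=
    squeeze_zero (fun n => norm_nonneg _) (fun n => (hg n).le)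
      tendsto_one_div_add_atTop_nhds_zero_nat
  have : ProperSpace (Matrix I I ℂ) := FiniteDimensional.proper ℂ _
  -- B is a limiting direction in which the elements outside K approach the identity. It will turn
  -- out to be tangent to S, hence to K, which contradicts their being closest in their cosets.
  obtain ⟨B, -, φ, hφ, hB⟩ := (isCompact_sphere (0 : Matrix I I ℂ) 1).tendsto_subseq
    (x := fun n => ‖(g n : Matrix I I ℂ) - 1‖⁻¹ • ((g n : Matrix I I ℂ) - 1)) fun n => by
      rw [mem_sphere_zero_iff_norm, norm_smul, norm_inv, norm_norm, inv_mul_cancel₀ (hpos n).ne']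
  set ε : ℕ → ℝ := fun n => ‖(g (φ n) : Matrix I I ℂ) - 1‖ with hεdef
  have hε0 : ∀ n, 0 < ε n := fun n => hpos _
  have hε : Tendsto ε atTop (𝓝 0) := hlim.comp hφ.tendsto_atTop
  -- Both (g - 1)/ε and (exp(εB) - 1)/ε converge to B, so g and exp(εB) differ by o(ε).
  have hdiff : Tendsto (fun n => (ε n)⁻¹ •
      ((g (φ n) : Matrix I I ℂ) - NormedSpace.exp (ε n • B))) atTop (𝓝 0) := by
    have := hB.sub (tendsto_slope_exp B hε0 hε)
    rw [sub_self] at this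
    refine this.congr fun n => ?_
    simp only [Function.comp_apply, ← smul_sub, hεdef]
    congr 1
    abel
  have hpt : ∀ θ : ℝ, 0 ≤ θ → ∃ U ∈ S, (U : Matrix I I ℂ) = NormedSpace.exp (θ • B) := by
    intro θ hθ
    have h1 := tendsto_pow_exp (fun n => g (φ n)) hε0 hε B hdiff hθ
    have hcl : IsClosed (Subtype.val '' (S : Set (Matrix.unitaryGroup I ℂ))) :=
      (hS.image continuous_subtype_val).isClosed
    obtain ⟨U, hU, hUe⟩ := hcl.mem_of_tendsto h1 (Eventually.of_forall fun n =>
      ⟨g (φ n) ^ ⌊θ * (ε n)⁻¹⌋₊, pow_mem (hgS _) _, rfl⟩)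
    exact ⟨U, hU, hUe⟩
  have hneg : ∀ θ : ℝ, NormedSpace.exp (θ • B) * NormedSpace.exp ((-θ) • B) = 1 := fun θ => by
    rw [← Matrix.exp_add_of_commute _ _ ((Commute.refl B).smul_left _ |>.smul_right _),
      ← add_smul, add_neg_cancel, zero_smul, NormedSpace.exp_zero]
  have hall : ∀ θ : ℝ, ∃ U ∈ S, (U : Matrix I I ℂ) = NormedSpace.exp (θ • B) := by
    intro θ
    rcases le_total 0 θ with hθ | hθ
    · exact hpt θ hθ
    · obtain ⟨U, hU, hUe⟩ := hpt (-θ) (by linarith)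
      refine ⟨U⁻¹, inv_mem hU, ?_⟩
      have h1 : ((U⁻¹ : Matrix.unitaryGroup I ℂ) : Matrix I I ℂ) * U = 1 := by
        rw [← Submonoid.coe_mul, inv_mul_cancel]
        rfl
      have h2 := hneg (-θ)
      rw [neg_neg, ← hUe] at h2
      exact left_inv_eq_right_inv h1 h2
  have hsm : ∀ θ : ℝ, ((θ : ℂ) * Complex.I) • ((-Complex.I) • B) = θ • B := fun θ => by
    rw [smul_smul, mul_assoc, mul_neg, Complex.I_mul_I, neg_neg, mul_one, Complex.coe_smul]
  have hA : (-Complex.I) • B ∈ lieAlg K := hlie fun θ => by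
    rw [hsm]
    exact hall θ
  -- The element k = exp(-εB) lies in K, so minimality gives ε ≤ ‖gk - 1‖ = ‖g - exp(εB)‖, against
  -- the o(ε) bound.
  have hle : ∀ n, 1 ≤ ‖(ε n)⁻¹ • ((g (φ n) : Matrix I I ℂ) - NormedSpace.exp (ε n • B))‖ := by
    intro n
    obtain ⟨k, hk, hke⟩ := hA (-ε n)
    rw [hsm] at hke
    have h1 : (g (φ n) : Matrix I I ℂ) * (k : Matrix I I ℂ) - 1 =
        ((g (φ n) : Matrix I I ℂ) - NormedSpace.exp (ε n • B)) * (k : Matrix I I ℂ) := by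
      rw [sub_mul, hke, hneg]
    have h2 := hmin (φ n) k hk
    rw [h1, CStarRing.norm_mul_coe_unitary] at h2
    rw [norm_smul, norm_inv, Real.norm_of_nonneg (hε0 n).le, ← inv_mul_cancel₀ (hε0 n).ne']
    exact mul_le_mul_of_nonneg_left h2 (inv_nonneg.mpr (hε0 n).le)
  have h0 := hdiff.norm
  rw [norm_zero] at h0
  exact absurd (ge_of_tendsto' h0 hle) (by norm_num)

end ClosedSubgroup

/-! ### Symmetric operators in block form -/

section Blocks

open scoped Matrix.Norms.L2Operator

/-- Matrices commuting with all unitary matrices are scalar. -/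
theorem exists_eq_smul_one_of_commute_unitary {n : Type*} [Fintype n] [DecidableEq n]
    (Z : Matrix n n ℂ) (h : ∀ V : Matrix.unitaryGroup n ℂ, Z * V = V * Z) :
    ∃ c : ℂ, Z = c • 1 := by
  have hall : ∀ X : Matrix n n ℂ, Z * X = X * Z := fun X => by
    -- The unitaries span the whole matrix algebra, so commuting with them already means being
    -- central.
    have hX : X ∈ Submodule.span ℂ (unitary (Matrix n n ℂ) : Set (Matrix n n ℂ)) := by
      rw [CStarAlgebra.span_unitary]
      trivial
    induction hX using Submodule.span_induction with
    | mem V hV => exact h ⟨V, hV⟩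
    | zero => simp
    | add X Y _ _ hX hY => rw [mul_add, add_mul, hX, hY]
    | smul c X _ hX => rw [mul_smul_comm, smul_mul_assoc, hX]
  obtain ⟨c, hc⟩ := Matrix.mem_range_scalar_of_commute_single
    (M := Z) fun i j _ => (hall (Matrix.single i j 1)).symm
  exact ⟨c, by rw [← hc, Matrix.smul_one_eq_diagonal]; rfl⟩

variable {I : Type*} [Fintype I] [DecidableEq I] {G : Type*} [Group G]

/-- Schur's lemma for inequivalent representations. -/
theorem eq_zero_of_intertwines {k k' : ℕ} (σ : G →* Matrix.unitaryGroup (Fin k) ℂ)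
    (σ' : G →* Matrix.unitaryGroup (Fin k') ℂ) (hσ : (toRep σ).IsIrreducible)
    (hσ' : (toRep σ').IsIrreducible) (hne : IsEmpty ((toRep σ).Equiv (toRep σ')))
    (X : Matrix (Fin k') (Fin k) ℂ)
    (hX : ∀ g, X * (σ g : Matrix (Fin k) (Fin k) ℂ) = (σ' g : Matrix (Fin k') (Fin k') ℂ) * X) :
    X = 0 := by
  let f : (toRep σ).IntertwiningMap (toRep σ') :=
    ⟨Matrix.toLin' X, fun g => LinearMap.ext fun v => by
      simp only [LinearMap.comp_apply, Matrix.toLin'_apply, toRep_apply, Matrix.mulVec_mulVec, hX]⟩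
  have hf : f = 0 := Subsingleton.elim _ _
  refine Matrix.toLin'.injective (LinearMap.ext fun v => ?_)
  rw [map_zero]
  exact DFunLike.congr_fun hf v

/-- Schur's lemma for the endomorphisms of an irreducible representation. -/
theorem exists_eq_smul_one_of_intertwines {k : ℕ} (σ : G →* Matrix.unitaryGroup (Fin k) ℂ)
    (hσ : (toRep σ).IsIrreducible) (X : Matrix (Fin k) (Fin k) ℂ)
    (hX : ∀ g, X * (σ g : Matrix (Fin k) (Fin k) ℂ) = (σ g : Matrix (Fin k) (Fin k) ℂ) * X) :
    ∃ c : ℂ, X = c • 1 := by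
  let f : (toRep σ).IntertwiningMap (toRep σ) :=
    ⟨Matrix.toLin' X, fun g => LinearMap.ext fun v => by
      simp only [LinearMap.comp_apply, Matrix.toLin'_apply, toRep_apply, Matrix.mulVec_mulVec, hX]⟩
  obtain ⟨c, hc⟩ :=
    (Representation.IsIrreducible.algebraMap_intertwiningMap_bijective_of_isAlgClosed
      (ρ := toRep σ)).2 f
  refine ⟨c, Matrix.toLin'.injective (LinearMap.ext fun v => ?_)⟩
  have : f v = c • v := by rw [← hc]; rfl
  simpa [f, Matrix.toLin'_apply, Matrix.smul_mulVec] using this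

namespace IrrepDecomposition

variable {R : G →* Matrix.unitaryGroup I ℂ} {Λ : Type*} [Fintype Λ]
  (D : IrrepDecomposition R Λ)

/-- The tuples of blocks of symmetric operators. -/
abbrev Tuple : Type _ := ∀ l, Matrix (Fin (D.m l)) (Fin (D.m l)) ℂ

/-- The tuples of blocks of symmetric unitaries. -/
abbrev UTuple : Type _ := ∀ l, Matrix.unitaryGroup (Fin (D.m l)) ℂ

/-- The symmetric operator `∑_λ F_λ (1 ⊗ B_λ) F_λ†` with given blocks. -/
def ofBlocks : D.Tuple →⋆ₐ[ℂ] Matrix I I ℂ where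
  toFun B := ∑ l, D.F l * ((1 : Matrix (Fin (D.r l)) (Fin (D.r l)) ℂ) ⊗ₖ B l) * (D.F l)ᴴ
  map_one' := by
    simp only [Pi.one_apply, Matrix.one_kronecker_one, Matrix.mul_one]
    exact D.complete
  map_mul' A B := by
    rw [Matrix.sum_mul]
    refine Finset.sum_congr rfl fun l _ => ?_
    rw [Matrix.mul_sum, Finset.sum_eq_single l]
    · calc _ = D.F l * (((1 : Matrix (Fin (D.r l)) (Fin (D.r l)) ℂ) ⊗ₖ A l) *
            ((1 : Matrix (Fin (D.r l)) (Fin (D.r l)) ℂ) ⊗ₖ B l)) * (D.F l)ᴴ := by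
            rw [← Matrix.mul_kronecker_mul, Matrix.one_mul]; rfl
        _ = D.F l * (((1 : Matrix (Fin (D.r l)) (Fin (D.r l)) ℂ) ⊗ₖ A l) * ((D.F l)ᴴ * D.F l) *
            ((1 : Matrix (Fin (D.r l)) (Fin (D.r l)) ℂ) ⊗ₖ B l)) * (D.F l)ᴴ := by
            rw [D.isometry, Matrix.mul_one]
        _ = _ := by simp only [Matrix.mul_assoc]
    · intro l' _ hne
      calc _ = D.F l * ((1 : Matrix (Fin (D.r l)) (Fin (D.r l)) ℂ) ⊗ₖ A l) *
            ((D.F l)ᴴ * D.F l') * (((1 : Matrix (Fin (D.r l')) (Fin (D.r l')) ℂ) ⊗ₖ B l') *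
              (D.F l')ᴴ) := by simp only [Matrix.mul_assoc]
        _ = 0 := by rw [D.orthogonal l l' hne.symm, Matrix.mul_zero, Matrix.zero_mul]
    · simp
  map_zero' := by simp
  map_add' A B := by
    simp [Matrix.kronecker_add, Matrix.mul_add, Matrix.add_mul, Finset.sum_add_distrib]
  commutes' c := by
    rw [Algebra.algebraMap_eq_smul_one, Algebra.algebraMap_eq_smul_one]
    simp only [Pi.smul_apply, Pi.one_apply, Matrix.kronecker_smul, Matrix.one_kronecker_one,
      Matrix.mul_smul, Matrix.smul_mul, Matrix.mul_one, ← Finset.smul_sum, D.complete]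
  map_star' B := by
    simp only [Matrix.star_eq_conjTranspose, Matrix.conjTranspose_sum, Matrix.conjTranspose_mul,
      Matrix.conjTranspose_conjTranspose, Pi.star_apply, Matrix.conjTranspose_kronecker,
      Matrix.conjTranspose_one, Matrix.mul_assoc]

theorem ofBlocks_apply (B : D.Tuple) : D.ofBlocks B =
    ∑ l, D.F l * ((1 : Matrix (Fin (D.r l)) (Fin (D.r l)) ℂ) ⊗ₖ B l) * (D.F l)ᴴ := rfl

theorem block_ofBlocks (B : D.Tuple) : D.block (D.ofBlocks B) = B :=
  funext fun l => D.block_eq _ B rfl l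

theorem ofBlocks_injective : Function.Injective D.ofBlocks := fun A B h => by
  rw [← D.block_ofBlocks A, h, D.block_ofBlocks]

theorem rep_mul_F (g : G) (l : Λ) : (R g : Matrix I I ℂ) * D.F l =
    D.F l * ((D.irr l g : Matrix (Fin (D.r l)) (Fin (D.r l)) ℂ) ⊗ₖ
      (1 : Matrix (Fin (D.m l)) (Fin (D.m l)) ℂ)) := by
  rw [D.decomp, Matrix.sum_mul, Finset.sum_eq_single l]
  · rw [Matrix.mul_assoc, D.isometry, Matrix.mul_one]
  · intro l' _ hne
    rw [Matrix.mul_assoc, D.orthogonal l' l hne, Matrix.mul_zero]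
  · simp

theorem conjTranspose_F_mul_rep (g : G) (l : Λ) : (D.F l)ᴴ * (R g : Matrix I I ℂ) =
    ((D.irr l g : Matrix (Fin (D.r l)) (Fin (D.r l)) ℂ) ⊗ₖ
      (1 : Matrix (Fin (D.m l)) (Fin (D.m l)) ℂ)) * (D.F l)ᴴ := by
  rw [D.decomp, Matrix.mul_sum, Finset.sum_eq_single l]
  · rw [← Matrix.mul_assoc, ← Matrix.mul_assoc, D.isometry, Matrix.one_mul]
  · intro l' _ hne
    rw [← Matrix.mul_assoc, ← Matrix.mul_assoc, D.orthogonal l l' hne.symm, Matrix.zero_mul,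
      Matrix.zero_mul]
  · simp

theorem ofBlocks_mem_symOps (B : D.Tuple) : D.ofBlocks B ∈ symOps R := by
  intro g
  rw [ofBlocks_apply, Matrix.sum_mul, Matrix.mul_sum]
  refine Finset.sum_congr rfl fun l _ => ?_
  calc _ = D.F l * (((1 : Matrix (Fin (D.r l)) (Fin (D.r l)) ℂ) ⊗ₖ B l) *
        ((D.irr l g : Matrix (Fin (D.r l)) (Fin (D.r l)) ℂ) ⊗ₖ
          (1 : Matrix (Fin (D.m l)) (Fin (D.m l)) ℂ))) * (D.F l)ᴴ := by
        rw [Matrix.mul_assoc, conjTranspose_F_mul_rep]; simp only [Matrix.mul_assoc]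
    _ = D.F l * (((D.irr l g : Matrix (Fin (D.r l)) (Fin (D.r l)) ℂ) ⊗ₖ
          (1 : Matrix (Fin (D.m l)) (Fin (D.m l)) ℂ)) *
            ((1 : Matrix (Fin (D.r l)) (Fin (D.r l)) ℂ) ⊗ₖ B l)) * (D.F l)ᴴ := by
        rw [← Matrix.mul_kronecker_mul, ← Matrix.mul_kronecker_mul, Matrix.mul_one, Matrix.mul_one,
          Matrix.one_mul, Matrix.one_mul]
    _ = _ := by
        simp only [← Matrix.mul_assoc]
        rw [rep_mul_F]

/-- Schur's lemma. For fixed multiplicity indices α, β the slices of F_l† A F_l' intertwine the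
irreducible representations l' and l. They vanish for l ≠ l' and are scalar for l = l', and the
average defining `block` recovers that scalar. -/
theorem ofBlocks_block {A : Matrix I I ℂ} (hA : A ∈ symOps R) : D.ofBlocks (D.block A) = A := by
  have hX : ∀ l l' g, ((D.F l)ᴴ * A * D.F l') *
      ((D.irr l' g : Matrix (Fin (D.r l')) (Fin (D.r l')) ℂ) ⊗ₖ
        (1 : Matrix (Fin (D.m l')) (Fin (D.m l')) ℂ)) =
      ((D.irr l g : Matrix (Fin (D.r l)) (Fin (D.r l)) ℂ) ⊗ₖ
        (1 : Matrix (Fin (D.m l)) (Fin (D.m l)) ℂ)) * ((D.F l)ᴴ * A * D.F l') := by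
    intro l l' g
    calc _ = (D.F l)ᴴ * (A * (R g : Matrix I I ℂ)) * D.F l' := by
          rw [Matrix.mul_assoc, ← rep_mul_F]
          simp only [Matrix.mul_assoc]
      _ = ((D.F l)ᴴ * (R g : Matrix I I ℂ)) * A * D.F l' := by
          rw [hA g]
          simp only [Matrix.mul_assoc]
      _ = _ := by
          rw [conjTranspose_F_mul_rep]
          simp only [Matrix.mul_assoc]
  have hslice : ∀ l l' (α : Fin (D.m l)) (β : Fin (D.m l')) g,
      (Matrix.of fun a b => ((D.F l)ᴴ * A * D.F l') (a, α) (b, β)) *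
        (D.irr l' g : Matrix (Fin (D.r l')) (Fin (D.r l')) ℂ) =
      (D.irr l g : Matrix (Fin (D.r l)) (Fin (D.r l)) ℂ) *
        (Matrix.of fun a b => ((D.F l)ᴴ * A * D.F l') (a, α) (b, β)) := by
    intro l l' α β g
    ext a b
    have h1 := congrFun (congrFun (hX l l' g) (a, α)) (b, β)
    rw [Matrix.mul_apply, Matrix.mul_apply, Fintype.sum_prod_type, Fintype.sum_prod_type] at h1
    simpa [Matrix.mul_apply, Matrix.kroneckerMap_apply, Matrix.one_apply] using h1
  have hoff : ∀ l l', l ≠ l' → (D.F l)ᴴ * A * D.F l' = 0 := by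
    intro l l' hne
    ext ⟨a, α⟩ ⟨b, β⟩
    exact congrFun (congrFun (eq_zero_of_intertwines _ _ (D.irreducible l') (D.irreducible l)
      (D.inequivalent l' l hne.symm) _ (hslice l l' α β)) a) b
  have hdiag : ∀ l, (D.F l)ᴴ * A * D.F l =
      (1 : Matrix (Fin (D.r l)) (Fin (D.r l)) ℂ) ⊗ₖ D.block A l := by
    intro l
    have hr : (D.r l : ℂ) ≠ 0 := by exact_mod_cast D.r_ne_zero l
    ext ⟨a, α⟩ ⟨b, β⟩
    obtain ⟨c, hc⟩ := exists_eq_smul_one_of_intertwines _ (D.irreducible l) _ (hslice l l α β)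
    have hc' : ∀ a b, ((D.F l)ᴴ * A * D.F l) (a, α) (b, β) = c * (1 : Matrix _ _ ℂ) a b :=
      fun a b => congrFun (congrFun hc a) b
    rw [Matrix.kroneckerMap_apply, block, Matrix.of_apply]
    simp only [hc', Matrix.one_apply_eq, mul_one, Finset.sum_const, Finset.card_univ,
      Fintype.card_fin, nsmul_eq_mul]
    rw [inv_mul_cancel_left₀ hr, mul_comm]
  calc D.ofBlocks (D.block A)
      = ∑ l, ∑ l', D.F l * ((D.F l)ᴴ * A * D.F l') * (D.F l')ᴴ := by
        rw [ofBlocks_apply]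
        refine Finset.sum_congr rfl fun l _ => ?_
        rw [Finset.sum_eq_single l]
        · rw [hdiag]
        · intro l' _ hne
          rw [hoff l l' hne.symm, Matrix.mul_zero, Matrix.zero_mul]
        · simp
    _ = (∑ l, D.F l * (D.F l)ᴴ) * A * ∑ l', D.F l' * (D.F l')ᴴ := by
        simp only [Matrix.sum_mul, Matrix.mul_sum, Matrix.mul_assoc]
        exact Finset.sum_comm
    _ = A := by rw [D.complete, Matrix.one_mul, Matrix.mul_one]

theorem continuous_ofBlocks : Continuous D.ofBlocks :=
  D.ofBlocks.toAlgHom.toLinearMap.continuous_of_finiteDimensional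

theorem ofBlocks_exp (B : D.Tuple) :
    D.ofBlocks (fun l => NormedSpace.exp (B l)) = NormedSpace.exp (D.ofBlocks B) := by
  let : NormedAlgebra ℚ D.Tuple := NormedAlgebra.restrictScalars ℚ ℂ _
  rw [← NormedSpace.map_exp D.ofBlocks D.continuous_ofBlocks B]
  congr 1
  funext l
  let : ∀ l, NormedAlgebra ℚ (Matrix (Fin (D.m l)) (Fin (D.m l)) ℂ) :=
    fun l => NormedAlgebra.restrictScalars ℚ ℂ _
  exact (Pi.coe_exp B l).symm

/-- A tuple of unitary matrices as a tuple of matrices. -/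
def coeTuple : D.UTuple →* D.Tuple where
  toFun V l := V l
  map_one' := rfl
  map_mul' _ _ := rfl

theorem coeTuple_mul_star (V : D.UTuple) : D.coeTuple V * star (D.coeTuple V) = 1 :=
  funext fun l => Matrix.mem_unitaryGroup_iff.mp (V l).2

/-- The symmetric unitary with given blocks. -/
def ofUBlocks : D.UTuple →* Matrix.unitaryGroup I ℂ where
  toFun V := ⟨D.ofBlocks (D.coeTuple V), by
    rw [Matrix.mem_unitaryGroup_iff, ← map_star, ← map_mul, coeTuple_mul_star, map_one]⟩
  map_one' := Subtype.ext ((congrArg D.ofBlocks (map_one D.coeTuple)).trans (map_one _))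
  map_mul' V V' := Subtype.ext ((congrArg D.ofBlocks (map_mul D.coeTuple V V')).trans
    (map_mul _ _ _))

theorem coe_ofUBlocks (V : D.UTuple) :
    (D.ofUBlocks V : Matrix I I ℂ) = D.ofBlocks (D.coeTuple V) := rfl

theorem ofUBlocks_injective : Function.Injective D.ofUBlocks := fun V V' h => by
  have := D.ofBlocks_injective (congrArg Subtype.val h)
  exact funext fun l => Subtype.ext (congrFun this l)

theorem continuous_ofUBlocks : Continuous D.ofUBlocks :=
  (D.continuous_ofBlocks.comp (continuous_pi fun l =>
    continuous_subtype_val.comp (continuous_apply l))).subtype_mk _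

theorem ofUBlocks_mem (V : D.UTuple) : D.ofUBlocks V ∈ symUnitary R := fun g =>
  Subtype.ext (D.ofBlocks_mem_symOps _ g)

theorem exists_ofUBlocks {U : Matrix.unitaryGroup I ℂ} (hU : U ∈ symUnitary R) :
    ∃ V, D.ofUBlocks V = U := by
  have h1 : D.ofBlocks (D.block (U : Matrix I I ℂ)) = U :=
    D.ofBlocks_block fun g => congrArg Subtype.val (hU g)
  have h2 : D.block (U : Matrix I I ℂ) * star (D.block (U : Matrix I I ℂ)) = 1 := by
    apply D.ofBlocks_injective
    rw [map_mul, map_star, h1, map_one]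
    exact Matrix.mem_unitaryGroup_iff.mp U.2
  exact ⟨fun l => ⟨D.block (U : Matrix I I ℂ) l,
    Matrix.mem_unitaryGroup_iff.mpr (congrFun h2 l)⟩, Subtype.ext h1⟩

/-- A phase as a unitary scalar matrix. -/
def _root_.SymDesign.phase (n : Type*) [Fintype n] [DecidableEq n] (θ : ℝ) :
    Matrix.unitaryGroup n ℂ :=
  ⟨Complex.exp (θ * Complex.I) • 1, by
    rw [Matrix.mem_unitaryGroup_iff, star_smul, star_one, smul_mul_smul_comm, one_mul,
      Complex.star_def, ← Complex.exp_conj, ← Complex.exp_add]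
    simp⟩

/-- Testing against unitaries supported in a single sector shows that each block commutes with every
unitary matrix of its size, hence is scalar. Unitarity, read off at a diagonal entry (there is one
since the multiplicity is positive), makes the scalar a phase. -/
theorem exists_phase_of_mem_symCenter {U : Matrix.unitaryGroup I ℂ} (hU : U ∈ symCenter R) :
    ∃ φ : Λ → ℝ, U = D.ofUBlocks fun l => phase _ (φ l) := by
  classical
  obtain ⟨Z, rfl⟩ := D.exists_ofUBlocks hU.1
  have hZ : ∀ l, ∃ θ : ℝ, Z l = phase _ θ := by
    intro l
    have hcomm : ∀ V : Matrix.unitaryGroup (Fin (D.m l)) ℂ,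
        (Z l : Matrix (Fin (D.m l)) (Fin (D.m l)) ℂ) * V = V * Z l := by
      intro V
      have h1 := hU.2 _ (D.ofUBlocks_mem (Pi.mulSingle l V))
      rw [← map_mul, ← map_mul] at h1
      have h2 := congrFun (D.ofUBlocks_injective h1) l
      simp only [Pi.mul_apply, Pi.mulSingle_eq_same] at h2
      exact congrArg Subtype.val h2
    obtain ⟨c, hc⟩ := exists_eq_smul_one_of_commute_unitary _ hcomm
    have h1 := Matrix.mem_unitaryGroup_iff.mp (Z l).2
    rw [hc, star_smul, star_one, smul_mul_smul_comm, one_mul] at h1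
    have h2 := congrFun (congrFun h1 ⟨0, D.m_pos l⟩) ⟨0, D.m_pos l⟩
    simp only [Matrix.smul_apply, Matrix.one_apply_eq, smul_eq_mul, mul_one, Complex.star_def,
      Complex.mul_conj'] at h2
    have h3 : ‖c‖ = 1 := by
      have : ‖c‖ ^ 2 = 1 := by exact_mod_cast h2
      exact (pow_eq_one_iff_of_nonneg (norm_nonneg c) two_ne_zero).mp this
    obtain ⟨θ, hθ⟩ := (Complex.norm_eq_one_iff c).mp h3
    exact ⟨θ, Subtype.ext (by rw [hc, ← hθ]; rfl)⟩
  choose φ hφ using hZ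
  exact ⟨φ, by rw [← funext hφ]⟩

end IrrepDecomposition

/-! ### Lie algebras of symmetric groups -/

theorem hasDerivAt_exp_I_smul (A : Matrix I I ℂ) :
    HasDerivAt (fun θ : ℝ => NormedSpace.exp (((θ : ℂ) * Complex.I) • A)) (Complex.I • A) 0 := by
  have h := hasDerivAt_exp_smul_const (𝕂 := ℝ) (Complex.I • A) (0 : ℝ)
  rw [zero_smul, NormedSpace.exp_zero, one_mul] at h
  refine h.congr_of_eventuallyEq (Eventually.of_forall fun θ => ?_)
  simp only [mul_smul, Complex.coe_smul]

/-- The difference quotients of the one-parameter group at 0 lie in W, which is closed, so their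
limit iA does too. -/
theorem mem_of_forall_exp_mem (W : Submodule ℂ (Matrix I I ℂ)) (hW : (1 : Matrix I I ℂ) ∈ W)
    (A : Matrix I I ℂ)
    (h : ∀ θ : ℝ, NormedSpace.exp (((θ : ℂ) * Complex.I) • A) ∈ W) : A ∈ W := by
  have h1 := hasDerivAt_exp_I_smul A
  rw [hasDerivAt_iff_tendsto_slope_zero] at h1
  have hcl : IsClosed (W : Set (Matrix I I ℂ)) := Submodule.closed_of_finiteDimensional W
  have h2 : Complex.I • A ∈ W := by
    refine hcl.mem_of_tendsto h1 (Eventually.of_forall fun θ => ?_)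
    rw [← Complex.coe_smul]
    refine W.smul_mem _ (W.sub_mem (h _) ?_)
    simpa using hW
  have h3 := W.smul_mem (-Complex.I) h2
  rwa [smul_smul, neg_mul, Complex.I_mul_I, neg_neg, one_smul] at h3

/-- Differentiating UU† = 1 along exp(iθA) at θ = 0 gives iA - iA† = 0. -/
theorem isHermitian_of_mem_lieAlg {S : Subgroup (Matrix.unitaryGroup I ℂ)} {A : Matrix I I ℂ}
    (hA : A ∈ lieAlg S) : A.IsHermitian := by
  have h1 := hasDerivAt_exp_I_smul A
  have h2 : HasDerivAt (fun θ : ℝ => (NormedSpace.exp (((θ : ℂ) * Complex.I) • A))ᴴ)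
      ((Complex.I • A)ᴴ) 0 := h1.star
  have h3 := h1.mul h2
  have h4 : (fun θ : ℝ => NormedSpace.exp (((θ : ℂ) * Complex.I) • A)) *
      (fun θ : ℝ => (NormedSpace.exp (((θ : ℂ) * Complex.I) • A))ᴴ) = fun _ => 1 := by
    funext θ
    obtain ⟨U, -, hU⟩ := hA θ
    simp only [Pi.mul_apply, ← hU]
    exact Matrix.mem_unitaryGroup_iff.mp U.2
  rw [h4] at h3
  have h5 := h3.unique (hasDerivAt_const (0 : ℝ) (1 : Matrix I I ℂ))
  simp only [Complex.ofReal_zero, zero_mul, zero_smul, NormedSpace.exp_zero,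
    Matrix.conjTranspose_one, mul_one, one_mul, Matrix.conjTranspose_smul, Complex.star_def,
    Complex.conj_I, neg_smul] at h5
  rw [← sub_eq_add_neg, ← smul_sub, smul_eq_zero] at h5
  exact (sub_eq_zero.mp (h5.resolve_left Complex.I_ne_zero)).symm

/-- The symmetric operators as a submodule. -/
def symOpsSubmodule (R : G →* Matrix.unitaryGroup I ℂ) : Submodule ℂ (Matrix I I ℂ) where
  carrier := symOps R
  zero_mem' g := by simp
  add_mem' hA hB g := by rw [Matrix.add_mul, Matrix.mul_add, hA g, hB g]
  smul_mem' c A hA g := by rw [Matrix.smul_mul, Matrix.mul_smul, hA g]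

theorem mem_symOps_of_mem_lieAlg {R : G →* Matrix.unitaryGroup I ℂ}
    {S : Subgroup (Matrix.unitaryGroup I ℂ)} (hS : S ≤ symUnitary R) {A : Matrix I I ℂ}
    (hA : A ∈ lieAlg S) : A ∈ symOps R := by
  refine mem_of_forall_exp_mem (symOpsSubmodule R) (fun g => by simp) A fun θ => ?_
  obtain ⟨U, hU, hUe⟩ := hA θ
  rw [← hUe]
  exact fun g => congrArg Subtype.val (hS hU g)

end Blocks

/-! ### Weights of the mixed tensor power -/

section Weights

/-- Differentiate at 0 along each coordinate axis. Agreement for all real θ removes the ambiguity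
modulo 2π, so coefficients, even complex ones, can be compared directly. -/
theorem eq_of_forall_exp_eq {Q : Type*} [Fintype Q] [DecidableEq Q] {c c' : Q → ℂ}
    (h : ∀ θ : Q → ℝ, Complex.exp ((∑ q, c q * θ q) * Complex.I) =
      Complex.exp ((∑ q, c' q * θ q) * Complex.I)) : c = c' := by
  funext q
  have h1 : ∀ s : ℝ, Complex.exp (s * (c q * Complex.I)) = Complex.exp (s * (c' q * Complex.I)) := by
    intro s
    have := h (Pi.single q s)
    have hs : ∀ c : Q → ℂ, ∑ q', c q' * (((Pi.single q s : Q → ℝ) q' : ℝ) : ℂ) = s * c q := by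
      intro c
      rw [Finset.sum_eq_single q]
      · rw [Pi.single_eq_same, mul_comm]
      · intro q' _ hne
        rw [Pi.single_eq_of_ne hne, Complex.ofReal_zero, mul_zero]
      · simp
    rw [hs, hs, mul_assoc, mul_assoc] at this
    exact this
  have hd : ∀ z : ℂ, HasDerivAt (fun s : ℝ => Complex.exp (s * z)) z 0 := fun z => by
    have := ((Complex.ofRealCLM.hasDerivAt (x := (0 : ℝ))).mul_const z).cexp
    simpa using this
  have h2 := (hd (c q * Complex.I)).unique ((hd (c' q * Complex.I)).congr_of_eventuallyEq
    (Eventually.of_forall h1))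
  exact mul_right_cancel₀ Complex.I_ne_zero h2

variable {I : Type*} [Fintype I] [DecidableEq I] {G : Type*} [Group G]

namespace IrrepDecomposition

variable {R : G →* Matrix.unitaryGroup I ℂ} {Λ : Type*} [Fintype Λ]
  (D : IrrepDecomposition R Λ)

/-- Labels of the basis adapted to the decomposition. -/
abbrev Idx : Type _ := Σ l, Fin (D.r l) × Fin (D.m l)

/-- Labels of the eigenvalues of symmetric operators. -/
abbrev EigIdx : Type _ := Σ l, Fin (D.m l)

/-- The eigenvalue label of a basis label. -/
def eigIdx (k : D.Idx) : D.EigIdx := ⟨k.1, k.2.2⟩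

/-- The unitary matrix of the adapted basis. -/
def basisMat : Matrix I D.Idx ℂ := Matrix.of fun i k => D.F k.1 i k.2

theorem basisMat_mul_conjTranspose : D.basisMat * D.basisMatᴴ = 1 := by
  rw [← D.complete]
  ext i j
  rw [Matrix.mul_apply, Fintype.sum_sigma, Matrix.sum_apply]
  rfl

theorem conjTranspose_F_mul_ofBlocks_mul_F (B : D.Tuple) (l : Λ) :
    (D.F l)ᴴ * D.ofBlocks B * D.F l = (1 : Matrix (Fin (D.r l)) (Fin (D.r l)) ℂ) ⊗ₖ B l := by
  rw [ofBlocks_apply, Matrix.mul_sum, Matrix.sum_mul, Finset.sum_eq_single l]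
  · calc _ = ((D.F l)ᴴ * D.F l) * ((1 : Matrix (Fin (D.r l)) (Fin (D.r l)) ℂ) ⊗ₖ B l) *
          ((D.F l)ᴴ * D.F l) := by simp only [Matrix.mul_assoc]
      _ = _ := by rw [D.isometry]; simp
  · intro l' _ hne
    calc _ = ((D.F l)ᴴ * D.F l') * (((1 : Matrix (Fin (D.r l')) (Fin (D.r l')) ℂ) ⊗ₖ B l') *
          (D.F l')ᴴ * D.F l) := by simp only [Matrix.mul_assoc]
      _ = _ := by rw [D.orthogonal l l' hne.symm]; simp
  · simp

theorem conjTranspose_F_mul_ofBlocks_mul_F_of_ne (B : D.Tuple) {l l' : Λ} (h : l ≠ l') :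
    (D.F l)ᴴ * D.ofBlocks B * D.F l' = 0 := by
  rw [ofBlocks_apply, Matrix.mul_sum, Matrix.sum_mul]
  refine Finset.sum_eq_zero fun j _ => ?_
  calc _ = ((D.F l)ᴴ * D.F j) * ((1 : Matrix (Fin (D.r j)) (Fin (D.r j)) ℂ) ⊗ₖ B j) *
        ((D.F j)ᴴ * D.F l') := by simp only [Matrix.mul_assoc]
    _ = 0 := by
      by_cases hj : l = j
      · subst hj
        rw [D.orthogonal l l' h, Matrix.mul_zero]
      · rw [D.orthogonal l j hj, Matrix.zero_mul, Matrix.zero_mul]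

theorem compress_ofBlocks_apply_same (B : D.Tuple) (l : Λ) (a b : Fin (D.r l))
    (α β : Fin (D.m l)) :
    (D.basisMatᴴ * D.ofBlocks B * D.basisMat) ⟨l, a, α⟩ ⟨l, b, β⟩ =
      (1 : Matrix (Fin (D.r l)) (Fin (D.r l)) ℂ) a b * B l α β :=
  congrFun (congrFun (D.conjTranspose_F_mul_ofBlocks_mul_F B l) (a, α)) (b, β)

theorem compress_ofBlocks_apply_ne (B : D.Tuple) {k k' : D.Idx} (h : k.1 ≠ k'.1) :
    (D.basisMatᴴ * D.ofBlocks B * D.basisMat) k k' = 0 :=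
  congrFun (congrFun (D.conjTranspose_F_mul_ofBlocks_mul_F_of_ne B h) k.2) k'.2

/-- The mixed tensor power in the adapted basis. -/
def coordRep (t : ℕ) (M : Matrix I I ℂ) :
    Matrix ((Fin t → D.Idx) × (Fin t → D.Idx)) ((Fin t → D.Idx) × (Fin t → D.Idx)) ℂ :=
  mixedTensor t (D.basisMatᴴ * M * D.basisMat)

theorem coordRep_mul (t : ℕ) (M N : Matrix I I ℂ) :
    D.coordRep t (M * N) = D.coordRep t M * D.coordRep t N := by
  rw [coordRep, coordRep, coordRep, ← mixedTensor_mul]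
  congr 1
  calc D.basisMatᴴ * (M * N) * D.basisMat
      = D.basisMatᴴ * M * ((1 : Matrix I I ℂ) * (N * D.basisMat)) := by
        rw [Matrix.one_mul]; simp only [Matrix.mul_assoc]
    _ = _ := by rw [← D.basisMat_mul_conjTranspose]; simp only [Matrix.mul_assoc]

theorem coordRep_mulVec (t : ℕ) (M : Matrix I I ℂ) (v : (Fin t → I) × (Fin t → I) → ℂ) :
    D.coordRep t M *ᵥ (mixedTensor t D.basisMatᴴ *ᵥ v) =
      mixedTensor t D.basisMatᴴ *ᵥ (mixedTensor t M *ᵥ v) := by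
  rw [coordRep, Matrix.mulVec_mulVec, Matrix.mulVec_mulVec, ← mixedTensor_mul, ← mixedTensor_mul,
    Matrix.mul_assoc, D.basisMat_mul_conjTranspose, Matrix.mul_one]

theorem mixedTensor_basisMat_injective (t : ℕ) :
    Function.Injective fun v => mixedTensor t D.basisMatᴴ *ᵥ v := by
  intro v v' h
  have := congrArg (fun w => mixedTensor t D.basisMat *ᵥ w) h
  simpa only [Matrix.mulVec_mulVec, ← mixedTensor_mul, D.basisMat_mul_conjTranspose,
    mixedTensor_one, Matrix.one_mulVec] using this

/-- The elements of the maximal torus. -/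
def diagU (θ : D.EigIdx → ℝ) : D.UTuple := fun l =>
  ⟨Matrix.diagonal fun α => Complex.exp (θ ⟨l, α⟩ * Complex.I), by
    rw [Matrix.mem_unitaryGroup_iff, Matrix.star_eq_conjTranspose,
      Matrix.diagonal_conjTranspose, Matrix.diagonal_mul_diagonal, ← Matrix.diagonal_one]
    congr 1
    funext α
    rw [Pi.star_apply, Complex.star_def, ← Complex.exp_conj, ← Complex.exp_add]
    simp⟩

theorem diagU_const (φ : Λ → ℝ) : D.diagU (fun q => φ q.1) = fun l => phase _ (φ l) := by
  funext l
  exact Subtype.ext (by simp [diagU, phase, Matrix.smul_one_eq_diagonal])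

/-- A multiplicative function of symmetric unitaries is determined by its values on the maximal
torus. -/
theorem apply_exp_of_diagU (c : D.UTuple → ℂ) (hc1 : c 1 = 1)
    (hc : ∀ V V', c (V * V') = c V * c V') (x : Λ → ℤ)
    (hx : ∀ θ, c (D.diagU θ) = Complex.exp ((∑ q, (x q.1 : ℂ) * θ q) * Complex.I))
    (a : D.Tuple) (ha : ∀ l, (a l).IsHermitian) (θ : ℝ) (U : D.UTuple)
    (hU : ∀ l, (U l : Matrix (Fin (D.m l)) (Fin (D.m l)) ℂ) =
      NormedSpace.exp (((θ : ℂ) * Complex.I) • a l)) :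
    c U = Complex.exp ((∑ l, (a l).trace * (x l : ℂ)) * θ * Complex.I) := by
  -- Diagonalising every block conjugates U into the maximal torus.
  let V : D.UTuple := fun l => (ha l).eigenvectorUnitary
  let E : D.UTuple := D.diagU fun q => θ * (ha q.1).eigenvalues q.2
  have hUV : U = V * E * V⁻¹ := by
    funext l
    refine Subtype.ext ?_
    have h1 := (ha l).spectral_theorem
    rw [Unitary.conjStarAlgAut_apply] at h1
    have hinv : ((ha l).eigenvectorUnitary : Matrix (Fin (D.m l)) (Fin (D.m l)) ℂ)⁻¹ =
        star ((ha l).eigenvectorUnitary : Matrix (Fin (D.m l)) (Fin (D.m l)) ℂ) :=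
      Matrix.inv_eq_right_inv (Matrix.mem_unitaryGroup_iff.mp (ha l).eigenvectorUnitary.2)
    have hunit : IsUnit ((ha l).eigenvectorUnitary : Matrix (Fin (D.m l)) (Fin (D.m l)) ℂ) :=
      ⟨⟨_, _, Matrix.mem_unitaryGroup_iff.mp (ha l).eigenvectorUnitary.2,
        Matrix.mem_unitaryGroup_iff'.mp (ha l).eigenvectorUnitary.2⟩, rfl⟩
    have h2 : ((θ : ℂ) * Complex.I) • a l =
        ((ha l).eigenvectorUnitary : Matrix (Fin (D.m l)) (Fin (D.m l)) ℂ) *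
          Matrix.diagonal (fun α => (((θ * (ha l).eigenvalues α : ℝ) : ℂ) * Complex.I)) *
          ((ha l).eigenvectorUnitary : Matrix (Fin (D.m l)) (Fin (D.m l)) ℂ)⁻¹ := by
      rw [hinv]
      conv_lhs => rw [h1]
      rw [← Matrix.smul_mul, ← Matrix.mul_smul, ← Matrix.diagonal_smul]
      congr 3
      funext α
      simp only [Pi.smul_apply, Function.comp_apply, smul_eq_mul, Complex.ofReal_mul,
        Complex.coe_algebraMap]
      ring
    rw [hU, h2, Matrix.exp_conj _ _ hunit, Matrix.exp_diagonal, hinv]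
    have h3 : NormedSpace.exp (fun α => (((θ * (ha l).eigenvalues α : ℝ) : ℂ) * Complex.I)) =
        fun α => Complex.exp (((θ * (ha l).eigenvalues α : ℝ) : ℂ) * Complex.I) := by
      funext α
      rw [Pi.coe_exp, Complex.exp_eq_exp_ℂ]
    rw [h3]
    rfl
  -- Values of c commute, so conjugation drops out and c U = c E. The eigenvalues of each block then
  -- add up to its trace.
  rw [hUV, hc, hc, mul_right_comm, ← hc, mul_inv_cancel, hc1, one_mul, hx]
  congr 2
  rw [Fintype.sum_sigma, Finset.sum_mul]
  refine Finset.sum_congr rfl fun l _ => ?_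
  rw [(ha l).trace_eq_sum_eigenvalues, Finset.sum_mul, Finset.sum_mul]
  refine Finset.sum_congr rfl fun α _ => ?_
  simp only [Complex.ofReal_mul, Complex.coe_algebraMap]
  ring

variable [DecidableEq Λ]

theorem compress_ofBlocks_diagonal (d : D.EigIdx → ℂ) :
    D.basisMatᴴ * D.ofBlocks (fun l => Matrix.diagonal fun α => d ⟨l, α⟩) * D.basisMat =
      Matrix.diagonal fun k => d (D.eigIdx k) := by
  ext ⟨l, a, α⟩ ⟨l', b, β⟩
  by_cases h : l = l'
  · subst h
    rw [compress_ofBlocks_apply_same]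
    by_cases hab : a = b <;> by_cases hαβ : α = β <;>
      simp [Matrix.one_apply, eigIdx, hab, hαβ]
  · rw [compress_ofBlocks_apply_ne _ _ h, Matrix.diagonal_apply_ne]
    exact fun h' => h (congrArg Sigma.fst h')

theorem conjTranspose_basisMat_mul : D.basisMatᴴ * D.basisMat = 1 := by
  have := D.compress_ofBlocks_diagonal fun _ => 1
  simp only [Matrix.diagonal_one] at this
  rwa [show (fun l => 1 : D.Tuple) = 1 from rfl, map_one, Matrix.mul_one] at this

theorem coordRep_one (t : ℕ) : D.coordRep t 1 = 1 := by
  rw [coordRep, Matrix.mul_one, conjTranspose_basisMat_mul, mixedTensor_one]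

/-- The weight of a basis tensor under the maximal torus. -/
def weight {t : ℕ} (b : (Fin t → D.Idx) × (Fin t → D.Idx)) (q : D.EigIdx) : ℤ :=
  (∑ s, if D.eigIdx (b.1 s) = q then 1 else 0) - ∑ s, if D.eigIdx (b.2 s) = q then 1 else 0

theorem sum_weight_mul {t : ℕ} (b : (Fin t → D.Idx) × (Fin t → D.Idx)) (f : D.EigIdx → ℂ) :
    ∑ q, (D.weight b q : ℂ) * f q =
      ∑ s, f (D.eigIdx (b.1 s)) - ∑ s, f (D.eigIdx (b.2 s)) := by
  simp only [weight, Int.cast_sub, Int.cast_sum, Int.cast_ite, Int.cast_one, Int.cast_zero, sub_mul,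
    Finset.sum_mul, ite_mul, one_mul, zero_mul, Finset.sum_sub_distrib]
  rw [Finset.sum_comm, Finset.sum_comm (s := Finset.univ (α := D.EigIdx))]
  simp

theorem sum_weight {t : ℕ} (b : (Fin t → D.Idx) × (Fin t → D.Idx)) : ∑ q, D.weight b q = 0 := by
  have := D.sum_weight_mul b fun _ => 1
  simp only [mul_one, Finset.sum_const, sub_self] at this
  exact_mod_cast this

/-- Each of the t plain and t conjugate tensor factors contributes one unit to a single label;
cancellation can only lower the total. -/
theorem sum_abs_weight_le {t : ℕ} (b : (Fin t → D.Idx) × (Fin t → D.Idx)) :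
    ∑ q, |D.weight b q| ≤ 2 * (t : ℤ) := by
  have h1 : ∀ f : Fin t → D.Idx, ∑ q, ∑ s, (if D.eigIdx (f s) = q then (1 : ℤ) else 0) = t := by
    intro f
    rw [Finset.sum_comm]
    simp
  calc ∑ q, |D.weight b q| ≤ ∑ q, ((∑ s, if D.eigIdx (b.1 s) = q then (1 : ℤ) else 0) +
        ∑ s, if D.eigIdx (b.2 s) = q then (1 : ℤ) else 0) := by
        refine Finset.sum_le_sum fun q _ => (abs_sub _ _).trans (le_of_eq ?_)
        have h2 : ∀ f : Fin t → D.Idx,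
            0 ≤ ∑ s, (if D.eigIdx (f s) = q then (1 : ℤ) else 0) := fun f =>
          Finset.sum_nonneg fun s _ => by split_ifs <;> norm_num
        rw [abs_of_nonneg (h2 _), abs_of_nonneg (h2 _)]
    _ = 2 * t := by
        rw [Finset.sum_add_distrib, h1, h1]
        ring

/-- In the adapted basis torus elements are diagonal, and conjugation turns the phases of the second
t factors into their inverses, whence the difference in `weight`. -/
theorem coordRep_diagU (t : ℕ) (θ : D.EigIdx → ℝ) :
    D.coordRep t (D.ofUBlocks (D.diagU θ) : Matrix I I ℂ) =
      Matrix.diagonal fun b => Complex.exp ((∑ q, (D.weight b q : ℂ) * θ q) * Complex.I) := by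
  have h1 : (D.ofUBlocks (D.diagU θ) : Matrix I I ℂ) = D.ofBlocks fun l =>
      Matrix.diagonal fun α => (fun q => Complex.exp (θ q * Complex.I)) ⟨l, α⟩ := rfl
  rw [coordRep, h1, D.compress_ofBlocks_diagonal fun q => Complex.exp (θ q * Complex.I),
    mixedTensor_diagonal]
  congr 1
  funext b
  simp only [Complex.star_def, ← Complex.exp_conj, ← Complex.exp_sum, ← Complex.exp_add]
  congr 1
  rw [D.sum_weight_mul b fun q => (θ q : ℂ), sub_mul, Finset.sum_mul, Finset.sum_mul]
  simp [sub_eq_add_neg]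

end IrrepDecomposition

end Weights

/-! ### Invariant vectors and characters -/

section InvariantVectors

variable {I : Type*} [Fintype I] [DecidableEq I] {G : Type*} [Group G]

/-- A permutation matrix as a unitary matrix. -/
def permU {n : Type*} [Fintype n] [DecidableEq n] (σ : Equiv.Perm n) : Matrix.unitaryGroup n ℂ :=
  ⟨(1 : Matrix n n ℂ).submatrix σ id, by
    rw [Matrix.mem_unitaryGroup_iff, Matrix.star_eq_conjTranspose, Matrix.conjTranspose_submatrix,
      Matrix.conjTranspose_one, ← Equiv.coe_refl, Matrix.submatrix_mul_equiv, Matrix.one_mul,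
      Matrix.submatrix_one_equiv]⟩

namespace IrrepDecomposition

variable {R : G →* Matrix.unitaryGroup I ℂ} {Λ : Type*} [Fintype Λ]
  (D : IrrepDecomposition R Λ)

/-- The permutations of the eigenvalue labels within the sectors. -/
def permTuple (σ : ∀ l, Equiv.Perm (Fin (D.m l))) : D.UTuple := fun l => permU (σ l)

/-- The action of the Weyl group on the torus, used to show that weights of characters are symmetric
within each sector. -/
theorem permTuple_mul_diagU (σ : ∀ l, Equiv.Perm (Fin (D.m l))) (θ : D.EigIdx → ℝ) :
    D.permTuple σ * D.diagU θ =
      D.diagU (fun q => θ (Equiv.sigmaCongrRight σ q)) * D.permTuple σ := by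
  funext l
  refine Subtype.ext ?_
  change (1 : Matrix _ _ ℂ).submatrix (σ l) id * Matrix.diagonal _ =
    Matrix.diagonal _ * (1 : Matrix _ _ ℂ).submatrix (σ l) id
  ext α β
  rw [Matrix.mul_diagonal, Matrix.diagonal_mul, Matrix.submatrix_apply, id, Matrix.one_apply]
  by_cases h : σ l α = β
  · subst h
    simp
  · simp [h]

theorem block_isHermitian {A : Matrix I I ℂ} (hA : A ∈ symOps R) (hH : A.IsHermitian) (l : Λ) :
    (D.block A l).IsHermitian := by
  have h1 : star (D.block A) = D.block A := by
    apply D.ofBlocks_injective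
    rw [map_star, D.ofBlocks_block hA]
    exact hH
  exact congrFun h1 l

theorem exists_block_exp {S : Subgroup (Matrix.unitaryGroup I ℂ)} (hS : S ≤ symUnitary R)
    {A : Matrix I I ℂ} (hA : A ∈ lieAlg S) (θ : ℝ) : ∃ U : D.UTuple, D.ofUBlocks U ∈ S ∧
      (D.ofUBlocks U : Matrix I I ℂ) = NormedSpace.exp (((θ : ℂ) * Complex.I) • A) ∧
      ∀ l, (U l : Matrix (Fin (D.m l)) (Fin (D.m l)) ℂ) =
        NormedSpace.exp (((θ : ℂ) * Complex.I) • D.block A l) := by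
  obtain ⟨W, hW, hWe⟩ := hA θ
  obtain ⟨U, rfl⟩ := D.exists_ofUBlocks (hS hW)
  refine ⟨U, hW, hWe, fun l => ?_⟩
  have h1 : D.coeTuple U =
      fun l => NormedSpace.exp ((((θ : ℂ) * Complex.I) • D.block A : D.Tuple) l) := by
    apply D.ofBlocks_injective
    rw [D.ofBlocks_exp, map_smul, D.ofBlocks_block (mem_symOps_of_mem_lieAlg hS hA), ← hWe]
    rfl
  exact congrFun h1 l

theorem sum_eigIdx {M : Type*} [AddCommMonoid M] (f : Λ → M) :
    ∑ q : D.EigIdx, f q.1 = ∑ l, D.m l • f l := by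
  rw [Fintype.sum_sigma]
  simp

/-- A vector of the mixed tensor power that is invariant under a subgroup `H` generating the
symmetric unitaries together with the phases, but not under all symmetric unitaries, yields a
character of the symmetric unitaries trivial on `H`. -/
theorem exists_weight_of_not_invariant (H : Subgroup (Matrix.unitaryGroup I ℂ))
    (hHR : H ≤ symUnitary R)
    (hH : ∀ u ∈ symUnitary R, ∃ h ∈ H, ∃ φ : Λ → ℝ, u = h * D.ofUBlocks fun l => phase _ (φ l))
    (t : ℕ) (v : (Fin t → I) × (Fin t → I) → ℂ)
    (hv : ∀ h ∈ H, mixedTensor t (h : Matrix I I ℂ) *ᵥ v = v)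
    (hnot : ∃ u ∈ symUnitary R, mixedTensor t (u : Matrix I I ℂ) *ᵥ v ≠ v) :
    ∃ x : Λ → ℤ, x ≠ 0 ∧ ∑ l, (D.m l : ℤ) * |x l| ≤ 2 * (t : ℤ) ∧ ∑ l, (D.m l : ℤ) * x l = 0 ∧
      ∀ A ∈ lieAlg H, ∑ l, D.traceVec A l * (x l : ℂ) = 0 := by
  classical
  set N : Matrix.unitaryGroup I ℂ → Matrix _ _ ℂ := fun u => D.coordRep t (u : Matrix I I ℂ)
    with hN
  have hNmul : ∀ u u', N (u * u') = N u * N u' := fun u u' => D.coordRep_mul t _ _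
  set E : ((Fin t → D.Idx) × (Fin t → D.Idx)) → (D.EigIdx → ℝ) → ℂ := fun b θ =>
    Complex.exp ((∑ q, (D.weight b q : ℂ) * θ q) * Complex.I) with hE
  have hNdiag : ∀ θ, N (D.ofUBlocks (D.diagU θ)) = Matrix.diagonal fun b => E b θ :=
    D.coordRep_diagU t
  set w := mixedTensor t D.basisMatᴴ *ᵥ v with hw
  have hwH : ∀ h ∈ H, N h *ᵥ w = w := fun h hh => by
    rw [hN, hw, D.coordRep_mulVec, hv h hh]
  have hcomm : ∀ (φ : Λ → ℝ) (V : D.UTuple),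
      V * D.diagU (fun q => φ q.1) = D.diagU (fun q => φ q.1) * V := fun φ V => by
    rw [D.diagU_const]
    funext l
    exact Subtype.ext (by simp [phase])
  have hcommH : ∀ (φ : Λ → ℝ), ∀ h ∈ H, h * D.ofUBlocks (D.diagU fun q => φ q.1) =
      D.ofUBlocks (D.diagU fun q => φ q.1) * h := fun φ h hh => by
    obtain ⟨V, rfl⟩ := D.exists_ofUBlocks (hHR hh)
    rw [← map_mul, ← map_mul, hcomm]
  -- If every basis tensor occurring in w had trivial phase weight, the phases would fix w; together
  -- with H they would then make w invariant under all symmetric unitaries.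
  obtain ⟨b₀, hb₀, φ₀, hφ₀⟩ : ∃ b₀, w b₀ ≠ 0 ∧ ∃ φ : Λ → ℝ, E b₀ (fun q => φ q.1) ≠ 1 := by
    by_contra hcon
    push Not at hcon
    obtain ⟨u, hu, hne⟩ := hnot
    obtain ⟨h, hh, φ, rfl⟩ := hH u hu
    apply hne
    rw [← D.diagU_const, hcommH φ h hh]
    apply D.mixedTensor_basisMat_injective t
    change mixedTensor t D.basisMatᴴ *ᵥ _ = mixedTensor t D.basisMatᴴ *ᵥ v
    rw [← D.coordRep_mulVec, ← hw]
    change N _ *ᵥ w = w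
    rw [hNmul, ← Matrix.mulVec_mulVec, hwH h hh, hNdiag]
    ext b
    rw [Matrix.mulVec_diagonal]
    by_cases hb : w b = 0
    · rw [hb, mul_zero]
    · rw [hcon b hb φ, one_mul]
  -- The component of w in the phase-weight space of b₀.
  set w' : ((Fin t → D.Idx) × (Fin t → D.Idx)) → ℂ := fun b =>
    if ∀ φ : Λ → ℝ, E b (fun q => φ q.1) = E b₀ (fun q => φ q.1) then w b else 0 with hw'
  have hw'0 : w' b₀ = w b₀ := by simp [hw']
  have hw'pos : ∀ b, (∀ φ : Λ → ℝ, E b (fun q => φ q.1) = E b₀ (fun q => φ q.1)) → w' b = w b :=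
    fun b hb => if_pos hb
  have hw'neg : ∀ b, (¬ ∀ φ : Λ → ℝ, E b (fun q => φ q.1) = E b₀ (fun q => φ q.1)) → w' b = 0 :=
    fun b hb => if_neg hb
  -- H commutes with the phases, so its matrices have no entries between different phase weights.
  -- Hence the component w' inherits invariance under H.
  have hNcomm : ∀ h ∈ H, ∀ b b', N h b b' ≠ 0 →
      ∀ φ : Λ → ℝ, E b (fun q => φ q.1) = E b' (fun q => φ q.1) := by
    intro h hh b b' hne φ
    have h1 := congrArg N (hcommH φ h hh)
    rw [hNmul, hNmul, hNdiag] at h1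
    have h2 := congrFun (congrFun h1 b) b'
    rw [Matrix.mul_diagonal, Matrix.diagonal_mul, mul_comm] at h2
    exact (mul_right_cancel₀ hne h2).symm
  have hw'H : ∀ h ∈ H, N h *ᵥ w' = w' := by
    intro h hh
    ext b
    by_cases hb : ∀ φ : Λ → ℝ, E b (fun q => φ q.1) = E b₀ (fun q => φ q.1)
    · have h1 := congrFun (hwH h hh) b
      rw [hw'pos b hb, ← h1]
      refine Finset.sum_congr rfl fun b' _ => ?_
      change N h b b' * w' b' = N h b b' * w b'
      by_cases h0 : N h b b' = 0
      · rw [h0, zero_mul, zero_mul]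
      · rw [hw'pos b' fun φ => (hNcomm h hh b b' h0 φ).symm.trans (hb φ)]
    · rw [hw'neg b hb]
      refine Finset.sum_eq_zero fun b' _ => ?_
      change N h b b' * w' b' = 0
      by_cases h0 : N h b b' = 0
      · rw [h0, zero_mul]
      · rw [hw'neg b' fun hb' => hb fun φ => (hNcomm h hh b b' h0 φ).trans (hb' φ), mul_zero]
  -- H fixes w' and the phases act on it through the single weight of b₀, so their products, that is
  -- all symmetric unitaries, act on w' by scalars.
  have heig : ∀ V : D.UTuple, ∃ c : ℂ, N (D.ofUBlocks V) *ᵥ w' = c • w' := by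
    intro V
    obtain ⟨h, hh, φ, hφ⟩ := hH _ (D.ofUBlocks_mem V)
    refine ⟨E b₀ fun q => φ q.1, ?_⟩
    rw [hφ, ← D.diagU_const, hcommH φ h hh, hNmul, ← Matrix.mulVec_mulVec, hw'H h hh, hNdiag]
    ext b
    rw [Matrix.mulVec_diagonal, Pi.smul_apply, smul_eq_mul]
    by_cases hb : ∀ φ : Λ → ℝ, E b (fun q => φ q.1) = E b₀ (fun q => φ q.1)
    · rw [hb]
    · rw [hw'neg b hb, mul_zero, mul_zero]
  choose c hc using heig
  have hw'ne : w' b₀ ≠ 0 := hw'0 ▸ hb₀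
  have hcval : ∀ V k, N (D.ofUBlocks V) *ᵥ w' = k • w' → c V = k := by
    intro V k hk
    rw [hc] at hk
    exact mul_right_cancel₀ hw'ne (congrFun hk b₀)
  have hc1 : c 1 = 1 := hcval _ _ (by
    rw [map_one, one_smul]
    change D.coordRep t (1 : Matrix I I ℂ) *ᵥ w' = w'
    rw [D.coordRep_one, Matrix.one_mulVec])
  have hcmul : ∀ V V', c (V * V') = c V * c V' := fun V V' => hcval _ _ (by
    rw [map_mul, hNmul, ← Matrix.mulVec_mulVec, hc, Matrix.mulVec_smul, hc, smul_smul, mul_comm])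
  have hcdiag : ∀ θ, c (D.diagU θ) = E b₀ θ := by
    intro θ
    have h1 := congrFun (hc (D.diagU θ)) b₀
    rw [hNdiag, Matrix.mulVec_diagonal, Pi.smul_apply, smul_eq_mul] at h1
    exact (mul_right_cancel₀ hw'ne h1).symm
  -- c takes the same value on conjugate torus elements, and on the torus it is the exponential of
  -- the weight of b₀; the weight is therefore unchanged by permutations within sectors.
  have hperm : ∀ σ : ∀ l, Equiv.Perm (Fin (D.m l)), ∀ q,
      D.weight b₀ (Equiv.sigmaCongrRight σ q) = D.weight b₀ q := by
    intro σ q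
    have h1 : ∀ θ, E b₀ θ = E b₀ fun q => θ (Equiv.sigmaCongrRight σ q) := fun θ => by
      have h2 := congrArg c (D.permTuple_mul_diagU σ θ)
      rw [hcmul, hcmul, mul_comm, hcdiag, hcdiag] at h2
      refine mul_right_cancel₀ (fun h0 => ?_) h2
      have h3 := hcmul (D.permTuple σ) (D.permTuple σ)⁻¹
      rw [mul_inv_cancel, hc1, h0, zero_mul] at h3
      exact one_ne_zero h3
    have h2 : (fun q => (D.weight b₀ (Equiv.sigmaCongrRight σ q) : ℂ)) =
        fun q => (D.weight b₀ q : ℂ) := by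
      refine eq_of_forall_exp_eq fun θ => ?_
      calc Complex.exp ((∑ q, (D.weight b₀ (Equiv.sigmaCongrRight σ q) : ℂ) * θ q) * Complex.I)
          = E b₀ fun q => θ ((Equiv.sigmaCongrRight σ).symm q) := by
            change _ = Complex.exp ((∑ q, (D.weight b₀ q : ℂ) *
              θ ((Equiv.sigmaCongrRight σ).symm q)) * Complex.I)
            rw [← Equiv.sum_comp (Equiv.sigmaCongrRight σ) fun q => (D.weight b₀ q : ℂ) *
              θ ((Equiv.sigmaCongrRight σ).symm q)]
            refine congrArg (fun z => Complex.exp (z * Complex.I))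
              (Finset.sum_congr rfl fun q _ => ?_)
            rw [Equiv.symm_apply_apply]
        _ = E b₀ θ := by
            rw [h1]
            exact congrArg (E b₀) (funext fun q => by rw [Equiv.symm_apply_apply])
    exact_mod_cast congrFun h2 q
  -- The weight is constant on each sector: the swap of α with 0 carries any label to label 0, which
  -- exists because the multiplicity is positive.
  set x : Λ → ℤ := fun l => D.weight b₀ ⟨l, ⟨0, D.m_pos l⟩⟩ with hx
  have hwx : ∀ q : D.EigIdx, D.weight b₀ q = x q.1 := by
    rintro ⟨l, α⟩
    have := hperm (Pi.mulSingle l (Equiv.swap α ⟨0, D.m_pos l⟩)) ⟨l, α⟩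
    rw [← this, Equiv.sigmaCongrRight_apply]
    simp [hx]
  have hEx : ∀ θ, E b₀ θ = Complex.exp ((∑ q, (x q.1 : ℂ) * θ q) * Complex.I) := fun θ => by
    simp only [hE, hwx]
  refine ⟨x, ?_, ?_, ?_, ?_⟩
  · intro h0
    apply hφ₀
    rw [hEx, h0]
    simp
  · have h1 := D.sum_abs_weight_le b₀
    simp only [hwx] at h1
    rw [D.sum_eigIdx fun l => |x l|] at h1
    simpa using h1
  · have h1 := D.sum_weight b₀
    simp only [hwx] at h1
    rw [D.sum_eigIdx x] at h1
    simpa using h1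
  · intro A hA
    have hexp : ∀ θ : ℝ,
        Complex.exp ((∑ l, D.traceVec A l * (x l : ℂ)) * θ * Complex.I) = 1 := by
      intro θ
      obtain ⟨U, hU, -, hUe⟩ := D.exists_block_exp hHR hA θ
      change Complex.exp ((∑ l, (D.block A l).trace * (x l : ℂ)) * θ * Complex.I) = 1
      rw [← D.apply_exp_of_diagU c hc1 hcmul x (fun θ => (hcdiag θ).trans (hEx θ)) (D.block A)
        (D.block_isHermitian (mem_symOps_of_mem_lieAlg hHR hA) (isHermitian_of_mem_lieAlg hA))
        θ U hUe]
      exact hcval _ _ (by rw [hw'H _ hU, one_smul])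
    -- A one-point index type specialises the comparison of exponents to a single scalar.
    have h1 : (fun _ : Unit => ∑ l, D.traceVec A l * (x l : ℂ)) = fun _ => 0 := by
      refine eq_of_forall_exp_eq fun θ => ?_
      simp [hexp]
    exact congrFun h1 ()

end IrrepDecomposition

end InvariantVectors

/-! ### Determinant characters -/

section DetCharacter

/-- Products of elements of submodules of a commutative algebra graded by two submodules. -/
theorem prod_mem_pow_mul_pow {A ι : Type*} [CommRing A] [Algebra ℂ A] (E E' : Submodule ℂ A)
    (s : Finset ι) (f : ι → A) (a b : ι → ℕ) (h : ∀ i ∈ s, f i ∈ E ^ a i * E' ^ b i) :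
    ∏ i ∈ s, f i ∈ E ^ (∑ i ∈ s, a i) * E' ^ (∑ i ∈ s, b i) := by
  classical
  induction s using Finset.induction_on with
  | empty =>
    simp only [Finset.prod_empty, Finset.sum_empty, pow_zero, mul_one]
    exact Submodule.one_le.mp le_rfl
  | insert i s hi ih =>
    rw [Finset.prod_insert hi, Finset.sum_insert hi, Finset.sum_insert hi, pow_add, pow_add,
      mul_mul_mul_comm]
    exact Submodule.mul_mem_mul (h i (Finset.mem_insert_self i s))
      (ih fun j hj => h j (Finset.mem_insert_of_mem hj))

theorem prod_mem_pow_card {A ι : Type*} [CommRing A] [Algebra ℂ A] (E : Submodule ℂ A)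
    (s : Finset ι) (f : ι → A) (h : ∀ i ∈ s, f i ∈ E) : ∏ i ∈ s, f i ∈ E ^ s.card := by
  have := prod_mem_pow_mul_pow E E s f (fun _ => 1) (fun _ => 0) fun i hi => by
    simpa using h i hi
  simpa using this

/-- Every term of the Leibniz expansion is, up to sign, a product of m entries. Powers of a
submodule thus serve to count degrees. -/
theorem det_mem_pow {A : Type*} [CommRing A] [Algebra ℂ A] (E : Submodule ℂ A) {m : ℕ}
    (M : Matrix (Fin m) (Fin m) A) (h : ∀ i j, M i j ∈ E) : M.det ∈ E ^ m := by
  rw [Matrix.det_apply]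
  refine Submodule.sum_mem _ fun σ _ => ?_
  have h1 := prod_mem_pow_card E Finset.univ (fun i => M (σ i) i) fun i _ => h _ _
  rw [Finset.card_univ, Fintype.card_fin] at h1
  rcases Int.units_eq_one_or (Equiv.Perm.sign σ) with hs | hs
  · rw [hs, one_smul]
    exact h1
  · rw [hs, Units.neg_smul, one_smul]
    exact Submodule.neg_mem _ h1

variable {I : Type*} [Fintype I] [DecidableEq I] {G : Type*} [Group G]

namespace IrrepDecomposition

variable {R : G →* Matrix.unitaryGroup I ℂ} {Λ : Type*} [Fintype Λ]
  (D : IrrepDecomposition R Λ)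

/-- The character `∏_λ det(V_λ)^{x_λ}` of the symmetric unitaries. -/
def detChar (x : Λ → ℤ) (V : D.UTuple) : ℂ :=
  ∏ l, (V l : Matrix (Fin (D.m l)) (Fin (D.m l)) ℂ).det ^ x l

theorem det_mul_star (V : D.UTuple) (l : Λ) :
    (V l : Matrix (Fin (D.m l)) (Fin (D.m l)) ℂ).det *
      star (V l : Matrix (Fin (D.m l)) (Fin (D.m l)) ℂ).det = 1 := by
  rw [← Matrix.det_conjTranspose, ← Matrix.det_mul, ← Matrix.star_eq_conjTranspose,
    Matrix.mem_unitaryGroup_iff.mp (V l).2, Matrix.det_one]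

theorem det_ne_zero (V : D.UTuple) (l : Λ) :
    (V l : Matrix (Fin (D.m l)) (Fin (D.m l)) ℂ).det ≠ 0 :=
  left_ne_zero_of_mul (by rw [D.det_mul_star V l]; exact one_ne_zero)

theorem detChar_one (x : Λ → ℤ) : D.detChar x 1 = 1 := by
  simp [detChar]

theorem detChar_mul (x : Λ → ℤ) (V V' : D.UTuple) :
    D.detChar x (V * V') = D.detChar x V * D.detChar x V' := by
  simp only [detChar, Pi.mul_apply, Submonoid.coe_mul, Matrix.det_mul, mul_zpow,
    Finset.prod_mul_distrib]

theorem continuous_detChar (x : Λ → ℤ) : Continuous (D.detChar x) := by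
  refine continuous_finsetProd _ fun l _ => Continuous.zpow₀ ?_ _ fun V => Or.inl ?_
  · exact (continuous_subtype_val.comp (continuous_apply l)).matrix_det
  · exact D.det_ne_zero V l

theorem detChar_diagU (x : Λ → ℤ) (θ : D.EigIdx → ℝ) :
    D.detChar x (D.diagU θ) = Complex.exp ((∑ q, (x q.1 : ℂ) * θ q) * Complex.I) := by
  simp only [detChar, diagU, Matrix.det_diagonal]
  rw [Fintype.sum_sigma, Finset.sum_mul, Complex.exp_sum]
  refine Finset.prod_congr rfl fun l _ => ?_
  rw [← Complex.exp_sum, ← Complex.exp_int_mul]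
  congr 1
  rw [Finset.mul_sum, Finset.sum_mul]
  exact Finset.sum_congr rfl fun α _ => by ring

/-- The kernel of a determinant character, as a group of symmetric unitaries. -/
def detKer (x : Λ → ℤ) : Subgroup D.UTuple where
  carrier := {V | D.detChar x V = 1}
  one_mem' := D.detChar_one x
  mul_mem' {V V'} hV hV' := by
    change D.detChar x (V * V') = 1
    rw [detChar_mul, show D.detChar x V = 1 from hV, show D.detChar x V' = 1 from hV', one_mul]
  inv_mem' {V} hV := by
    have h1 := D.detChar_mul x V V⁻¹
    rw [mul_inv_cancel, detChar_one, show D.detChar x V = 1 from hV, one_mul] at h1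
    exact h1.symm

theorem isCompact_map_detKer (x : Λ → ℤ) :
    IsCompact ((D.detKer x).map D.ofUBlocks : Set (Matrix.unitaryGroup I ℂ)) := by
  rw [Subgroup.coe_map]
  refine IsCompact.image ?_ D.continuous_ofUBlocks
  exact (isClosed_eq (D.continuous_detChar x) continuous_const).isCompact

/-- A determinant character is trivial on a connected group if it is so infinitesimally. -/
theorem detChar_eq_one (x : Λ → ℤ) {S : Subgroup (Matrix.unitaryGroup I ℂ)}
    (hSR : S ≤ symUnitary R) (hS : IsCompact (S : Set (Matrix.unitaryGroup I ℂ)))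
    (hconn : IsConnected (S : Set (Matrix.unitaryGroup I ℂ)))
    (hx : ∀ A ∈ lieAlg S, ∑ l, D.traceVec A l * (x l : ℂ) = 0) (V : D.UTuple)
    (hV : D.ofUBlocks V ∈ S) : D.detChar x V = 1 := by
  -- The kernel of the character inside S is closed and, by the trace condition, contains every
  -- one-parameter group of S; connectedness makes it all of S.
  have hle : S ≤ S ⊓ (D.detKer x).map D.ofUBlocks := by
    refine le_of_lieAlg_subset hS hconn (hS.inter_right (D.isCompact_map_detKer x).isClosed)
      inf_le_left fun A hA θ => ?_
    obtain ⟨U, hU, hUA, hUe⟩ := D.exists_block_exp hSR hA θ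
    refine ⟨D.ofUBlocks U, ⟨hU, U, ?_, rfl⟩, hUA⟩
    change D.detChar x U = 1
    rw [D.apply_exp_of_diagU _ (D.detChar_one x) (D.detChar_mul x) x (D.detChar_diagU x)
      (D.block A) (D.block_isHermitian (mem_symOps_of_mem_lieAlg hSR hA)
        (isHermitian_of_mem_lieAlg hA)) θ U hUe]
    change Complex.exp ((∑ l, D.traceVec A l * (x l : ℂ)) * θ * Complex.I) = 1
    rw [hx A hA]
    simp
  obtain ⟨V', hV', h⟩ := (hle hV).2
  rw [← D.ofUBlocks_injective h]
  exact hV'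

/-- The matrix entries of symmetric unitaries, as functions of the blocks. -/
def entry (i j : I) (V : D.UTuple) : ℂ := (D.ofUBlocks V : Matrix I I ℂ) i j

/-- The span of the matrix entries of symmetric unitaries. -/
def entrySpan : Submodule ℂ (D.UTuple → ℂ) :=
  Submodule.span ℂ (Set.range fun ij : I × I => D.entry ij.1 ij.2)

/-- The span of the conjugate matrix entries of symmetric unitaries. -/
def conjEntrySpan : Submodule ℂ (D.UTuple → ℂ) :=
  Submodule.span ℂ (Set.range fun ij : I × I => star (D.entry ij.1 ij.2))

/-- From F_l† U F_l = 1 ⊗ V_l, an entry of V_l is the entry of the left-hand side at (a, α), (a, β)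
for any one a, and this is linear in the entries of U. -/
theorem blockEntry_mem (l : Λ) (α β : Fin (D.m l)) :
    (fun V : D.UTuple => (V l : Matrix (Fin (D.m l)) (Fin (D.m l)) ℂ) α β) ∈ D.entrySpan := by
  have a : Fin (D.r l) := ⟨0, Nat.pos_of_ne_zero (D.r_ne_zero l)⟩
  have h1 : (fun V : D.UTuple => (V l : Matrix (Fin (D.m l)) (Fin (D.m l)) ℂ) α β) =
      ∑ j, ∑ i, (star (D.F l i (a, α)) * D.F l j (a, β)) • D.entry i j := by
    funext V
    have h2 := congrFun (congrFun
      (D.conjTranspose_F_mul_ofBlocks_mul_F (D.coeTuple V) l) (a, α)) (a, β)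
    rw [Matrix.kroneckerMap_apply, Matrix.one_apply_eq, one_mul] at h2
    change D.coeTuple V l α β = _
    rw [← h2, Matrix.mul_apply]
    simp only [Matrix.mul_apply, Matrix.conjTranspose_apply, Finset.sum_apply, Pi.smul_apply,
      smul_eq_mul, Finset.sum_mul]
    refine Finset.sum_congr rfl fun j _ => Finset.sum_congr rfl fun i _ => ?_
    rw [entry, coe_ofUBlocks]
    ring
  rw [h1]
  exact Submodule.sum_mem _ fun j _ => Submodule.sum_mem _ fun i _ =>
    Submodule.smul_mem _ _ (Submodule.subset_span ⟨(i, j), rfl⟩)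

theorem star_mem_conjEntrySpan {f : D.UTuple → ℂ} (hf : f ∈ D.entrySpan) :
    star f ∈ D.conjEntrySpan := by
  induction hf using Submodule.span_induction with
  | mem f hf =>
    obtain ⟨ij, rfl⟩ := hf
    exact Submodule.subset_span ⟨ij, rfl⟩
  | zero => simp
  | add f g _ _ hf hg =>
    rw [star_add]
    exact Submodule.add_mem _ hf hg
  | smul c f _ hf =>
    rw [star_smul]
    exact Submodule.smul_mem _ _ hf

/-- Normalisation of one row of U. It serves to raise both degrees by one without changing the
function. -/
theorem one_mem_entrySpan_mul [Nonempty I] :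
    (1 : D.UTuple → ℂ) ∈ D.entrySpan * D.conjEntrySpan := by
  obtain ⟨i⟩ := ‹Nonempty I›
  have h1 : (1 : D.UTuple → ℂ) = ∑ j, D.entry i j * star (D.entry i j) := by
    funext V
    have h2 := congrFun (congrFun (Matrix.mem_unitaryGroup_iff.mp (D.ofUBlocks V).2) i) i
    rw [Matrix.mul_apply, Matrix.one_apply_eq] at h2
    rw [Pi.one_apply, ← h2, Finset.sum_apply]
    rfl
  rw [h1]
  exact Submodule.sum_mem _ fun j _ => Submodule.mul_mem_mul
    (Submodule.subset_span ⟨(i, j), rfl⟩) (Submodule.subset_span ⟨(i, j), rfl⟩)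

/-- A product of t entries and t conjugate entries is a single entry of the mixed tensor power. Such
products span, and the functions realised by linear functionals form a submodule, the range of Φ. -/
theorem exists_linearMap_of_mem {t : ℕ} {f : D.UTuple → ℂ}
    (hf : f ∈ D.entrySpan ^ t * D.conjEntrySpan ^ t) :
    ∃ L : Matrix ((Fin t → I) × (Fin t → I)) ((Fin t → I) × (Fin t → I)) ℂ →ₗ[ℂ] ℂ,
      ∀ V, L (mixedTensor t (D.ofUBlocks V : Matrix I I ℂ)) = f V := by
  let Φ : (Matrix ((Fin t → I) × (Fin t → I)) ((Fin t → I) × (Fin t → I)) ℂ →ₗ[ℂ] ℂ) →ₗ[ℂ]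
      (D.UTuple → ℂ) :=
    LinearMap.pi fun V => LinearMap.applyₗ (mixedTensor t (D.ofUBlocks V : Matrix I I ℂ))
  have hle : D.entrySpan ^ t * D.conjEntrySpan ^ t ≤ LinearMap.range Φ := by
    rw [entrySpan, conjEntrySpan, Submodule.span_pow, Submodule.span_pow, Submodule.span_mul_span,
      Submodule.span_le]
    rintro _ ⟨g, hg, g', hg', rfl⟩
    obtain ⟨g, rfl⟩ := Set.mem_pow.mp hg
    obtain ⟨g', rfl⟩ := Set.mem_pow.mp hg'
    choose p hp using fun s => (g s).2
    choose p' hp' using fun s => (g' s).2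
    refine ⟨Matrix.entryLinearMap ℂ ℂ (fun s => (p s).1, fun s => (p' s).1)
      (fun s => (p s).2, fun s => (p' s).2), ?_⟩
    funext V
    simp only [← hp, ← hp', List.prod_ofFn]
    simp [Φ, mixedTensor, entry]
  obtain ⟨L, hL⟩ := hle hf
  exact ⟨L, fun V => congrFun hL V⟩

/-- The determinant of a unitary has modulus one, so its negative powers are powers of its
conjugate. Positive parts of exponents thus count plain degrees and negative parts conjugate
degrees. -/
theorem det_zpow_mem (l : Λ) (k : ℤ) :
    (fun V : D.UTuple => (V l : Matrix (Fin (D.m l)) (Fin (D.m l)) ℂ).det ^ k) ∈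
      D.entrySpan ^ (D.m l * k.toNat) * D.conjEntrySpan ^ (D.m l * (-k).toNat) := by
  have hd : (fun V : D.UTuple => (V l : Matrix (Fin (D.m l)) (Fin (D.m l)) ℂ).det) =
      (Matrix.of fun α β => fun V : D.UTuple =>
        (V l : Matrix (Fin (D.m l)) (Fin (D.m l)) ℂ) α β).det := by
    funext V
    simp [Matrix.det_apply]
  have h1 : (fun V : D.UTuple => (V l : Matrix (Fin (D.m l)) (Fin (D.m l)) ℂ).det) ∈
      D.entrySpan ^ D.m l := by
    rw [hd]
    exact det_mem_pow _ _ fun α β => D.blockEntry_mem l α β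
  have h2 : star (fun V : D.UTuple => (V l : Matrix (Fin (D.m l)) (Fin (D.m l)) ℂ).det) ∈
      D.conjEntrySpan ^ D.m l := by
    have : star (fun V : D.UTuple => (V l : Matrix (Fin (D.m l)) (Fin (D.m l)) ℂ).det) =
        (Matrix.of fun α β => star fun V : D.UTuple =>
          (V l : Matrix (Fin (D.m l)) (Fin (D.m l)) ℂ) α β).det := by
      funext V
      simp [Matrix.det_apply']
    rw [this]
    exact det_mem_pow _ _ fun α β => D.star_mem_conjEntrySpan (D.blockEntry_mem l α β)
  rcases le_total 0 k with hk | hk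
  · lift k to ℕ using hk
    rw [Int.toNat_of_nonpos (by omega : -(k : ℤ) ≤ 0), mul_zero, pow_zero, mul_one,
      Int.toNat_natCast, pow_mul]
    simp only [zpow_natCast]
    exact Submodule.pow_mem_pow _ h1 k
  · obtain ⟨k, rfl⟩ : ∃ k' : ℕ, k = -(k' : ℤ) := ⟨(-k).toNat, by omega⟩
    rw [Int.toNat_of_nonpos hk, mul_zero, pow_zero, one_mul, neg_neg, Int.toNat_natCast, pow_mul]
    have h3 : (fun V : D.UTuple =>
        (V l : Matrix (Fin (D.m l)) (Fin (D.m l)) ℂ).det ^ (-(k : ℤ))) =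
        (star fun V : D.UTuple => (V l : Matrix (Fin (D.m l)) (Fin (D.m l)) ℂ).det) ^ k := by
      funext V
      rw [_root_.zpow_neg, zpow_natCast, ← inv_pow, inv_eq_of_mul_eq_one_right (D.det_mul_star V l)]
      rfl
    rw [h3]
    exact Submodule.pow_mem_pow _ h2 k

/-- Determinant characters of small weight are matrix coefficients of the mixed tensor power. -/
theorem exists_linearMap_detChar [Nonempty I] {t : ℕ} (x : Λ → ℤ)
    (h1 : ∑ l, (D.m l : ℤ) * |x l| ≤ 2 * (t : ℤ)) (h2 : ∑ l, (D.m l : ℤ) * x l = 0) :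
    ∃ L : Matrix ((Fin t → I) × (Fin t → I)) ((Fin t → I) × (Fin t → I)) ℂ →ₗ[ℂ] ℂ,
      ∀ V, L (mixedTensor t (D.ofUBlocks V : Matrix I I ℂ)) = D.detChar x V := by
  apply D.exists_linearMap_of_mem
  have h3 := prod_mem_pow_mul_pow D.entrySpan D.conjEntrySpan Finset.univ _ _ _
    fun l _ => D.det_zpow_mem l (x l)
  -- The plain degree. The condition ∑ m x = 0 makes the conjugate degree equal to it, and the bound
  -- on ∑ m|x| then says 2s ≤ 2t.
  set s := ∑ l, D.m l * (x l).toNat with hs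
  have hs' : ∑ l, D.m l * (-x l).toNat = s := by
    have : (∑ l, (D.m l : ℤ) * ((x l).toNat : ℤ)) - ∑ l, (D.m l : ℤ) * ((-x l).toNat : ℤ) = 0 := by
      rw [← Finset.sum_sub_distrib, ← h2]
      exact Finset.sum_congr rfl fun l _ => by rw [← mul_sub]; congr 1; omega
    zify
    rw [hs]
    push_cast
    linarith
  have hst : s ≤ t := by
    have : (∑ l, (D.m l : ℤ) * ((x l).toNat : ℤ)) + ∑ l, (D.m l : ℤ) * ((-x l).toNat : ℤ) ≤
        2 * t := by
      rw [← Finset.sum_add_distrib]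
      refine le_trans (le_of_eq (Finset.sum_congr rfl fun l _ => ?_)) h1
      rw [← mul_add]
      congr 1
      rcases abs_cases (x l) with h | h <;> omega
    have e1 : (s : ℤ) = ∑ l, (D.m l : ℤ) * ((x l).toNat : ℤ) := by
      rw [hs, Nat.cast_sum]
      exact Finset.sum_congr rfl fun l _ => Nat.cast_mul _ _
    have e2 : (s : ℤ) = ∑ l, (D.m l : ℤ) * ((-x l).toNat : ℤ) := by
      rw [← hs', Nat.cast_sum]
      exact Finset.sum_congr rfl fun l _ => Nat.cast_mul _ _
    omega
  rw [hs'] at h3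
  -- Multiply by t - s factors equal to 1 to reach degree exactly t on both sides.
  have h4 := Submodule.mul_mem_mul h3 (Submodule.pow_mem_pow _ D.one_mem_entrySpan_mul (t - s))
  rw [one_pow, mul_one, mul_pow, mul_mul_mul_comm, ← pow_add, ← pow_add,
    Nat.add_sub_cancel' hst] at h4
  convert h4 using 1
  funext V
  simp [detChar]

end IrrepDecomposition

end DetCharacter

/-! ### The design criterion for mixtures of connected groups -/

section Criterion

variable {I : Type*} [Fintype I] [DecidableEq I] {G : Type*} [Group G]

theorem lieAlg_mono {S S' : Subgroup (Matrix.unitaryGroup I ℂ)} (h : S ≤ S') :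
    lieAlg S ⊆ lieAlg S' := fun _ hA θ => by
  obtain ⟨U, hU, hUe⟩ := hA θ
  exact ⟨U, h hU, hUe⟩

namespace IrrepDecomposition

variable {R : G →* Matrix.unitaryGroup I ℂ} {Λ : Type*} [Fintype Λ]
  (D : IrrepDecomposition R Λ)

theorem sum_eq_zero_of_mem_relPhaseSpace_iff {Γ : Type*}
    (S : Γ → Subgroup (Matrix.unitaryGroup I ℂ)) (x : Λ → ℤ) :
    (∀ v ∈ D.relPhaseSpace S, ∑ l, v l * (x l : ℂ) = 0) ↔
      ∀ γ, ∀ A ∈ lieAlg (S γ), ∑ l, D.traceVec A l * (x l : ℂ) = 0 := by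
  refine ⟨fun h γ A hA => h _ (Submodule.subset_span ⟨γ, A, hA, rfl⟩), fun h v hv => ?_⟩
  induction hv using Submodule.span_induction with
  | mem v hv =>
    obtain ⟨γ, A, hA, rfl⟩ := hv
    exact h γ A hA
  | zero => simp
  | add v w _ _ hv hw =>
    simp only [Pi.add_apply, add_mul, Finset.sum_add_distrib, hv, hw, add_zero]
  | smul c v _ hv =>
    simp only [Pi.smul_apply, smul_mul_assoc, ← Finset.smul_sum, hv, smul_zero]

theorem nonempty_of_label (D : IrrepDecomposition R Λ) (l : Λ) : Nonempty I := by
  by_contra hI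
  rw [not_nonempty_iff] at hI
  have h := congrFun (congrFun (D.isometry l)
    (⟨0, Nat.pos_of_ne_zero (D.r_ne_zero l)⟩, ⟨0, D.m_pos l⟩))
    (⟨0, Nat.pos_of_ne_zero (D.r_ne_zero l)⟩, ⟨0, D.m_pos l⟩)
  rw [Matrix.mul_apply, Matrix.one_apply_eq] at h
  simp at h

/-- On the maximal torus the character is the exponential of the weight x, which is trivial only for
x = 0. -/
theorem exists_detChar_ne_one {x : Λ → ℤ} (hx : x ≠ 0) : ∃ V, D.detChar x V ≠ 1 := by
  classical
  by_contra! h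
  refine hx (funext fun l => ?_)
  have h1 : (fun q : D.EigIdx => (x q.1 : ℂ)) = fun _ => 0 := by
    refine eq_of_forall_exp_eq fun θ => ?_
    rw [← D.detChar_diagU, h]
    simp
  have h2 := congrFun h1 ⟨l, ⟨0, D.m_pos l⟩⟩
  exact_mod_cast h2

/-- The design criterion for a mixture of Haar measures of connected compact groups. -/
theorem isAsymptoticDesign_iff {Γ : Type*} [Fintype Γ] (t : ℕ) (p : Γ → ℝ) (hp : ∀ γ, 0 < p γ)
    (hp1 : ∑ γ, p γ = 1) (S : Γ → Subgroup (Matrix.unitaryGroup I ℂ))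
    (hSR : ∀ γ, S γ ≤ symUnitary R)
    (hconn : ∀ γ, IsConnected (S γ : Set (Matrix.unitaryGroup I ℂ)))
    (hcpt : ∀ γ, IsCompact (S γ : Set (Matrix.unitaryGroup I ℂ)))
    (huniv : SemiUniversal R (⋃ γ, (S γ : Set (Matrix.unitaryGroup I ℂ)))) :
    IsAsymptoticDesign R t (haarMixture p S hcpt) ↔
      ¬ ∃ x : Λ → ℤ, x ≠ 0 ∧
        ∑ l, (D.m l : ℤ) * |x l| ≤ 2 * (t : ℤ) ∧
        ∑ l, (D.m l : ℤ) * x l = 0 ∧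
        ∀ v ∈ D.relPhaseSpace S, ∑ l, v l * (x l : ℂ) = 0 := by
  classical
  constructor
  · rintro hdesign ⟨x, hx, h1, h2, h3⟩
    rw [sum_eq_zero_of_mem_relPhaseSpace_iff] at h3
    -- A nonzero x supplies a sector, so the space is nonzero and there is a matrix row to
    -- normalise.
    obtain ⟨l, -⟩ := Function.ne_iff.mp hx
    have := D.nonempty_of_label l
    obtain ⟨L, hL⟩ := D.exists_linearMap_detChar (t := t) x h1 h2
    -- The character lives on tuples of blocks. Transporting it through an inverse of the
    -- parametrisation defines it on the whole unitary group, but only its values on symmetric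
    -- unitaries matter.
    have hinv : ∀ V, Function.invFun D.ofUBlocks (D.ofUBlocks V) = V :=
      Function.leftInverse_invFun D.ofUBlocks_injective
    refine not_tendsto_momentOp_pow p S hcpt (symUnitary R) (isCompact_symUnitary R) t hp hp1 hSR
      L (fun u => D.detChar x (Function.invFun D.ofUBlocks u)) ?_ ?_ ?_ ?_ ?_ hdesign
    · have := hinv 1
      rw [map_one] at this
      simp only [this, detChar_one]
    · intro u hu w hw
      obtain ⟨V, rfl⟩ := D.exists_ofUBlocks hu
      obtain ⟨W, rfl⟩ := D.exists_ofUBlocks hw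
      rw [← map_mul, hinv, hinv, hinv, detChar_mul]
    · intro u hu
      obtain ⟨V, rfl⟩ := D.exists_ofUBlocks hu
      rw [hinv, hL]
    · intro γ u hu
      obtain ⟨V, rfl⟩ := D.exists_ofUBlocks (hSR γ hu)
      rw [hinv]
      exact D.detChar_eq_one x (hSR γ) (hcpt γ) (hconn γ) (h3 γ) V hu
    · obtain ⟨V, hV⟩ := D.exists_detChar_ne_one hx
      exact ⟨D.ofUBlocks V, D.ofUBlocks_mem V, by rwa [hinv]⟩
  · intro hno
    refine tendsto_momentOp_pow p S hcpt (symUnitary R) (isCompact_symUnitary R) t hp hp1 hSR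
      fun v hv => ?_
    by_contra! hnot
    have hle : Subgroup.closure (⋃ γ, (S γ : Set (Matrix.unitaryGroup I ℂ))) ≤ symUnitary R := by
      rw [Subgroup.closure_le]
      exact Set.iUnion_subset hSR
    obtain ⟨x, hx, h1, h2, h3⟩ := D.exists_weight_of_not_invariant
      (Subgroup.closure (⋃ γ, (S γ : Set (Matrix.unitaryGroup I ℂ)))) hle
      (fun u hu => by
        have hu' : u ∈ (symUnitary R : Set (Matrix.unitaryGroup I ℂ)) := hu
        rw [← show _ = _ from huniv] at hu'
        obtain ⟨h, hh, z, hz, rfl⟩ := Set.mem_mul.mp hu'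
        obtain ⟨φ, rfl⟩ := D.exists_phase_of_mem_symCenter hz
        exact ⟨h, hh, φ, rfl⟩) t v
      (fun h hh => by
        induction hh using Subgroup.closure_induction with
        | mem u hu =>
          obtain ⟨γ, hγ⟩ := Set.mem_iUnion.mp hu
          exact hv γ u hγ
        | one => rw [Submonoid.coe_one, mixedTensor_one, Matrix.one_mulVec]
        | mul a b _ _ ha hb =>
          rw [Submonoid.coe_mul, mixedTensor_mul, ← Matrix.mulVec_mulVec, hb, ha]
        | inv a _ ha =>
          have h4 := congrArg (fun w => mixedTensor t ((a⁻¹ : Matrix.unitaryGroup I ℂ) :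
            Matrix I I ℂ) *ᵥ w) ha
          simp only [Matrix.mulVec_mulVec, ← mixedTensor_mul, ← Submonoid.coe_mul,
            inv_mul_cancel, Submonoid.coe_one, mixedTensor_one, Matrix.one_mulVec] at h4
          exact h4.symm) hnot
    refine hno ⟨x, hx, h1, h2, (D.sum_eq_zero_of_mem_relPhaseSpace_iff S x).mpr fun γ A hA => ?_⟩
    -- Only the one-parameter groups inside each S γ are needed, so nothing has to be known about
    -- closedness or the full Lie algebra of the generated group.
    exact h3 A (lieAlg_mono (fun u hu =>
      Subgroup.subset_closure (Set.mem_iUnion.mpr ⟨γ, hu⟩)) hA)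

end IrrepDecomposition

end Criterion

/-! ### The unitary group of a star-algebra of matrices -/

section StarAlgebra

open scoped Matrix.Norms.L2Operator

variable {I : Type*} [Fintype I] [DecidableEq I]

theorem isClosed_starSubalgebra (W : StarSubalgebra ℂ (Matrix I I ℂ)) :
    IsClosed (W : Set (Matrix I I ℂ)) :=
  Submodule.closed_of_finiteDimensional (Subalgebra.toSubmodule W.toSubalgebra)

theorem exp_mem_starSubalgebra (W : StarSubalgebra ℂ (Matrix I I ℂ)) {A : Matrix I I ℂ}
    (hA : A ∈ W) : NormedSpace.exp A ∈ W := by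
  let : NormedAlgebra ℚ (Matrix I I ℂ) := NormedAlgebra.restrictScalars ℚ ℂ _
  exact NormedSpace.exp_mem (R := ℂ) (isClosed_starSubalgebra W) hA

/-- Every unitary element of a star-algebra of matrices is the exponential of `i` times a
Hermitian element. -/
theorem exists_exp_I_smul_eq (W : StarSubalgebra ℂ (Matrix I I ℂ)) {U : Matrix I I ℂ}
    (hU : U ∈ Matrix.unitaryGroup I ℂ) (hUW : U ∈ W) :
    ∃ A ∈ W, A.IsHermitian ∧ NormedSpace.exp (Complex.I • A) = U := by
  have hn : IsStarNormal U := ⟨by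
    rw [commute_iff_eq, Matrix.mem_unitaryGroup_iff.mp hU, Matrix.mem_unitaryGroup_iff'.mp hU]⟩
  -- The argument function jumps on the circle, but on a finite spectrum every function is
  -- continuous, so the functional calculus applies to it.
  have hf : ContinuousOn (fun z : ℂ => (Complex.arg z : ℂ)) (spectrum ℂ U) :=
    (Matrix.finite_spectrum U).continuousOn _
  have hW : IsClosed (W : Set (Matrix I I ℂ)) := isClosed_starSubalgebra W
  refine ⟨cfc (fun z : ℂ => (Complex.arg z : ℂ)) U, cfc_mem (𝕜' := ℂ) _ hUW,
    IsSelfAdjoint.cfc_arg U, ?_⟩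
  rw [← CFC.exp_eq_normedSpace_exp (𝕜 := ℂ), ← cfc_comp_smul .., ← cfc_comp' ..]
  conv_rhs => rw [← cfc_id' ℂ U]
  refine cfc_congr fun y hy => ?_
  have hy1 : ‖y‖ = 1 := spectrum.norm_eq_one_of_unitary hU hy
  -- On the unit circle the real part of the logarithm vanishes.
  have hlog : Complex.I * y.arg = Complex.log y :=
    Complex.ext (by simp [Complex.log_re, hy1]) (by simp [Complex.log_im])
  have hy0 : y ≠ 0 := by
    rintro rfl
    simp at hy1
  simpa [← Complex.exp_eq_exp_ℂ, hlog] using Complex.exp_log hy0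

variable {S : Subgroup (Matrix.unitaryGroup I ℂ)} {W : StarSubalgebra ℂ (Matrix I I ℂ)}

theorem exists_mem_eq_exp (h : ∀ U, U ∈ S ↔ (U : Matrix I I ℂ) ∈ W) {A : Matrix I I ℂ}
    (hA : A.IsHermitian) (hAW : A ∈ W) (θ : ℝ) :
    ∃ U ∈ S, (U : Matrix I I ℂ) = NormedSpace.exp (((θ : ℂ) * Complex.I) • A) := by
  have h1 : ((θ : ℂ) * Complex.I) • A ∈ skewAdjoint (Matrix I I ℂ) := by
    rw [skewAdjoint.mem_iff, star_smul, Matrix.star_eq_conjTranspose, hA.eq, ← neg_smul]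
    congr 1
    simp
  let : NormedAlgebra ℚ (Matrix I I ℂ) := NormedAlgebra.restrictScalars ℚ ℂ _
  exact ⟨⟨_, NormedSpace.exp_mem_unitary_of_mem_skewAdjoint h1⟩,
    (h _).mpr (exp_mem_starSubalgebra W (W.smul_mem hAW _)), rfl⟩

theorem mem_lieAlg_iff (h : ∀ U, U ∈ S ↔ (U : Matrix I I ℂ) ∈ W) (A : Matrix I I ℂ) :
    A ∈ lieAlg S ↔ A.IsHermitian ∧ A ∈ W := by
  refine ⟨fun hA => ⟨isHermitian_of_mem_lieAlg hA, ?_⟩, fun hA => exists_mem_eq_exp h hA.1 hA.2⟩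
  refine mem_of_forall_exp_mem (Subalgebra.toSubmodule W.toSubalgebra) (one_mem W) A fun θ => ?_
  obtain ⟨U, hU, hUe⟩ := hA θ
  rw [← hUe]
  exact (h U).mp hU

/-- The unitary group of a star-algebra of matrices is connected. -/
theorem isConnected_of_mem_iff (h : ∀ U, U ∈ S ↔ (U : Matrix I I ℂ) ∈ W) :
    IsConnected (S : Set (Matrix.unitaryGroup I ℂ)) := by
  refine ⟨⟨1, S.one_mem⟩, isPreconnected_of_forall 1 fun U hU => ?_⟩
  obtain ⟨A, hAW, hA, hAU⟩ := exists_exp_I_smul_eq W U.2 ((h U).mp hU)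
  -- The path θ ↦ exp(iθA) joins 1, at θ = 0, to U, at θ = 1, inside S.
  choose u huS hu using exists_mem_eq_exp h hA hAW
  refine ⟨Set.range u, Set.range_subset_iff.mpr huS, ⟨0, ?_⟩, ⟨1, ?_⟩, isPreconnected_range ?_⟩
  · apply Subtype.ext
    rw [hu]
    simp
  · apply Subtype.ext
    rw [hu]
    simpa using hAU
  · refine continuous_induced_rng.mpr ?_
    have h1 : (Subtype.val ∘ u) =
        fun θ : ℝ => NormedSpace.exp (((θ : ℂ) * Complex.I) • A) := funext hu
    rw [h1]
    let : NormedAlgebra ℚ (Matrix I I ℂ) := NormedAlgebra.restrictScalars ℚ ℂ _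
    exact NormedSpace.exp_continuous.comp (by fun_prop)

end StarAlgebra

/-! ### Operators on few sites -/

section Sites

/-- Separating the sites in the range of `e` from the others. -/
def splitSites {ι κ : Type*} (I : Type*) (e : ι ↪ κ) :
    (κ → I) ≃ (ι → I) × ({s // s ∉ Set.range e} → I) :=
  open Classical in
  { toFun := fun a => (a ∘ e, fun s => a s)
    invFun := fun p s => if h : s ∈ Set.range e then p.1 h.choose else p.2 ⟨s, h⟩
    left_inv := fun a => funext fun s => by
      by_cases h : s ∈ Set.range e
      · simp only [dif_pos h, Function.comp_apply, h.choose_spec]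
      · simp only [dif_neg h]
    right_inv := fun p => by
      refine Prod.ext (funext fun i => ?_) (funext fun s => ?_)
      · have h : e i ∈ Set.range e := ⟨i, rfl⟩
        simp only [Function.comp_apply, dif_pos h]
        exact congrArg p.1 (e.injective h.choose_spec)
      · simp only [dif_neg s.2] }

theorem embedOp_trans {ι κ μ I : Type*} (f : ι ↪ κ) (e : κ ↪ μ)
    (A : Matrix (ι → I) (ι → I) ℂ) :
    embedOp (f.trans e) A = embedOp e (embedOp f A) := by
  classical
  ext a b
  simp only [embedOp, Matrix.of_apply]
  by_cases h : ∀ s, s ∉ Set.range e → a s = b s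
  · rw [if_pos h]
    by_cases h' : ∀ s, s ∉ Set.range f → (a ∘ e) s = (b ∘ e) s
    · rw [if_pos h', if_pos]
      · rfl
      · intro s hs
        by_cases hse : s ∈ Set.range e
        · obtain ⟨j, rfl⟩ := hse
          exact h' j fun ⟨i, hi⟩ => hs ⟨i, congrArg e hi⟩
        · exact h s hse
    · rw [if_neg h', if_neg]
      exact fun h'' => h' fun j hj => h'' (e j) fun ⟨i, hi⟩ => hj ⟨i, e.injective hi⟩
  · rw [if_neg h, if_neg]
    exact fun h'' => h fun s hs => h'' s fun ⟨i, hi⟩ => hs ⟨f i, hi⟩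

/-- The bijection between the two ranges extends to a permutation because κ is finite. -/
theorem exists_perm_trans_eq {ι κ : Type*} [Finite κ]
    (e e' : ι ↪ κ) :
    ∃ π : Equiv.Perm κ, e.trans π.toEmbedding = e' := by
  classical
  have := Fintype.ofFinite κ
  let g : {s // s ∈ Set.range e} ≃ {s // s ∈ Set.range e'} :=
    (Equiv.ofInjective e e.injective).symm.trans (Equiv.ofInjective e' e'.injective)
  refine ⟨g.extendSubtype, ?_⟩
  ext i
  change g.extendSubtype (e i) = e' i
  rw [g.extendSubtype_apply_of_mem _ ⟨i, rfl⟩]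
  have : (Equiv.ofInjective e e.injective).symm ⟨e i, i, rfl⟩ = i :=
    Equiv.ofInjective_symm_apply e.injective i
  simp [g, this]

/-- Once the sites are separated, local operators are A ⊗ 1 and T^{⊗κ} factorises, so symmetry can
be tested by the algebra of Kronecker products. -/
theorem embedOp_eq_submatrix {ι κ I : Type*} [Fintype ι] [Fintype κ] [DecidableEq κ]
    [DecidableEq I] (e : ι ↪ κ) (A : Matrix (ι → I) (ι → I) ℂ) :
    embedOp e A = (A ⊗ₖ (1 : Matrix ({s // s ∉ Set.range e} → I) _ ℂ)).submatrix
      (splitSites I e) (splitSites I e) := by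
  classical
  ext a b
  simp only [embedOp, Matrix.of_apply, Matrix.submatrix_apply, Matrix.kroneckerMap_apply,
    Matrix.one_apply, mul_ite, mul_one, mul_zero, splitSites, Equiv.coe_fn_mk, funext_iff,
    Subtype.forall]
  congr

theorem tensorPow_eq_submatrix {ι κ I : Type*} [Fintype ι] [Fintype κ] [DecidableEq κ]
    (e : ι ↪ κ) (M : Matrix I I ℂ) :
    tensorPow κ M = (tensorPow ι M ⊗ₖ tensorPow {s // s ∉ Set.range e} M).submatrix
      (splitSites I e) (splitSites I e) := by
  ext a b
  simp only [tensorPow, Matrix.of_apply, Matrix.submatrix_apply, Matrix.kroneckerMap_apply,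
    splitSites, Equiv.coe_fn_mk, Function.comp_apply]
  rw [← Fintype.prod_subtype_mul_prod_subtype (fun s => s ∈ Set.range e)]
  congr 1
  convert ((Equiv.ofInjective e e.injective).prod_comp fun s => M (a s) (b s)).symm <;> rfl

theorem embedOp_submatrix {ι κ I : Type*} (e : ι ↪ κ) (π : Equiv.Perm κ) (A : Matrix (ι → I) (ι → I) ℂ) :
    (embedOp e A).submatrix (π.arrowCongr (Equiv.refl I)).symm (π.arrowCongr (Equiv.refl I)).symm =
      embedOp (e.trans π.toEmbedding) A := by
  ext a b
  simp only [embedOp, Matrix.of_apply, Matrix.submatrix_apply]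
  congr 1
  refine propext ⟨fun h s hs => ?_, fun h s hs => ?_⟩
  · have := h (π.symm s) fun ⟨i, hi⟩ => hs ⟨i, by simp [hi]⟩
    simpa using this
  · have := h (π s) fun ⟨i, hi⟩ => hs ⟨i, π.injective hi⟩
    simpa using this

theorem tensorPow_submatrix {κ I : Type*} [Fintype κ] (π : Equiv.Perm κ) (M : Matrix I I ℂ) :
    (tensorPow κ M).submatrix (π.arrowCongr (Equiv.refl I)).symm
      (π.arrowCongr (Equiv.refl I)).symm = tensorPow κ M := by
  ext a b
  simp only [tensorPow, Matrix.of_apply, Matrix.submatrix_apply]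
  exact Equiv.prod_comp π fun s => M (a s) (b s)

theorem permU_mul_mul_inv {n : Type*} [Fintype n] [DecidableEq n] (σ : Equiv.Perm n)
    (A : Matrix n n ℂ) : (permU σ : Matrix n n ℂ) * A * ((permU σ)⁻¹ : Matrix.unitaryGroup n ℂ) =
      A.submatrix σ σ := by
  have h : ((permU σ)⁻¹ : Matrix.unitaryGroup n ℂ) =
      (star (permU σ : Matrix n n ℂ)) := rfl
  rw [h]
  ext i j
  simp [permU, Matrix.mul_apply, Matrix.one_apply, Matrix.star_apply]

variable {ι κ I : Type*} [Fintype ι] [Fintype κ] [DecidableEq ι] [DecidableEq κ]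
  [Fintype I] [DecidableEq I]
  {G : Type*} [Group G] (T : G →* Matrix.unitaryGroup I ℂ)

/-- T^{⊗κ} acts in the same way on every site, so relabelling the sites leaves it unchanged. -/
theorem permU_mem_symUnitary (π : Equiv.Perm κ) :
    permU (π.arrowCongr (Equiv.refl I)).symm ∈ symUnitary (tensorPowRep κ T) := fun g => by
  rw [← mul_inv_eq_iff_eq_mul]
  exact Subtype.ext ((permU_mul_mul_inv _ _).trans (tensorPow_submatrix π _))

/-- A local operator is symmetric if and only if it is so on its sites. -/
theorem embedOp_mem_symOps_iff (e : ι ↪ κ) (A : Matrix (ι → I) (ι → I) ℂ) :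
    embedOp e A ∈ symOps (tensorPowRep κ T) ↔ A ∈ symOps (tensorPowRep ι T) := by
  refine forall_congr' fun g => ?_
  change embedOp e A * tensorPow κ (T g : Matrix I I ℂ) =
    tensorPow κ (T g : Matrix I I ℂ) * embedOp e A ↔
    A * tensorPow ι (T g : Matrix I I ℂ) = tensorPow ι (T g : Matrix I I ℂ) * A
  rw [embedOp_eq_submatrix, tensorPow_eq_submatrix e, Matrix.submatrix_mul_equiv,
    Matrix.submatrix_mul_equiv, ← Matrix.mul_kronecker_mul, ← Matrix.mul_kronecker_mul,
    Matrix.one_mul, Matrix.mul_one]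
  constructor
  · intro h
    -- For zero-dimensional qudits the remaining sites may carry no configuration `c`; but then all
    -- the matrices have size at most one and commute.
    rcases isEmpty_or_nonempty I with hI | hI
    · ext a b
      rw [Subsingleton.elim b a, Matrix.mul_apply, Matrix.mul_apply, Fintype.sum_subsingleton _ a,
        Fintype.sum_subsingleton _ a, mul_comm]
    · obtain ⟨c⟩ : Nonempty ({s // s ∉ Set.range e} → I) := inferInstance
      -- The unitary T(g)^{⊗} on the remaining sites is cancelled by its adjoint, leaving both sides
      -- tensored with 1; a diagonal entry of that factor extracts them.
      have h1 := congrArg (fun M => M * ((1 : Matrix (ι → I) (ι → I) ℂ) ⊗ₖ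
        star (tensorPow {s // s ∉ Set.range e} (T g : Matrix I I ℂ))))
        ((Matrix.reindex (α := ℂ) (splitSites I e).symm (splitSites I e).symm).injective
          (a₁ := (A * tensorPow ι (T g : Matrix I I ℂ)) ⊗ₖ tensorPow _ (T g : Matrix I I ℂ))
          (a₂ := (tensorPow ι (T g : Matrix I I ℂ) * A) ⊗ₖ tensorPow _ (T g : Matrix I I ℂ)) h)
      simp only [← Matrix.mul_kronecker_mul, Matrix.mul_one, ← tensorPow_star, ← tensorPow_mul,
        Matrix.mem_unitaryGroup_iff.mp (T g).2, tensorPow_one] at h1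
      ext a b
      simpa using congrFun (congrFun h1 (a, c)) (b, c)
  · intro h
    rw [h]

end Sites

/-! ### Sector traces of local operators -/

section LocalGates

namespace IrrepDecomposition

variable {I : Type*} [Fintype I] [DecidableEq I] {G : Type*} [Group G]
  {R : G →* Matrix.unitaryGroup I ℂ} {Λ : Type*} [Fintype Λ] (D : IrrepDecomposition R Λ)

theorem traceVec_add (A B : Matrix I I ℂ) :
    D.traceVec (A + B) = D.traceVec A + D.traceVec B := by
  funext l
  simp [traceVec, block, Matrix.trace, Matrix.mul_add, Matrix.add_mul, Finset.sum_add_distrib,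
    mul_add]

theorem traceVec_smul (c : ℂ) (A : Matrix I I ℂ) : D.traceVec (c • A) = c • D.traceVec A := by
  funext l
  simp [traceVec, block, Matrix.trace, Finset.mul_sum, mul_left_comm]

theorem traceVec_one (l : Λ) : D.traceVec 1 l = D.m l := by
  have h := D.block_ofBlocks 1
  rw [map_one] at h
  simp [traceVec, h]

/-- In block form this is conjugation within each sector, and the trace is cyclic. -/
theorem traceVec_conj {U : Matrix.unitaryGroup I ℂ} (hU : U ∈ symUnitary R) {A : Matrix I I ℂ}
    (hA : A ∈ symOps R) :
    D.traceVec ((U : Matrix I I ℂ) * A * (U⁻¹ : Matrix.unitaryGroup I ℂ)) = D.traceVec A := by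
  obtain ⟨V, rfl⟩ := D.exists_ofUBlocks hU
  have h : (D.ofUBlocks V : Matrix I I ℂ) * A * ((D.ofUBlocks V)⁻¹ : Matrix.unitaryGroup I ℂ) =
      D.ofBlocks (D.coeTuple V * D.block A * D.coeTuple V⁻¹) := by
    rw [map_mul, map_mul, D.ofBlocks_block hA, ← coe_ofUBlocks, ← coe_ofUBlocks, map_inv]
  funext l
  rw [h, traceVec, block_ofBlocks, Pi.mul_apply, Pi.mul_apply, Matrix.trace_mul_comm,
    ← Matrix.mul_assoc, ← Pi.mul_apply, ← map_mul, inv_mul_cancel, map_one, Pi.one_apply,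
    Matrix.one_mul]
  rfl

/-- The sector traces of a local operator do not depend on the sites it acts on. -/
theorem traceVec_embedOp_congr {ι κ J : Type*} [Fintype ι] [Fintype κ] [DecidableEq ι]
    [DecidableEq κ] [Fintype J] [DecidableEq J] {T : G →* Matrix.unitaryGroup J ℂ}
    (D : IrrepDecomposition (tensorPowRep κ T) Λ) (e e' : ι ↪ κ)
    {A : Matrix (ι → J) (ι → J) ℂ} (hA : A ∈ symOps (tensorPowRep ι T)) :
    D.traceVec (embedOp e A) = D.traceVec (embedOp e' A) := by
  obtain ⟨π, rfl⟩ := exists_perm_trans_eq e e'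
  rw [← embedOp_submatrix, ← permU_mul_mul_inv, D.traceVec_conj (permU_mem_symUnitary T π)
    ((embedOp_mem_symOps_iff T e A).mpr hA)]

end IrrepDecomposition

variable {n d : ℕ} {G : Type*} [Group G]

/-- The star-algebra of symmetric operators acting on the sites in `s`. -/
def localStarAlg (R : G →* Matrix.unitaryGroup (Fin n → Fin d) ℂ) (s : Finset (Fin n)) :
    StarSubalgebra ℂ (Matrix (Fin n → Fin d) (Fin n → Fin d) ℂ) where
  carrier := {B | B ∈ symOps R ∧ ∃ A : Matrix (s → Fin d) (s → Fin d) ℂ,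
    B = embedOp (Function.Embedding.subtype fun i => i ∈ s) A}
  mul_mem' := by
    rintro B B' ⟨hB, A, rfl⟩ ⟨hB', A', rfl⟩
    exact ⟨fun g => by rw [Matrix.mul_assoc, hB' g, ← Matrix.mul_assoc, hB g, Matrix.mul_assoc],
      A * A', (embedOp_mul _ _ _).symm⟩
  add_mem' := by
    rintro B B' ⟨hB, A, rfl⟩ ⟨hB', A', rfl⟩
    exact ⟨(symOpsSubmodule R).add_mem hB hB', A + A', ((embedLin _).map_add A A').symm⟩
  algebraMap_mem' c := by
    rw [Algebra.algebraMap_eq_smul_one]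
    refine ⟨fun g => by simp, c • 1, ?_⟩
    rw [← embedOp_one (Function.Embedding.subtype fun i => i ∈ s)]
    exact ((embedLin _).map_smul c 1).symm
  star_mem' := by
    rintro B ⟨hB, A, rfl⟩
    refine ⟨fun g => ?_, star A, (embedOp_star _ _).symm⟩
    have h := congrArg star (hB g⁻¹)
    have hg : star ((R g)⁻¹ : Matrix.unitaryGroup (Fin n → Fin d) ℂ).1 = (R g).1 := star_star _
    rw [map_inv, star_mul, star_mul, hg] at h
    exact h.symm

theorem localSymUnitary_le (R : G →* Matrix.unitaryGroup (Fin n → Fin d) ℂ)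
    (s : Finset (Fin n)) : localSymUnitary R s ≤ symUnitary R := fun _ hU => hU.1

theorem mem_localSymUnitary_iff (R : G →* Matrix.unitaryGroup (Fin n → Fin d) ℂ)
    (s : Finset (Fin n)) (U : Matrix.unitaryGroup (Fin n → Fin d) ℂ) :
    U ∈ localSymUnitary R s ↔
      (U : Matrix (Fin n → Fin d) (Fin n → Fin d) ℂ) ∈ localStarAlg R s :=
  and_congr (forall_congr' fun _ => Subtype.ext_iff) Iff.rfl

theorem isConnected_localSymUnitary (R : G →* Matrix.unitaryGroup (Fin n → Fin d) ℂ)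
    (s : Finset (Fin n)) :
    IsConnected (localSymUnitary R s : Set (Matrix.unitaryGroup (Fin n → Fin d) ℂ)) :=
  isConnected_of_mem_iff (mem_localSymUnitary_iff R s)

variable {Λ : Type*} [Fintype Λ] {T : G →* Matrix.unitaryGroup (Fin d) ℂ}
  (D : IrrepDecomposition (tensorPowRep (Fin n) T) Λ)

/-- A real-linear condition on sector traces of Hermitian elements of a star-algebra holds for
all its elements. -/
theorem sum_traceVec_eq_zero_of_isHermitian {I : Type*} [Fintype I] [DecidableEq I]
    {R : G →* Matrix.unitaryGroup I ℂ} (D : IrrepDecomposition R Λ)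
    (W : StarSubalgebra ℂ (Matrix I I ℂ)) (x : Λ → ℂ)
    (h : ∀ A : Matrix I I ℂ, A.IsHermitian → A ∈ W → ∑ l, D.traceVec A l * x l = 0)
    {B : Matrix I I ℂ} (hB : B ∈ W) : ∑ l, D.traceVec B l * x l = 0 := by
  have h1 := h (B + star B) (IsSelfAdjoint.add_star_self B) (add_mem hB (star_mem hB))
  have h2 := h (Complex.I • (star B - B))
    (by
      change star _ = _
      rw [star_smul, star_sub, star_star, Complex.star_def, Complex.conj_I, neg_smul, ← smul_neg,
        neg_sub])
    (SMulMemClass.smul_mem _ (sub_mem (star_mem hB) hB))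
  -- Twice B is the Hermitian B + B* plus i times the Hermitian i(B* - B), and sector traces are
  -- complex-linear.
  have h3 : B = (2⁻¹ : ℂ) • ((B + star B) + Complex.I • (Complex.I • (star B - B))) := by
    rw [smul_smul, Complex.I_mul_I, neg_one_smul, neg_sub, add_add_sub_cancel, ← two_smul ℂ B,
      smul_smul, inv_mul_cancel₀ two_ne_zero, one_smul]
  rw [h3, D.traceVec_smul, D.traceVec_add, D.traceVec_smul Complex.I]
  simp only [Pi.smul_apply, Pi.add_apply, smul_eq_mul, mul_assoc, add_mul, mul_add,
    Finset.sum_add_distrib, ← Finset.mul_sum, h1, h2, mul_zero, add_zero]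

/-- The conditions on the sector traces of the local Lie algebras amount to conditions on the
sector traces of the operators on `k` qudits. -/
theorem relPhaseSpace_iff_localTraceVecs {Γ : Type*} [Fintype Γ] [Nonempty Γ]
    (loc : Γ → Finset (Fin n)) (x : Λ → ℤ) :
    (∑ l, (D.m l : ℤ) * x l = 0 ∧
      ∀ v ∈ D.relPhaseSpace (fun γ => localSymUnitary (tensorPowRep (Fin n) T) (loc γ)),
        ∑ l, v l * (x l : ℂ) = 0) ↔
      ∀ c ∈ localTraceVecs T D (locality_le loc), ∑ l, c l * (x l : ℂ) = 0 := by
  rw [D.sum_eq_zero_of_mem_relPhaseSpace_iff]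
  simp only [mem_lieAlg_iff (mem_localSymUnitary_iff _ _)]
  constructor
  · rintro ⟨-, h⟩ _ ⟨A, hA, rfl⟩
    -- A set γ attaining the maximum has exactly k sites, so A can be moved from the first k sites
    -- onto γ without changing its sector traces.
    obtain ⟨γ, -, hγ⟩ := Finset.exists_mem_eq_sup Finset.univ Finset.univ_nonempty
      fun γ => (loc γ).card
    let e : Fin (locality loc) ≃ loc γ := (finCongr hγ).trans (loc γ).equivFin.symm
    rw [padOp, D.traceVec_embedOp_congr _
      (e.toEmbedding.trans (Function.Embedding.subtype fun i => i ∈ loc γ)) hA]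
    refine sum_traceVec_eq_zero_of_isHermitian D
      (localStarAlg (tensorPowRep (Fin n) T) (loc γ)) (fun l => (x l : ℂ))
      (fun B hB hBW => h γ B ⟨hB, hBW⟩) 
      ⟨(embedOp_mem_symOps_iff T _ A).mpr hA, embedOp e.toEmbedding A, ?_⟩
    exact embedOp_trans _ _ _
  · intro h
    constructor
    -- The identity operator has sector traces m_λ, which yields (2).
    · have h1 := h _ ⟨1, fun g => by simp, rfl⟩
      rw [padOp, embedOp_one] at h1
      simp only [D.traceVec_one] at h1
      exact_mod_cast h1
    · rintro γ _ ⟨-, hAR, A, rfl⟩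
      rw [embedOp_mem_symOps_iff] at hAR
      have hcard : (loc γ).card ≤ locality loc :=
        Finset.le_sup (f := fun γ => (loc γ).card) (Finset.mem_univ γ)
      -- A set with at most k sites fits into the first k; the operator is padded there by the
      -- identity, which preserves its symmetry.
      let f : loc γ ↪ Fin (locality loc) :=
        (loc γ).equivFin.toEmbedding.trans (Fin.castLEEmb hcard)
      rw [D.traceVec_embedOp_congr _ (f.trans (Fin.castLEEmb (locality_le loc))) hAR,
        embedOp_trans]
      exact h _ ⟨embedOp f A, (embedOp_mem_symOps_iff T f A).mpr hAR, rfl⟩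

end LocalGates

end SymDesign

end

/-! ### The theorem: general criterion and local gates -/

open SymDesign in
theorem theorem1 {G : Type*} [Group G] (n d t : ℕ) (hn : 0 < n) (ht : 0 < t)
    {Γ : Type*} [Fintype Γ] [Nonempty Γ] {Λ : Type*} [Fintype Λ]
    (p : Γ → ℝ) (hp : ∀ γ, 0 < p γ) (hp1 : ∑ γ, p γ = 1) :
    (∀ (R : G →* Matrix.unitaryGroup (Fin n → Fin d) ℂ) (D : IrrepDecomposition R Λ)
        (S : Γ → Subgroup (Matrix.unitaryGroup (Fin n → Fin d) ℂ))
        (_ : ∀ γ, S γ ≤ symUnitary R)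
        (_ : ∀ γ, IsConnected (S γ : Set (Matrix.unitaryGroup (Fin n → Fin d) ℂ)))
        (hcpt : ∀ γ, IsCompact (S γ : Set (Matrix.unitaryGroup (Fin n → Fin d) ℂ)))
        (_ : SemiUniversal R (⋃ γ, (S γ : Set (Matrix.unitaryGroup (Fin n → Fin d) ℂ)))),
        IsAsymptoticDesign R t (haarMixture p S hcpt) ↔
          ¬ ∃ x : Λ → ℤ, x ≠ 0 ∧
            ∑ l, (D.m l : ℤ) * |x l| ≤ 2 * (t : ℤ) ∧
            ∑ l, (D.m l : ℤ) * x l = 0 ∧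
            ∀ v ∈ D.relPhaseSpace S, ∑ l, v l * (x l : ℂ) = 0) ∧
    (∀ (T : G →* Matrix.unitaryGroup (Fin d) ℂ)
        (D : IrrepDecomposition (tensorPowRep (Fin n) T) Λ) (loc : Γ → Finset (Fin n)),
        (∀ x : Λ → ℤ,
          (∑ l, (D.m l : ℤ) * x l = 0 ∧
            ∀ v ∈ D.relPhaseSpace (fun γ => localSymUnitary (tensorPowRep (Fin n) T) (loc γ)),
              ∑ l, v l * (x l : ℂ) = 0) ↔
          ∀ c ∈ localTraceVecs T D (locality_le loc), ∑ l, c l * (x l : ℂ) = 0) ∧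
        (SemiUniversal (tensorPowRep (Fin n) T)
            (⋃ γ, (localSymUnitary (tensorPowRep (Fin n) T) (loc γ) :
              Set (Matrix.unitaryGroup (Fin n → Fin d) ℂ))) →
          (IsAsymptoticDesign (tensorPowRep (Fin n) T) t
              (haarMixture p (fun γ => localSymUnitary (tensorPowRep (Fin n) T) (loc γ))
                (fun γ => isCompact_localSymUnitary (tensorPowRep (Fin n) T) (loc γ))) ↔
            ¬ ∃ x : Λ → ℤ, x ≠ 0 ∧
              ∑ l, (D.m l : ℤ) * |x l| ≤ 2 * (t : ℤ) ∧
              ∀ c ∈ localTraceVecs T D (locality_le loc), ∑ l, c l * (x l : ℂ) = 0))) := by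
  refine ⟨fun R D S hSR hconn hcpt huniv =>
    D.isAsymptoticDesign_iff t p hp hp1 S hSR hconn hcpt huniv, fun T D loc => ?_⟩
  refine ⟨relPhaseSpace_iff_localTraceVecs D loc, fun huniv => ?_⟩
  rw [D.isAsymptoticDesign_iff t p hp hp1 _ (fun γ => localSymUnitary_le _ _)
    (fun γ => isConnected_localSymUnitary _ _) _ huniv]
  simp only [relPhaseSpace_iff_localTraceVecs D loc]
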